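/- Throughout, $\mathbf{k}$ is an algebraically closed field of characteristic zero, and algebras are associative unital $\mathbf{k}$-algebras. **Algebras.** Let $A=\bigoplus_{d\in\mathbb{Z}}A(d)$ be a $\mathbb{Z}$-graded algebra, each $A(d)$ being endowed with a linear topology, and put $F_pA=\bigoplus_{d\le p}A(d)$, $F^\vee_pA=\bigoplus_{d\ge -p}A(d)$. For $n\in\mathbb{N}=\{0,1,2,\dots\}$ let $I_n(A(d))$ and $I^\vee_n(A(d))$ be the closures in $A(d)$ of $A(d)\cap(A\cdot F_{-n-1}A)$ and of $A(d)\cap(F^\vee_{-n-1}A\cdot A)$, and put $I_n(A)=\bigoplus_d I_n(A(d))$, $I^\vee_n(A)=\bigoplus_d I^\vee_n(A(d))$. Then $A$ is a *quasi-finite algebra* if the multiplications $A(d)\times A(e)\to A(d+e)$ are continuous, the spaces $I_n(A(d))$ $(n\in\mathbb{N})$ form a fundamental system of neighbourhoods of zero in $A(d)$, each $A(d)$ is complete and separated, and all the spaces $A(d)/I_n(A(d))$ are finite-dimensional. A *Hamiltonian* is an element $h\in A(0)$ such that $A(d)=\{a\in A\mid ha-ah=da\}$ for all $d\in\mathbb{Z}$.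 The *left filterwise completion* of $A$ is the algebra $\mathcal{A}=\bigcup_pF_p\mathcal{A}$, $F_p\mathcal{A}=\varprojlim_nF_pA/(F_pA\cap I_n(A))$, with the linear topology defined by $I_n(\mathcal{A})=\mathrm{Ker}(\mathcal{A}\to A/I_n(A))$. The *right filterwise completion* $\mathcal{A}^\vee=\bigcup_pF^\vee_p\mathcal{A}^\vee$ with the topology defined by $I^\vee_n(\mathcal{A}^\vee)=\mathrm{Ker}(\mathcal{A}^\vee\to A/I^\vee_n(A))$ is defined in the same way from $F^\vee_pA$ and $I^\vee_n(A)$. **The algebras $A_n$.** Let $\Omega_0\subset\mathbf{k}$ be the set of roots of the minimal polynomial of the image of $h$ in the finite-dimensional algebra $A(0)/I_0(A(0))$. Let $\Gamma_0$ be the set of the elements of $\Omega_0$ that are minimal for the partial order in which $\lambda$ is at least $\mu$ when $\lambda-\mu\in\mathbb{N}$, let $\Gamma_n=\{\gamma+j\mid\gamma\in\Gamma_0,\ j\in\mathbb{N},\ j\le n\}$, and let $g=\max\{\lambda-\mu\mid\lambda,\mu\in\Omega_0,\ \lambda-\mu\in\mathbb{N}\}$ (with $g=0$ if $\Omega_0=\emptyset$).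 Let $A[\lambda,\mu]=\{a\in A\mid(h-\lambda)^ra=a(h-\mu)^r=0\text{ for some }r\in\mathbb{N}\}$ and $A_n=\sum_{\lambda,\mu\in\Gamma_n}A[\lambda,\mu]$, which is closed under multiplication. **Modules.** A *quasi-finite left $\mathcal{A}$-module* is a left $\mathcal{A}$-module $M$ such that every $v\in M$ satisfies $I_m(\mathcal{A})\cdot v=0$ for some $m$, and the space $\{v\in M\mid I_n(\mathcal{A})\cdot v=0\}$ is finite-dimensional for every $n\in\mathbb{N}$; morphisms are all $\mathcal{A}$-linear maps. A *quasi-finite left $\mathcal{A}^\vee$-module* is a linearly topologized left $\mathcal{A}^\vee$-module $\mathcal{M}$ with continuous action $\mathcal{A}^\vee\times\mathcal{M}\to\mathcal{M}$ such that the closures $I^\vee_n(\mathcal{M})$ of $F^\vee_{-n-1}\mathcal{A}^\vee\cdot\mathcal{M}$ $(n\in\mathbb{N})$ form a fundamental system of neighbourhoods of zero, $\mathcal{M}$ is complete and separated, and all $\mathcal{M}/I^\vee_n(\mathcal{M})$ are finite-dimensional; morphisms are the continuous $\mathcal{A}^\vee$-linear maps. *Quasi-finite right $\mathcal{A}^\vee$-modules*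 are defined like quasi-finite left $\mathcal{A}$-modules, with right modules and $I^\vee_n(\mathcal{A}^\vee)$; *quasi-finite right $\mathcal{A}$-modules* are defined like quasi-finite left $\mathcal{A}^\vee$-modules, with right modules and $F_{-n-1}\mathcal{A}$. **Theorem.** Let $A$ be a quasi-finite algebra with a Hamiltonian $h$ and let $n\ge g$ be an integer. Then the algebra $A_n$ has a unity. Consider the categories - L1: quasi-finite left $\mathcal{A}$-modules; L2: quasi-finite left $\mathcal{A}^\vee$-modules; L3: finitely generated left $A_n$-modules; - R1: quasi-finite right $\mathcal{A}^\vee$-modules; R2: quasi-finite right $\mathcal{A}$-modules; R3: finitely generated right $A_n$-modules. 1. L1, L2 and L3 are equivalent to each other. 2. R1, R2 and R3 are equivalent to each other. 3. Each of L1, L2, L3 is dual to each of R1, R2, R3, i.e. the opposite category of the former is equivalent to the latter. 4. If there is a linear map $\theta:A\to A$ with $\theta\circ\theta=\mathrm{id}$, $\theta(ab)=\theta(b)\theta(a)$ for all $a,b\in A$, $\theta(h)=h$, such that $\theta$ restricts to continuous maps $A(d)\to A(-d)$ for all $d\in\mathbb{Z}$, then each of L1, L2, L3 is equivalent to each of R1,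 R2, R3. -/

import Mathlib

open CategoryTheory Topology
open scoped Pointwise

universe u

namespace QuasiFinite

/-! ## Filterwise completions

The construction of the filterwise completion of an algebra `A` that carries an increasing
filtration `F` and the linear topology defined by a decreasing sequence `I` of subspaces. -/

section Completion

variable {k : Type u} [Field k] {A : Type u} [Ring A] [Algebra k A]

/-- An increasing multiplicative filtration `F` of the algebra `A`, together with a decreasing
sequence `I` of subspaces such that left and right multiplication by the elements of a fixed
filtration step is equicontinuous for the linear topology defined by `I`. Below it is proved for
the two standard filtrations and topologies of a compatible degreewise topological algebra. -/
class IsFilteredLinear (F : ℤ → Submodule k A) (I : ℕ → Submodule k A) : Prop where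
  mono : Monotone F
  one_mem : (1 : A) ∈ F 0
  mul_le : ∀ p q, F p * F q ≤ F (p + q)
  anti : Antitone I
  exists_mul_left_le : ∀ (q : ℤ) (n : ℕ), ∃ m, F q * I m ≤ I n
  exists_mul_right_le : ∀ (q : ℤ) (n : ℕ), ∃ m, I m * F q ≤ I n

variable (F : ℤ → Submodule k A) (I : ℕ → Submodule k A) [IsFilteredLinear F I]

/-- The algebra of those sequences in `A` that lie in some step `F p` of the filtration and are
Cauchy for the linear topology defined by `I`. -/
def boundedCauchy : Subalgebra k (ℕ → A) where
  carrier := {a | (∃ p, ∀ i, a i ∈ F p) ∧ ∀ n, ∃ N, ∀ i ≥ N, ∀ j ≥ N, a i - a j ∈ I n}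
  mul_mem' := by
    rintro a b ⟨⟨p, hp⟩, ha⟩ ⟨⟨q, hq⟩, hb⟩
    refine ⟨⟨p + q, fun i => IsFilteredLinear.mul_le (I := I) p q
      (Submodule.mul_mem_mul (hp i) (hq i))⟩, fun n => ?_⟩
    obtain ⟨m₁, h₁⟩ := IsFilteredLinear.exists_mul_left_le (F := F) (I := I) p n
    obtain ⟨m₂, h₂⟩ := IsFilteredLinear.exists_mul_right_le (F := F) (I := I) q n
    obtain ⟨N₁, hN₁⟩ := hb m₁
    obtain ⟨N₂, hN₂⟩ := ha m₂
    refine ⟨max N₁ N₂, fun i hi j hj => ?_⟩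
    have e : (a * b) i - (a * b) j = a i * (b i - b j) + (a i - a j) * b j := by
      simp only [Pi.mul_apply]; noncomm_ring
    rw [e]
    exact add_mem
      (h₁ (Submodule.mul_mem_mul (hp i)
        (hN₁ i ((le_max_left _ _).trans hi) j ((le_max_left _ _).trans hj))))
      (h₂ (Submodule.mul_mem_mul
        (hN₂ i ((le_max_right _ _).trans hi) j ((le_max_right _ _).trans hj)) (hq j)))
  add_mem' := by
    rintro a b ⟨⟨p, hp⟩, ha⟩ ⟨⟨q, hq⟩, hb⟩
    refine ⟨⟨max p q, fun i => add_mem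
      (IsFilteredLinear.mono (F := F) (I := I) (le_max_left p q) (hp i))
      (IsFilteredLinear.mono (F := F) (I := I) (le_max_right p q) (hq i))⟩, fun n => ?_⟩
    obtain ⟨N₁, hN₁⟩ := ha n
    obtain ⟨N₂, hN₂⟩ := hb n
    refine ⟨max N₁ N₂, fun i hi j hj => ?_⟩
    have e : (a + b) i - (a + b) j = (a i - a j) + (b i - b j) := by
      simp only [Pi.add_apply]; abel
    rw [e]
    exact add_mem (hN₁ i ((le_max_left _ _).trans hi) j ((le_max_left _ _).trans hj))
      (hN₂ i ((le_max_right _ _).trans hi) j ((le_max_right _ _).trans hj))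
  algebraMap_mem' := by
    intro c
    refine ⟨⟨0, fun i => ?_⟩, fun n => ⟨0, fun i _ j _ => ?_⟩⟩
    · rw [Pi.algebraMap_apply, Algebra.algebraMap_eq_smul_one]
      exact Submodule.smul_mem _ _ (IsFilteredLinear.one_mem (F := F) (I := I))
    · simp

/-- The two-sided ideal of null sequences. -/
def nullIdeal : Ideal (boundedCauchy F I) where
  carrier := {a | ∀ n, ∃ N, ∀ i ≥ N, (a : ℕ → A) i ∈ I n}
  zero_mem' := fun n => ⟨0, fun i _ => by simp⟩
  add_mem' := by
    intro a b ha hb n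
    obtain ⟨N₁, hN₁⟩ := ha n
    obtain ⟨N₂, hN₂⟩ := hb n
    exact ⟨max N₁ N₂, fun i hi => add_mem (hN₁ i ((le_max_left _ _).trans hi))
      (hN₂ i ((le_max_right _ _).trans hi))⟩
  smul_mem' := by
    rintro ⟨a, ⟨p, hp⟩, ha⟩ b hb n
    obtain ⟨m, hm⟩ := IsFilteredLinear.exists_mul_left_le (F := F) (I := I) p n
    obtain ⟨N, hN⟩ := hb m
    exact ⟨N, fun i hi => hm (Submodule.mul_mem_mul (hp i) (hN i hi))⟩

instance nullIdeal_isTwoSided : (nullIdeal F I).IsTwoSided where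
  mul_mem_of_left := by
    rintro a ⟨b, ⟨p, hp⟩, hb⟩ ha n
    obtain ⟨m, hm⟩ := IsFilteredLinear.exists_mul_right_le (F := F) (I := I) p n
    obtain ⟨N, hN⟩ := ha m
    exact ⟨N, fun i hi => hm (Submodule.mul_mem_mul (hN i hi) (hp i))⟩

/-- The filterwise completion `⋃ₚ lim_n F p / (F p ∩ I n)` of `A`: the algebra of bounded Cauchy
sequences modulo the null sequences. -/
def FilterwiseCompletion : Type u := boundedCauchy F I ⧸ nullIdeal F I

namespace FilterwiseCompletion

instance : Ring (FilterwiseCompletion F I) :=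
  inferInstanceAs (Ring (boundedCauchy F I ⧸ nullIdeal F I))

instance : Algebra k (FilterwiseCompletion F I) :=
  inferInstanceAs (Algebra k (boundedCauchy F I ⧸ nullIdeal F I))

/-- The class of a bounded Cauchy sequence. -/
def mk : boundedCauchy F I →ₐ[k] FilterwiseCompletion F I :=
  Ideal.Quotient.mkₐ k (nullIdeal F I)

/-- The `p`-th filtration step of the completion, i.e. the completion of `F p`. -/
def filtration (p : ℤ) : Submodule k (FilterwiseCompletion F I) where
  carrier := {x | ∃ a : boundedCauchy F I, (∀ i, (a : ℕ → A) i ∈ F p) ∧ mk F I a = x}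
  zero_mem' := ⟨0, fun i => by simp, map_zero _⟩
  add_mem' := by
    rintro _ _ ⟨a, ha, rfl⟩ ⟨b, hb, rfl⟩
    exact ⟨a + b, fun i => add_mem (ha i) (hb i), map_add _ _ _⟩
  smul_mem' := by
    rintro c _ ⟨a, ha, rfl⟩
    exact ⟨c • a, fun i => Submodule.smul_mem _ c (ha i), map_smul _ _ _⟩

/-- The kernel of the canonical map from the completion to `A / I n`, which sends the class of a
Cauchy sequence to the eventually constant value of that sequence modulo `I n`. -/
def kerSubspace (n : ℕ) : Submodule k (FilterwiseCompletion F I) where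
  carrier := {x | ∃ a : boundedCauchy F I, (∃ N, ∀ i ≥ N, (a : ℕ → A) i ∈ I n) ∧ mk F I a = x}
  zero_mem' := ⟨0, ⟨0, fun i _ => by simp⟩, map_zero _⟩
  add_mem' := by
    rintro _ _ ⟨a, ⟨N₁, ha⟩, rfl⟩ ⟨b, ⟨N₂, hb⟩, rfl⟩
    exact ⟨a + b, ⟨max N₁ N₂, fun i hi => add_mem (ha i ((le_max_left _ _).trans hi))
      (hb i ((le_max_right _ _).trans hi))⟩, map_add _ _ _⟩
  smul_mem' := by
    rintro c _ ⟨a, ⟨N, ha⟩, rfl⟩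
    exact ⟨c • a, ⟨N, fun i hi => Submodule.smul_mem _ c (ha i hi)⟩, map_smul _ _ _⟩

lemma kerSubspace_anti : Antitone (kerSubspace F I) := by
  rintro m n h _ ⟨a, ⟨N, ha⟩, rfl⟩
  exact ⟨a, ⟨N, fun i hi => IsFilteredLinear.anti (F := F) (I := I) h (ha i hi)⟩, rfl⟩

/-- The linear topology on the completion defined by the kernels `kerSubspace n`. -/
instance : TopologicalSpace (FilterwiseCompletion F I) where
  IsOpen U := ∀ x ∈ U, ∃ n, ∀ y, y - x ∈ kerSubspace F I n → y ∈ U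
  isOpen_univ := fun _ _ => ⟨0, fun _ _ => trivial⟩
  isOpen_inter := by
    rintro U V hU hV x ⟨hxU, hxV⟩
    obtain ⟨n, hn⟩ := hU x hxU
    obtain ⟨m, hm⟩ := hV x hxV
    exact ⟨max n m, fun y hy => ⟨hn y (kerSubspace_anti F I (le_max_left n m) hy),
      hm y (kerSubspace_anti F I (le_max_right n m) hy)⟩⟩
  isOpen_sUnion := by
    rintro S hS x ⟨U, hU, hx⟩
    obtain ⟨n, hn⟩ := hS U hU x hx
    exact ⟨n, fun y hy => ⟨U, hU, hn y hy⟩⟩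

end FilterwiseCompletion

end Completion

/-! ## Compatible degreewise topological algebras -/

section Graded

variable {k : Type u} [Field k] {A : Type u} [Ring A] [Algebra k A] (𝒢 : ℤ → Submodule k A)

/-- The associated filtration `F_p A = ⨁_{d ≤ p} A(d)`. -/
def filt (p : ℤ) : Submodule k A := ⨆ d : ℤ, ⨆ _ : d ≤ p, 𝒢 d

/-- The opposite filtration `F^∨_p A = ⨁_{d ≥ -p} A(d)`. -/
def filtOpp (p : ℤ) : Submodule k A := ⨆ d : ℤ, ⨆ _ : -p ≤ d, 𝒢 d

lemma filt_mono : Monotone (filt 𝒢) := fun _ _ h =>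
  iSup_mono fun _ => iSup_mono' fun hd => ⟨hd.trans h, le_rfl⟩

lemma filtOpp_mono : Monotone (filtOpp 𝒢) := fun _ _ h =>
  iSup_mono fun _ => iSup_mono' fun hd => ⟨(neg_le_neg h).trans hd, le_rfl⟩

lemma le_filt {d p : ℤ} (h : d ≤ p) : 𝒢 d ≤ filt 𝒢 p := le_iSup₂_of_le d h le_rfl

lemma le_filtOpp {d p : ℤ} (h : -p ≤ d) : 𝒢 d ≤ filtOpp 𝒢 p := le_iSup₂_of_le d h le_rfl

lemma graded_mul_le [GradedAlgebra 𝒢] (d e : ℤ) : 𝒢 d * 𝒢 e ≤ 𝒢 (d + e) :=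
  Submodule.mul_le.2 fun _ ha _ hb => SetLike.mul_mem_graded ha hb

lemma filt_mul_le [GradedAlgebra 𝒢] (p q : ℤ) : filt 𝒢 p * filt 𝒢 q ≤ filt 𝒢 (p + q) := by
  unfold filt
  simp only [Submodule.iSup_mul, Submodule.mul_iSup]
  refine iSup_le fun d => iSup_le fun hd => iSup_le fun e => iSup_le fun he => ?_
  exact (graded_mul_le 𝒢 _ _).trans (le_filt 𝒢 (by omega))

lemma filtOpp_mul_le [GradedAlgebra 𝒢] (p q : ℤ) : filtOpp 𝒢 p * filtOpp 𝒢 q ≤ filtOpp 𝒢 (p + q) := by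
  unfold filtOpp
  simp only [Submodule.iSup_mul, Submodule.mul_iSup]
  refine iSup_le fun d => iSup_le fun hd => iSup_le fun e => iSup_le fun he => ?_
  exact (graded_mul_le 𝒢 _ _).trans (le_filtOpp 𝒢 (by omega))

lemma graded_mul_left_span_le (e : ℤ) (p : ℤ) : 𝒢 e * (⊤ * filt 𝒢 p) ≤ ⊤ * filt 𝒢 p := by
  rw [← mul_assoc]; exact mul_le_mul' le_top le_rfl

lemma left_span_mul_graded_le [GradedAlgebra 𝒢] {e p q : ℤ} (h : p + e ≤ q) :
    (⊤ * filt 𝒢 p) * 𝒢 e ≤ ⊤ * filt 𝒢 q := by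
  rw [mul_assoc]
  exact mul_le_mul' le_rfl (((mul_le_mul' le_rfl (le_filt 𝒢 le_rfl)).trans
    (filt_mul_le 𝒢 p e)).trans (filt_mono 𝒢 h))

lemma right_span_mul_graded_le (e : ℤ) (p : ℤ) :
    (filtOpp 𝒢 p * ⊤) * 𝒢 e ≤ filtOpp 𝒢 p * ⊤ := by
  rw [mul_assoc]; exact mul_le_mul' le_rfl le_top

lemma graded_mul_right_span_le [GradedAlgebra 𝒢] {e p q : ℤ} (h : p - e ≤ q) :
    𝒢 e * (filtOpp 𝒢 p * ⊤) ≤ filtOpp 𝒢 q * ⊤ := by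
  rw [← mul_assoc]
  exact mul_le_mul' (((mul_le_mul' (le_filtOpp 𝒢 (p := -e) (by simp)) le_rfl).trans
    (filtOpp_mul_le 𝒢 (-e) p)).trans (filtOpp_mono 𝒢 (by omega))) le_rfl

variable [∀ d, TopologicalSpace (𝒢 d)] [∀ d, IsTopologicalAddGroup (𝒢 d)]
  [∀ d, ContinuousConstSMul k (𝒢 d)]

/-- The closure of `A(d) ∩ S` in `A(d)`. -/
def degClosure (S : Submodule k A) (d : ℤ) : Submodule k (𝒢 d) :=
  (S.comap (𝒢 d).subtype).topologicalClosure

lemma degClosure_mono {S S' : Submodule k A} (h : S ≤ S') (d : ℤ) :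
    degClosure 𝒢 S d ≤ degClosure 𝒢 S' d :=
  Submodule.topologicalClosure_mono (Submodule.comap_mono h)

/-- `I_n(A(d))`, the closure of `A(d) ∩ (A · F_{-n-1} A)` in `A(d)`. -/
def leftI (n : ℕ) (d : ℤ) : Submodule k (𝒢 d) := degClosure 𝒢 (⊤ * filt 𝒢 (-(n : ℤ) - 1)) d

/-- `I^∨_n(A(d))`, the closure of `A(d) ∩ (F^∨_{-n-1} A · A)` in `A(d)`. -/
def rightI (n : ℕ) (d : ℤ) : Submodule k (𝒢 d) := degClosure 𝒢 (filtOpp 𝒢 (-(n : ℤ) - 1) * ⊤) d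

/-- `I_n(A) = ⨁_d I_n(A(d))`. -/
def leftIdeal (n : ℕ) : Submodule k A := ⨆ d, (leftI 𝒢 n d).map (𝒢 d).subtype

/-- `I^∨_n(A) = ⨁_d I^∨_n(A(d))`. -/
def rightIdeal (n : ℕ) : Submodule k A := ⨆ d, (rightI 𝒢 n d).map (𝒢 d).subtype

/-- A compatible degreewise topological algebra: the multiplication maps `A(d) × A(e) → A(d + e)`
are continuous and the subspaces `I_n(A(d))`, `n ∈ ℕ`, form a fundamental system of neighbourhoods
of zero in `A(d)` (so that the topology of `A(d)` is the linear topology they define). -/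
class IsCompatible [GradedAlgebra 𝒢] : Prop where
  continuous_mul : ∀ d e : ℤ, Continuous fun x : 𝒢 d × 𝒢 e =>
    (⟨(x.1 : A) * (x.2 : A), SetLike.mul_mem_graded x.1.2 x.2.2⟩ : 𝒢 (d + e))
  hasBasis : ∀ d : ℤ, (𝓝 (0 : 𝒢 d)).HasBasis (fun _ : ℕ => True)
    fun n => (leftI 𝒢 n d : Set (𝒢 d))

section Mul

variable [GradedAlgebra 𝒢]

variable [IsCompatible 𝒢]

lemma mul_degClosure_mem {S S' : Submodule k A} {d e f : ℤ} (h : 𝒢 e * S ≤ S') (hf : e + d = f)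
    (a : 𝒢 e) (b : 𝒢 d) (hb : b ∈ degClosure 𝒢 S d) (c : 𝒢 f) (hc : (c : A) = a * b) :
    c ∈ degClosure 𝒢 S' f := by
  subst hf
  have hcont : Continuous fun x : 𝒢 d =>
      (⟨(a : A) * (x : A), SetLike.mul_mem_graded a.2 x.2⟩ : 𝒢 (e + d)) :=
    (IsCompatible.continuous_mul (𝒢 := 𝒢) e d).comp (continuous_const.prodMk continuous_id)
  have := map_mem_closure hcont hb (t := ((S'.comap (𝒢 (e + d)).subtype : Submodule k _) : Set _))
    fun x hx => h (Submodule.mul_mem_mul a.2 hx)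
  have hce : c = ⟨(a : A) * (b : A), SetLike.mul_mem_graded a.2 b.2⟩ := Subtype.ext hc
  rw [hce]; exact this

lemma degClosure_mul_mem {S S' : Submodule k A} {d e f : ℤ} (h : S * 𝒢 e ≤ S') (hf : d + e = f)
    (a : 𝒢 e) (b : 𝒢 d) (hb : b ∈ degClosure 𝒢 S d) (c : 𝒢 f) (hc : (c : A) = b * a) :
    c ∈ degClosure 𝒢 S' f := by
  subst hf
  have hcont : Continuous fun x : 𝒢 d =>
      (⟨(x : A) * (a : A), SetLike.mul_mem_graded x.2 a.2⟩ : 𝒢 (d + e)) :=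
    (IsCompatible.continuous_mul (𝒢 := 𝒢) d e).comp (continuous_id.prodMk continuous_const)
  have := map_mem_closure hcont hb (t := ((S'.comap (𝒢 (d + e)).subtype : Submodule k _) : Set _))
    fun x hx => h (Submodule.mul_mem_mul hx a.2)
  have hce : c = ⟨(b : A) * (a : A), SetLike.mul_mem_graded b.2 a.2⟩ := Subtype.ext hc
  rw [hce]; exact this

lemma mul_iSup_degClosure_le {S S' : Submodule k A} {e : ℤ} (h : 𝒢 e * S ≤ S') :
    𝒢 e * (⨆ d, (degClosure 𝒢 S d).map (𝒢 d).subtype) ≤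
      ⨆ d, (degClosure 𝒢 S' d).map (𝒢 d).subtype := by
  rw [Submodule.mul_iSup]
  refine iSup_le fun d => Submodule.mul_le.2 ?_
  rintro a ha _ ⟨b, hb, rfl⟩
  exact Submodule.mem_iSup_of_mem (e + d) 
    ⟨⟨a * b, SetLike.mul_mem_graded ha b.2⟩, mul_degClosure_mem 𝒢 h rfl ⟨a, ha⟩ b hb _ rfl, rfl⟩

lemma iSup_degClosure_mul_le {S S' : Submodule k A} {e : ℤ} (h : S * 𝒢 e ≤ S') :
    (⨆ d, (degClosure 𝒢 S d).map (𝒢 d).subtype) * 𝒢 e ≤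
      ⨆ d, (degClosure 𝒢 S' d).map (𝒢 d).subtype := by
  rw [Submodule.iSup_mul]
  refine iSup_le fun d => Submodule.mul_le.2 ?_
  rintro _ ⟨b, hb, rfl⟩ a ha
  exact Submodule.mem_iSup_of_mem (d + e) 
    ⟨⟨b * a, SetLike.mul_mem_graded b.2 ha⟩, degClosure_mul_mem 𝒢 h rfl ⟨a, ha⟩ b hb _ rfl, rfl⟩

instance leftFilteredLinear : IsFilteredLinear (filt 𝒢) (leftIdeal 𝒢) where
  mono := filt_mono 𝒢
  one_mem := le_filt 𝒢 le_rfl (SetLike.one_mem_graded 𝒢)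
  mul_le := filt_mul_le 𝒢
  anti := fun m n h => iSup_mono fun d => Submodule.map_mono
    (degClosure_mono 𝒢 (mul_le_mul' le_rfl (filt_mono 𝒢 (by omega))) d)
  exists_mul_left_le := fun q n => ⟨n, by
    rw [filt]
    simp only [Submodule.iSup_mul]
    exact iSup_le fun e => iSup_le fun _ =>
      mul_iSup_degClosure_le 𝒢 (graded_mul_left_span_le 𝒢 e _)⟩
  exists_mul_right_le := fun q n => ⟨n + q.toNat, by
    rw [filt]
    simp only [Submodule.mul_iSup]
    exact iSup_le fun e => iSup_le fun _ =>
      iSup_degClosure_mul_le 𝒢 (left_span_mul_graded_le 𝒢 (by omega))⟩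

instance rightFilteredLinear : IsFilteredLinear (filtOpp 𝒢) (rightIdeal 𝒢) where
  mono := filtOpp_mono 𝒢
  one_mem := le_filtOpp 𝒢 (by simp) (SetLike.one_mem_graded 𝒢)
  mul_le := filtOpp_mul_le 𝒢
  anti := fun m n h => iSup_mono fun d => Submodule.map_mono
    (degClosure_mono 𝒢 (mul_le_mul' (filtOpp_mono 𝒢 (by omega)) le_rfl) d)
  exists_mul_left_le := fun q n => ⟨n + q.toNat, by
    rw [filtOpp]
    simp only [Submodule.iSup_mul]
    exact iSup_le fun e => iSup_le fun _ =>
      mul_iSup_degClosure_le 𝒢 (graded_mul_right_span_le 𝒢 (by omega))⟩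
  exists_mul_right_le := fun q n => ⟨n, by
    rw [filtOpp]
    simp only [Submodule.mul_iSup]
    exact iSup_le fun e => iSup_le fun _ =>
      iSup_degClosure_mul_le 𝒢 (right_span_mul_graded_le 𝒢 e _)⟩

/-- The left linear filterwise completion `𝒜`. -/
abbrev LeftCompletion : Type u := FilterwiseCompletion (filt 𝒢) (leftIdeal 𝒢)

/-- The right linear filterwise completion `𝒜^∨`. -/
abbrev RightCompletion : Type u := FilterwiseCompletion (filtOpp 𝒢) (rightIdeal 𝒢)

/-- `I_n(A(0))` as an ideal of the ring `A(0)`. -/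
def zeroIdeal (n : ℕ) : Ideal (𝒢 0) where
  carrier := leftI 𝒢 n 0
  zero_mem' := zero_mem (leftI 𝒢 n 0)
  add_mem' := fun ha hb => add_mem (S := Submodule k (𝒢 0)) ha hb
  smul_mem' := fun a b hb => mul_degClosure_mem 𝒢
    (graded_mul_left_span_le 𝒢 0 (-(n : ℤ) - 1)) (add_zero 0) a b hb _ rfl

instance zeroIdeal_isTwoSided (n : ℕ) : (zeroIdeal 𝒢 n).IsTwoSided where
  mul_mem_of_left := fun {a} b ha => degClosure_mul_mem 𝒢
    (left_span_mul_graded_le 𝒢 (add_zero _).le) (add_zero 0) b a ha _ rfl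

end Mul

/-- `V` is complete (and separated) as a topological vector space. -/
def IsCompleteSeparated (V : Type u) [AddCommGroup V] [TopologicalSpace V]
    [IsTopologicalAddGroup V] : Prop :=
  T2Space V ∧ @CompleteSpace V (IsTopologicalAddGroup.rightUniformSpace V)

/-- A compatible degreewise topological algebra is quasi-finite if it is degreewise complete and
all the spaces `Q_n(d) = A(d) / I_n(A(d))` are finite-dimensional. -/
structure IsQuasiFinite [GradedAlgebra 𝒢] [IsCompatible 𝒢] : Prop where
  complete : ∀ d, IsCompleteSeparated (𝒢 d)
  finite : ∀ (n : ℕ) (d : ℤ), Module.Finite k (𝒢 d ⧸ leftI 𝒢 n d)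

/-- `h` is a Hamiltonian: `A(d) = {a | [h, a] = d a}` for all `d`. -/
def IsHamiltonian (h : A) : Prop :=
  ∀ (d : ℤ) (a : A), a ∈ 𝒢 d ↔ h * a - a * h = d • a

/-- A linear anti-involution `θ` of `A` that fixes `h` and restricts to continuous maps
`A(d) → A(-d)`. -/
structure IsAntiInvolution (h : A) (θ : A →ₗ[k] A) : Prop where
  involutive : ∀ a, θ (θ a) = a
  map_mul : ∀ a b, θ (a * b) = θ b * θ a
  map_ham : θ h = h
  map_mem : ∀ (d : ℤ) (a : A), a ∈ 𝒢 d → θ a ∈ 𝒢 (-d)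
  continuous : ∀ d : ℤ, Continuous fun a : 𝒢 d => (⟨θ a, map_mem d a a.2⟩ : 𝒢 (-d))

/-! ## The spectrum of the Hamiltonian and the algebras `A_n` -/

section Spectrum

variable [GradedAlgebra 𝒢] [IsCompatible 𝒢] (h : 𝒢 0)

/-- `Ω_n`, the set of roots of the minimal polynomial of the image of `h` in the algebra
`Q_n(0) = A(0) / I_n(A(0))`. -/
def spec (n : ℕ) : Set k :=
  {x | (minpoly k (Ideal.Quotient.mk (zeroIdeal 𝒢 n) h)).IsRoot x}

/-- `Γ_0`, the minimal elements of `Ω_0` for the partial order in which `x` is at least `y` when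
`x - y` is a nonnegative integer. -/
def minSpec : Set k :=
  {x | x ∈ spec 𝒢 h 0 ∧ ∀ y ∈ spec 𝒢 h 0, (∃ m : ℕ, x - y = m) → y = x}

/-- `Γ_n = {γ + j | γ ∈ Γ_0, 0 ≤ j ≤ n}`. -/
def specRange (n : ℕ) : Set k := {x | ∃ y ∈ minSpec 𝒢 h, ∃ j : ℕ, j ≤ n ∧ x = y + j}

/-- `g`, the maximum of the integral differences among the elements of `Ω_0` (and `0` if `Ω_0` is
empty). -/
noncomputable def gap : ℕ :=
  sSup {m : ℕ | ∃ x ∈ spec 𝒢 h 0, ∃ y ∈ spec 𝒢 h 0, x - y = (m : k)}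

end Spectrum

end Graded

section FiniteAlgebra

variable {k : Type u} [Field k] {A : Type u} [Ring A] [Algebra k A]

/-- `A[x, y]`, the simultaneous generalized eigenspace of the left and the right multiplication by
`h`. -/
def genEig (h : A) (x y : k) : Submodule k A where
  carrier := {a | ∃ r : ℕ, (h - algebraMap k A x) ^ r * a = 0 ∧ a * (h - algebraMap k A y) ^ r = 0}
  zero_mem' := ⟨0, by simp, by simp⟩
  add_mem' := by
    rintro a b ⟨r, h₁, h₂⟩ ⟨s, h₃, h₄⟩
    refine ⟨r + s, ?_, ?_⟩
    · rw [mul_add, pow_add, mul_assoc _ _ b, h₃, (Commute.refl _).pow_pow r s |>.eq, mul_assoc,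
        h₁]; simp
    · rw [add_mul, pow_add, ← mul_assoc, h₂, (Commute.refl _).pow_pow r s |>.eq, ← mul_assoc b,
        h₄]; simp
  smul_mem' := by
    rintro c a ⟨r, h₁, h₂⟩
    exact ⟨r, by rw [mul_smul_comm, h₁, smul_zero], by rw [smul_mul_assoc, h₂, smul_zero]⟩

lemma genEig_mul_eq {h : A} {x y z : k} {a b : A} (ha : a ∈ genEig h x y)
    (hb : b ∈ genEig h y z) : a * b ∈ genEig h x z := by
  obtain ⟨r, h₁, -⟩ := ha
  obtain ⟨s, -, h₂⟩ := hb
  refine ⟨r + s, ?_, ?_⟩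
  · rw [add_comm r s, pow_add, mul_assoc, ← mul_assoc _ a b, h₁, zero_mul, mul_zero]
  · rw [add_comm r s, pow_add, mul_assoc a, ← mul_assoc b, h₂, zero_mul, mul_zero]

lemma genEig_mul_ne {h : A} {w x y z : k} (hxy : x ≠ y) {a b : A} (ha : a ∈ genEig h w x)
    (hb : b ∈ genEig h y z) : a * b = 0 := by
  obtain ⟨r, -, h₁⟩ := ha
  obtain ⟨s, h₂, -⟩ := hb
  obtain ⟨p, q, hpq⟩ : IsCoprime ((Polynomial.X - Polynomial.C x) ^ r)
      ((Polynomial.X - Polynomial.C y) ^ s) :=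
    (Polynomial.isCoprime_X_sub_C_of_isUnit_sub (sub_ne_zero.2 hxy).isUnit).pow
  have e := congrArg (Polynomial.aeval h) ((add_comm _ _).trans hpq)
  simp only [map_add, map_mul, map_pow, map_sub, Polynomial.aeval_X, Polynomial.aeval_C,
    map_one] at e
  have c : Polynomial.aeval h p * (h - algebraMap k A x) ^ r =
      (h - algebraMap k A x) ^ r * Polynomial.aeval h p := by
    have := congrArg (Polynomial.aeval h) (mul_comm p ((Polynomial.X - Polynomial.C x) ^ r))
    simpa using this
  calc a * b = a * 1 * b := by rw [mul_one]
    _ = a * Polynomial.aeval h q * ((h - algebraMap k A y) ^ s * b) +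
        (a * (h - algebraMap k A x) ^ r) * Polynomial.aeval h p * b := by
          rw [← e, c]; noncomm_ring
    _ = 0 := by rw [h₁, h₂]; simp

/-- For a set `Γ` of scalars, the subspace `∑_{x, y ∈ Γ} A[x, y]`, which is closed under
multiplication. -/
def cornerAlgebra (h : A) (Γ : Set k) : NonUnitalSubalgebra k A where
  __ := (⨆ x ∈ Γ, ⨆ y ∈ Γ, genEig h x y : Submodule k A)
  mul_mem' := by
    intro a b ha hb
    have key : (⨆ x ∈ Γ, ⨆ y ∈ Γ, genEig h x y : Submodule k A) *
        (⨆ x ∈ Γ, ⨆ y ∈ Γ, genEig h x y) ≤ ⨆ x ∈ Γ, ⨆ y ∈ Γ, genEig h x y := by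
      simp only [Submodule.iSup_mul, Submodule.mul_iSup]
      refine iSup₂_le fun w hw => iSup₂_le fun x hx => iSup₂_le fun y hy => iSup₂_le fun z hz =>
        Submodule.mul_le.2 fun a ha b hb => ?_
      rcases eq_or_ne z w with rfl | hzw
      · exact Submodule.mem_iSup_of_mem _ (Submodule.mem_iSup_of_mem hy
          (Submodule.mem_iSup_of_mem _ (Submodule.mem_iSup_of_mem hx (genEig_mul_eq ha hb))))
      · rw [genEig_mul_ne hzw ha hb]; exact zero_mem _
    exact key (Submodule.mul_mem_mul ha hb)

/-- The non-unital subalgebra `S` has a two-sided unity. -/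
def HasUnity (S : NonUnitalSubalgebra k A) : Prop := ∃ e : S, ∀ a : S, e * a = a ∧ a * e = a

/-- The algebra `S`, regarded as a unital ring by means of its own unity. -/
def UnitalRing (S : NonUnitalSubalgebra k A) (_ : HasUnity S) : Type u := S

noncomputable instance (S : NonUnitalSubalgebra k A) (hS : HasUnity S) :
    Ring (UnitalRing S hS) where
  __ := (inferInstanceAs (NonUnitalRing S) : NonUnitalRing (UnitalRing S hS))
  one := hS.choose
  one_mul a := (hS.choose_spec a).1
  mul_one a := (hS.choose_spec a).2

end FiniteAlgebra

/-! ## Quasi-finite modules -/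

section Modules

variable {k : Type u} [Field k] {R : Type u} [Ring R] [Algebra k R]

section

variable {M : Type u} [AddCommGroup M] [Module k M] [Module R M] [IsScalarTower k R M]

/-- The subspace of the elements of `M` that are annihilated by `J`. -/
def annihilated (J : Submodule k R) (M : Type u) [AddCommGroup M] [Module k M] [Module R M]
    [IsScalarTower k R M] : Submodule k M where
  carrier := {v | ∀ a ∈ J, a • v = 0}
  zero_mem' := fun a _ => smul_zero a
  add_mem' := fun hv hw a ha => by rw [smul_add, hv a ha, hw a ha, add_zero]
  smul_mem' := fun c v hv a ha => by
    rw [← algebraMap_smul R c v, ← mul_smul, ← Algebra.commutes, mul_smul, hv a ha, smul_zero]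

/-- The closure of `F_{-n-1} R · M` in the topological `R`-module `M`. -/
def stepClosure (F : ℤ → Submodule k R) (n : ℕ) (M : Type u) [AddCommGroup M] [Module k M]
    [Module R M] [TopologicalSpace M] [IsTopologicalAddGroup M] [ContinuousConstSMul k M] :
    Submodule k M :=
  (Submodule.span k {x | ∃ a ∈ F (-(n : ℤ) - 1), ∃ v : M, x = a • v}).topologicalClosure

end

/-- The underlying `k`-vector space of an `R`-module, `R` a `k`-algebra. -/
abbrev scalarModule (k R M : Type u) [Field k] [Ring R] [Algebra k R] [AddCommGroup M]
    [Module R M] : Module k M := Module.compHom M (algebraMap k R)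

lemma scalarModule_isScalarTower (k R M : Type u) [Field k] [Ring R] [Algebra k R]
    [AddCommGroup M] [Module R M] : letI := scalarModule k R M; IsScalarTower k R M :=
  letI := scalarModule k R M
  ⟨fun c a v => by rw [Algebra.smul_def, mul_smul]; rfl⟩

lemma scalarModule_continuousConstSMul (k R M : Type u) [Field k] [Ring R] [Algebra k R]
    [TopologicalSpace R] [AddCommGroup M] [Module R M] [TopologicalSpace M] [ContinuousSMul R M] :
    letI := scalarModule k R M; ContinuousConstSMul k M :=
  letI := scalarModule k R M
  ⟨fun c => continuous_const_smul (algebraMap k R c)⟩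

/-- The quasi-finite exhaustive `R`-modules with respect to the sequence `I` of subspaces of `R`:
every element is annihilated by some `I m` (exhaustiveness), and for each `n` the space of the
elements annihilated by `I n` is finite-dimensional. -/
def quasiFiniteExhaustive (I : ℕ → Submodule k R) : ObjectProperty (ModuleCat.{u} R) := fun M =>
  letI := scalarModule k R M
  haveI := scalarModule_isScalarTower k R M
  (∀ v : M, ∃ m, v ∈ annihilated (I m) M) ∧ ∀ n, Module.Finite k (annihilated (I n) M)

/-- The quasi-finite coexhaustive `R`-modules with respect to the filtration `F` of `R`: those
topological `R`-modules `M` (with continuous action `R × M → M`) such that the closures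
`I_n(M)` of `F_{-n-1} R · M` form a fundamental system of neighbourhoods of zero, `M` is complete
(and separated), and the quotients `M / I_n(M)` are finite-dimensional. -/
def quasiFiniteCoexhaustive [TopologicalSpace R] (F : ℤ → Submodule k R) :
    ObjectProperty (TopModuleCat.{u} R) := fun M =>
  letI := scalarModule k R M
  haveI := scalarModule_continuousConstSMul k R M
  ((𝓝 (0 : M)).HasBasis (fun _ : ℕ => True) fun n => (stepClosure F n M : Set M)) ∧
    IsCompleteSeparated M ∧ ∀ n, Module.Finite k (M ⧸ stepClosure F n M)

/-- A subspace of `R` regarded as a subspace of the opposite algebra. -/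
def opSubspace (J : Submodule k R) : Submodule k Rᵐᵒᵖ :=
  J.map (MulOpposite.opLinearEquiv k).toLinearMap

end Modules

/-! ## The categories -/

section Categories

variable {k : Type u} [Field k] {A : Type u} [Ring A] [Algebra k A] (𝒢 : ℤ → Submodule k A)
  [GradedAlgebra 𝒢] [∀ d, TopologicalSpace (𝒢 d)] [∀ d, IsTopologicalAddGroup (𝒢 d)]
  [∀ d, ContinuousConstSMul k (𝒢 d)] [IsCompatible 𝒢] (h : 𝒢 0) (n : ℕ)

/-- L1: quasi-finite left `𝒜`-modules. -/
def catL1 : Cat.{u, u + 1} :=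
  Cat.of (quasiFiniteExhaustive (R := LeftCompletion 𝒢)
    (FilterwiseCompletion.kerSubspace (filt 𝒢) (leftIdeal 𝒢))).FullSubcategory

/-- L2: quasi-finite left `𝒜^∨`-modules. -/
def catL2 : Cat.{u, u + 1} :=
  Cat.of (quasiFiniteCoexhaustive (R := RightCompletion 𝒢)
    (FilterwiseCompletion.filtration (filtOpp 𝒢) (rightIdeal 𝒢))).FullSubcategory

/-- R1: quasi-finite right `𝒜^∨`-modules, i.e. left modules over the opposite algebra. -/
def catR1 : Cat.{u, u + 1} :=
  Cat.of (quasiFiniteExhaustive (R := (RightCompletion 𝒢)ᵐᵒᵖ) fun m =>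
    opSubspace (FilterwiseCompletion.kerSubspace (filtOpp 𝒢) (rightIdeal 𝒢) m)).FullSubcategory

/-- R2: quasi-finite right `𝒜`-modules, i.e. left modules over the opposite algebra. -/
def catR2 : Cat.{u, u + 1} :=
  Cat.of (quasiFiniteCoexhaustive (R := (LeftCompletion 𝒢)ᵐᵒᵖ) fun p =>
    opSubspace (FilterwiseCompletion.filtration (filt 𝒢) (leftIdeal 𝒢) p)).FullSubcategory

/-- The algebra `A_n = ∑_{x, y ∈ Γ_n} A[x, y]`. -/
def finAlgebra : NonUnitalSubalgebra k A := cornerAlgebra (h : A) (specRange 𝒢 h n)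

variable (hU : HasUnity (finAlgebra 𝒢 h n))

/-- The finitely generated modules over a ring. -/
def finitelyGenerated (R : Type u) [Ring R] : ObjectProperty (ModuleCat.{u} R) :=
  fun M => Module.Finite R M

/-- L3: finitely generated left `A_n`-modules. -/
noncomputable def catL3 : Cat.{u, u + 1} :=
  Cat.of (finitelyGenerated (UnitalRing (finAlgebra 𝒢 h n) hU)).FullSubcategory

/-- R3: finitely generated right `A_n`-modules. -/
noncomputable def catR3 : Cat.{u, u + 1} :=
  Cat.of (finitelyGenerated (UnitalRing (finAlgebra 𝒢 h n) hU)ᵐᵒᵖ).FullSubcategory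

/-- The family of the categories L1, L2, L3. -/
noncomputable def catL : Fin 3 → Cat.{u, u + 1} := ![catL1 𝒢, catL2 𝒢, catL3 𝒢 h n hU]

/-- The family of the categories R1, R2, R3. -/
noncomputable def catR : Fin 3 → Cat.{u, u + 1} := ![catR1 𝒢, catR2 𝒢, catR3 𝒢 h n hU]

end Categories

end QuasiFinite

set_option linter.unusedSectionVars false

namespace QuasiFinite

/-! ### Homogeneous components of the left and right ideals, and their closures -/

section

section Graded

variable {k : Type u} [Field k] {A : Type u} [Ring A] [Algebra k A] (𝒢 : ℤ → Submodule k A)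
  [GradedAlgebra 𝒢]

/-! Everything rests on a sequence of idempotents cut out by the spectrum of h. Let φ be the minimal
polynomial of h modulo I_0(A(0)). An element a of degree d satisfies a p(h) = p(h - d) a, and this
implies that right multiplication by φ(h - t) maps I_{t-1}(A(d)) into I_t(A(d))
(`mul_aeval_comp_mem`). Hence φ(h)φ(h - 1)⋯φ(h - m) lies in I_m(A(0)). Its roots split into those in
Γ_m and the others, and further translates of φ only add roots outside Γ_m. Chinese remaindering and
the completeness of A(0) therefore give an idempotent e_m, the projector to the part Γ_m of the
spectrum (`exists_isSpectralFamily`).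

These idempotents satisfy I_m(A) e_m = 0 and e_m I^∨_m(A) = 0 (`clI_mul_eq_zero`,
`mul_clI_eq_zero`), 1 - e_{m+g} ∈ I_m(A(0)) (`one_sub_mem`), finite-dimensionality of e_m A e_{m'}
(`exists_fg`), and A_n = e_n A e_n (`mem_finAlgebra_iff`), so e_n is the unity of A_n. The bound n ≥
g enters through `succ_mem_idealGen`: e_{m+1} - e_m lies in I_0, hence comes from products whose
right factor lowers the degree, and that factor carries the spectrum Γ_{m+1} into Γ_m. So every e_m
lies in A e_n A.

In either completion R the e_m are approximate units and e_n R e_n is still A_n. The functor M ↦ e_n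
M is then an equivalence onto the finitely generated A_n-modules. Its inverse is coinduction Hom(e_n
R, N) over A_n: the part generated by its corner for exhaustive modules (`exhaustive_equivalence`),
all of it with the topology given by the kernels of the e_m for coexhaustive ones
(`coexhaustive_equivalence`). Right modules are handled by the opposite algebras. The duality is
linear duality over the finite-dimensional algebra A_n (`exists_duality`), and an anti-involution
fixing h exchanges A[λ, μ] with A[μ, λ], so A_n is isomorphic to its opposite
(`nonempty_ringEquiv_op`). -/

lemma iSup_graded_eq_top : (⨆ d, 𝒢 d) = ⊤ :=
  (DirectSum.Decomposition.isInternal 𝒢).submodule_iSup_eq_top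

/-- The span of the products of elements of degrees `d - j` and `j` with `j ≤ p`. -/
def degProd (p d : ℤ) : Submodule k A := ⨆ j : ℤ, ⨆ _ : j ≤ p, 𝒢 (d - j) * 𝒢 j

lemma degProd_le (p d : ℤ) : degProd 𝒢 p d ≤ 𝒢 d :=
  iSup₂_le fun j _ => (graded_mul_le 𝒢 _ _).trans (by rw [sub_add_cancel])

/-- The projection to degree `d` fixes `x` and kills the products of every other degree. -/
lemma mem_of_mem_iSup_mul {P : ℤ → ℤ → Prop} {d : ℤ} {x : A} (hx : x ∈ 𝒢 d)
    (h : x ∈ ⨆ i, ⨆ j, ⨆ _ : P i j, 𝒢 i * 𝒢 j) :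
    x ∈ ⨆ i, ⨆ j, ⨆ _ : P i j ∧ i + j = d, 𝒢 i * 𝒢 j := by
  have e : GradedAlgebra.proj 𝒢 d x = x := by
    simp [GradedAlgebra.proj_apply, DirectSum.decompose_of_mem_same 𝒢 hx]
  have : GradedAlgebra.proj 𝒢 d x ∈
      (⨆ i, ⨆ j, ⨆ _ : P i j, 𝒢 i * 𝒢 j).map (GradedAlgebra.proj 𝒢 d) :=
    Submodule.mem_map_of_mem h
  rw [e] at this
  refine (?_ : Submodule.map _ _ ≤ _) this
  simp only [Submodule.map_iSup]
  refine iSup_le fun i => iSup_le fun j => iSup_le fun hij => ?_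
  rintro _ ⟨y, hy, rfl⟩
  have hy' := graded_mul_le 𝒢 i j hy
  by_cases hd : i + j = d
  · subst hd
    rw [GradedAlgebra.proj_apply, DirectSum.decompose_of_mem_same 𝒢 hy']
    exact Submodule.mem_iSup_of_mem i (Submodule.mem_iSup_of_mem j
      (Submodule.mem_iSup_of_mem ⟨hij, rfl⟩ hy))
  · rw [GradedAlgebra.proj_apply, DirectSum.decompose_of_mem_ne 𝒢 hy' hd]
    exact zero_mem _

lemma top_mul_filt_eq (p : ℤ) :
    (⊤ * filt 𝒢 p : Submodule k A) = ⨆ i, ⨆ j, ⨆ _ : j ≤ p, 𝒢 i * 𝒢 j := by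
  rw [← iSup_graded_eq_top 𝒢, filt, Submodule.iSup_mul]
  simp only [Submodule.mul_iSup]

lemma filtOpp_mul_top_eq (p : ℤ) :
    (filtOpp 𝒢 p * ⊤ : Submodule k A) = ⨆ i, ⨆ j, ⨆ _ : -p ≤ i, 𝒢 i * 𝒢 j := by
  rw [← iSup_graded_eq_top 𝒢, filtOpp, Submodule.mul_iSup]
  simp only [Submodule.iSup_mul]
  rw [iSup_comm]

lemma mem_top_mul_filt_iff {p d : ℤ} {x : A} (hx : x ∈ 𝒢 d) :
    x ∈ (⊤ * filt 𝒢 p : Submodule k A) ↔ x ∈ degProd 𝒢 p d := by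
  rw [top_mul_filt_eq]
  constructor
  · suffices H : (⨆ i, ⨆ j, ⨆ _ : j ≤ p ∧ i + j = d, 𝒢 i * 𝒢 j) ≤ degProd 𝒢 p d from
      fun h => H (mem_of_mem_iSup_mul 𝒢 hx h)
    refine iSup_le fun i => iSup_le fun j => iSup_le ?_
    rintro ⟨h₁, rfl⟩
    exact le_iSup₂_of_le j h₁ (by rw [add_sub_cancel_right])
  · suffices H : degProd 𝒢 p d ≤ (⨆ i, ⨆ j, ⨆ _ : j ≤ p, 𝒢 i * 𝒢 j) from fun h => H h
    exact iSup₂_le fun j hj => le_iSup_of_le (d - j) (le_iSup₂_of_le j hj le_rfl)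

/-- In a product of total degree `d`, the left factor has degree at least `-p` exactly when the
right one has degree at most `d + p`. -/
lemma mem_filtOpp_mul_top_iff {p d : ℤ} {x : A} (hx : x ∈ 𝒢 d) :
    x ∈ (filtOpp 𝒢 p * ⊤ : Submodule k A) ↔ x ∈ degProd 𝒢 (d + p) d := by
  rw [filtOpp_mul_top_eq]
  constructor
  · suffices H : (⨆ i, ⨆ j, ⨆ _ : -p ≤ i ∧ i + j = d, 𝒢 i * 𝒢 j) ≤ degProd 𝒢 (d + p) d from
      fun h => H (mem_of_mem_iSup_mul (P := fun i _ => -p ≤ i) 𝒢 hx h)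
    refine iSup_le fun i => iSup_le fun j => iSup_le ?_
    rintro ⟨h₁, rfl⟩
    exact le_iSup₂_of_le j (by omega) (by rw [add_sub_cancel_right])
  · suffices H : degProd 𝒢 (d + p) d ≤ (⨆ i, ⨆ j, ⨆ _ : -p ≤ i, 𝒢 i * 𝒢 j) from fun h => H h
    exact iSup₂_le fun j hj => le_iSup_of_le (d - j) (le_iSup_of_le j
      (le_iSup_of_le (by omega) le_rfl))

lemma exists_mem_filt (a : A) : ∃ p, a ∈ filt 𝒢 p := by
  induction a using DirectSum.Decomposition.inductionOn 𝒢 with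
  | zero => exact ⟨0, zero_mem _⟩
  | @homogeneous i m => exact ⟨i, le_filt 𝒢 le_rfl m.2⟩
  | add m m' hm hm' =>
    obtain ⟨p, hp⟩ := hm
    obtain ⟨q, hq⟩ := hm'
    exact ⟨max p q, add_mem (filt_mono 𝒢 (le_max_left _ _) hp) (filt_mono 𝒢 (le_max_right _ _) hq)⟩

lemma exists_mem_filtOpp (a : A) : ∃ p, a ∈ filtOpp 𝒢 p := by
  induction a using DirectSum.Decomposition.inductionOn 𝒢 with
  | zero => exact ⟨0, zero_mem _⟩
  | @homogeneous i m => exact ⟨-i, le_filtOpp 𝒢 (by simp) m.2⟩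
  | add m m' hm hm' =>
    obtain ⟨p, hp⟩ := hm
    obtain ⟨q, hq⟩ := hm'
    exact ⟨max p q, add_mem (filtOpp_mono 𝒢 (le_max_left _ _) hp)
      (filtOpp_mono 𝒢 (le_max_right _ _) hq)⟩

variable [∀ d, TopologicalSpace (𝒢 d)] [∀ d, IsTopologicalAddGroup (𝒢 d)]
  [∀ d, ContinuousConstSMul k (𝒢 d)]

/-- The closure of `A(d) ∩ (A · F_{-t-1} A)` in `A(d)`, for an arbitrary integer `t`. -/
def clI (t d : ℤ) : Submodule k A :=
  (degClosure 𝒢 (⊤ * filt 𝒢 (-t - 1)) d).map (𝒢 d).subtype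

lemma clI_le (t d : ℤ) : clI 𝒢 t d ≤ 𝒢 d := Submodule.map_subtype_le _ _

lemma clI_anti {s t : ℤ} (h : s ≤ t) (d : ℤ) : clI 𝒢 t d ≤ clI 𝒢 s d :=
  Submodule.map_mono (degClosure_mono 𝒢 (mul_le_mul' le_rfl (filt_mono 𝒢 (by omega))) d)

/-- In each degree the right ideals are the left ones with a shifted index, so one family of
subspaces serves both sides. The index `n - d` can be negative, which is why `clI` is indexed by
integers. -/
lemma rightI_map_eq (n : ℕ) (d : ℤ) : (rightI 𝒢 n d).map (𝒢 d).subtype = clI 𝒢 (n - d) d := by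
  unfold rightI clI degClosure
  congr 2
  ext x
  simp only [Submodule.mem_comap, Submodule.coe_subtype]
  rw [mem_top_mul_filt_iff 𝒢 x.2, mem_filtOpp_mul_top_iff 𝒢 x.2,
    show d + (-(n : ℤ) - 1) = -(n - d) - 1 by ring]

lemma rightIdeal_eq (n : ℕ) : rightIdeal 𝒢 n = ⨆ d, clI 𝒢 (n - d) d :=
  iSup_congr fun d => rightI_map_eq 𝒢 n d

lemma mem_clI_iff {t d : ℤ} {x : A} : x ∈ clI 𝒢 t d ↔
    ∃ h : x ∈ 𝒢 d, (⟨x, h⟩ : 𝒢 d) ∈ degClosure 𝒢 (⊤ * filt 𝒢 (-t - 1)) d := by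
  unfold clI
  constructor
  · rintro ⟨y, hy, rfl⟩
    exact ⟨y.2, hy⟩
  · rintro ⟨h, hx⟩
    exact ⟨_, hx, rfl⟩

lemma mem_clI_of_mem {t d : ℤ} {x : A} (hx : x ∈ 𝒢 d)
    (h : x ∈ (⊤ * filt 𝒢 (-t - 1) : Submodule k A)) : x ∈ clI 𝒢 t d :=
  (mem_clI_iff 𝒢).2 ⟨hx, Submodule.le_topologicalClosure _ h⟩

lemma mul_mem_clI_of_le {i j t d : ℤ} {x y : A} (hx : x ∈ 𝒢 i) (hy : y ∈ 𝒢 j) (hj : j ≤ -t - 1)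
    (hd : i + j = d) : x * y ∈ clI 𝒢 t d := by
  subst hd
  exact mem_clI_of_mem 𝒢 (SetLike.mul_mem_graded hx hy)
    (Submodule.mul_mem_mul trivial (le_filt 𝒢 hj hy))

lemma graded_le_clI {t d : ℤ} (h : d ≤ -t - 1) : 𝒢 d ≤ clI 𝒢 t d := fun x hx => by
  simpa using mul_mem_clI_of_le 𝒢 (SetLike.one_mem_graded 𝒢) hx h (zero_add d)

lemma graded_le_clI_of_neg {t d : ℤ} (h : t ≤ -1) : 𝒢 d ≤ clI 𝒢 t d := fun x hx => by
  simpa using mul_mem_clI_of_le 𝒢 hx (SetLike.one_mem_graded 𝒢) (by omega) (add_zero d)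

variable [IsCompatible 𝒢]

lemma graded_mul_mem_clI {e t d f : ℤ} {a b : A} (ha : a ∈ 𝒢 e) (hb : b ∈ clI 𝒢 t d)
    (hf : e + d = f) : a * b ∈ clI 𝒢 t f := by
  subst hf
  obtain ⟨hb₁, hb₂⟩ := (mem_clI_iff 𝒢).1 hb
  exact (mem_clI_iff 𝒢).2 ⟨SetLike.mul_mem_graded ha hb₁,
    mul_degClosure_mem 𝒢 (graded_mul_left_span_le 𝒢 e _) rfl ⟨a, ha⟩ _ hb₂ _ rfl⟩

/-- A right factor of degree `e` raises the degree bound on the last factor by `e`, so the index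
drops by `e`; multiplication on the left costs nothing. -/
lemma clI_mul_graded_mem {e t d f s : ℤ} {a b : A} (hb : b ∈ clI 𝒢 t d) (ha : a ∈ 𝒢 e)
    (hf : d + e = f) (hs : s ≤ t - e) : b * a ∈ clI 𝒢 s f := by
  subst hf
  obtain ⟨hb₁, hb₂⟩ := (mem_clI_iff 𝒢).1 hb
  exact (mem_clI_iff 𝒢).2 ⟨SetLike.mul_mem_graded hb₁ ha,
    degClosure_mul_mem 𝒢 (left_span_mul_graded_le 𝒢 (by omega)) rfl ⟨a, ha⟩ _ hb₂ _ rfl⟩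

lemma exists_sub_mem_clI {t d : ℤ} {b : A} (hb : b ∈ clI 𝒢 t d) (m : ℕ) :
    ∃ c ∈ degProd 𝒢 (-t - 1) d, b - c ∈ clI 𝒢 m d := by
  obtain ⟨hb₁, hb₂⟩ := (mem_clI_iff 𝒢).1 hb
  have hmem : (leftI 𝒢 m d : Set (𝒢 d)) ∈ 𝓝 (0 : 𝒢 d) :=
    (IsCompatible.hasBasis (𝒢 := 𝒢) d).mem_of_mem trivial
  have hc : ContinuousAt (fun y : 𝒢 d => (⟨b, hb₁⟩ : 𝒢 d) - y) ⟨b, hb₁⟩ := by fun_prop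
  have := hc.preimage_mem_nhds (t := (leftI 𝒢 m d : Set (𝒢 d))) (by simpa using hmem)
  obtain ⟨y, hy₁, hy₂⟩ := mem_closure_iff_nhds.1 hb₂ _ this
  exact ⟨y, (mem_top_mul_filt_iff 𝒢 y.2).1 hy₂, _, hy₁, rfl⟩

variable {𝒢} in
-- Separatedness in the form used below: exact identities in `A` are obtained by pushing an element
-- into every I_m.
lemma IsQuasiFinite.eq_zero (hA : IsQuasiFinite 𝒢) {d : ℤ} {b : A}
    (hb : ∀ m : ℕ, b ∈ clI 𝒢 m d) : b = 0 := by
  have := (hA.complete d).1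
  have hb₁ := clI_le 𝒢 _ _ (hb 0)
  have : (⟨b, hb₁⟩ : 𝒢 d) = 0 := by
    by_contra hne
    have hcompl : ({⟨b, hb₁⟩}ᶜ : Set (𝒢 d)) ∈ 𝓝 (0 : 𝒢 d) :=
      isOpen_compl_singleton.mem_nhds (by simpa using Ne.symm hne)
    obtain ⟨m, -, hm⟩ := (IsCompatible.hasBasis (𝒢 := 𝒢) d).mem_iff.1 hcompl
    exact hm ((mem_clI_iff 𝒢).1 (hb m)).2 rfl
  simpa using congrArg Subtype.val this

end Graded

end

/-! ### Limits in complete groups, and polynomials in the Hamiltonian -/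

section

section TopologicalGroup

variable {V : Type u} [AddCommGroup V] [TopologicalSpace V] [IsTopologicalAddGroup V]
  {W : ℕ → AddSubgroup V}

lemma isClosed_of_hasBasis
    (hW : (𝓝 (0 : V)).HasBasis (fun _ : ℕ => True) fun n => (W n : Set V)) (n : ℕ) : IsClosed (W n : Set V) :=
  AddSubgroup.isClosed_of_isOpen _
    (AddSubgroup.isOpen_of_mem_nhds _ (hW.mem_of_mem (i := n) trivial))

lemma exists_limit_of_complete
    (hW : (𝓝 (0 : V)).HasBasis (fun _ : ℕ => True) fun n => (W n : Set V))
    (hV : @CompleteSpace V (IsTopologicalAddGroup.rightUniformSpace V))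
    {u : ℕ → V} (hu : ∀ m, ∀ j ≥ m, u j - u m ∈ W m) : ∃ x, ∀ m, x - u m ∈ W m := by
  let _ := IsTopologicalAddGroup.rightUniformSpace V
  have : IsUniformAddGroup V := isUniformAddGroup_of_addCommGroup
  have hc : CauchySeq u := by
    rw [hW.uniformity_of_nhds_zero.cauchySeq_iff]
    refine fun m _ => ⟨m, fun i hi j hj => ?_⟩
    have := sub_mem (hu m j hj) (hu m i hi)
    simpa using this
  obtain ⟨x, hx⟩ := cauchySeq_tendsto_of_complete hc
  refine ⟨x, fun m => (isClosed_of_hasBasis hW m).mem_of_tendsto (hx.sub_const (u m)) ?_⟩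
  exact Filter.eventually_atTop.2 ⟨m, fun j hj => hu m j hj⟩

/-- The neighbourhood basis is countable, so completeness can be tested on sequences, and any Cauchy
sequence can be thinned to one with the prescribed rate. -/
lemma complete_of_exists_limit
    (hW : (𝓝 (0 : V)).HasBasis (fun _ : ℕ => True) fun n => (W n : Set V))
    (hlim : ∀ u : ℕ → V, (∀ m, ∀ j ≥ m, u j - u m ∈ W m) → ∃ x, ∀ m, x - u m ∈ W m) :
    @CompleteSpace V (IsTopologicalAddGroup.rightUniformSpace V) := by
  let _ := IsTopologicalAddGroup.rightUniformSpace V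
  have : IsUniformAddGroup V := isUniformAddGroup_of_addCommGroup
  have : (uniformity V).IsCountablyGenerated := 
    hW.uniformity_of_nhds_zero.isCountablyGenerated
  refine UniformSpace.complete_of_cauchySeq_tendsto fun u hu => ?_
  have hu' := fun m => hW.uniformity_of_nhds_zero.cauchySeq_iff.1 hu m trivial
  choose N hN using hu'
  -- The supremum over all earlier moduli makes the thinning indices monotone, so that `φ j` is past
  -- `N m` for every `j ≥ m`.
  let φ : ℕ → ℕ := fun m => (Finset.range (m + 1)).sup N
  have hφ : ∀ m, ∀ j ≥ m, N m ≤ φ j := fun m j hj =>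
    Finset.le_sup (f := N) (Finset.mem_range.2 (by omega))
  obtain ⟨x, hx⟩ := hlim (u ∘ φ) fun m j hj => by
    have := hN m _ (hφ m m le_rfl) _ (hφ m j hj)
    simpa using this
  refine ⟨x, ?_⟩
  rw [← tendsto_sub_nhds_zero_iff, hW.tendsto_right_iff]
  refine fun m _ => Filter.eventually_atTop.2 ⟨N m, fun j hj => ?_⟩
  have h₁ := hN m _ (hφ m m le_rfl) j hj
  have h₂ := hx m
  have := sub_mem (show u j - u (φ m) ∈ W m by simpa using h₁) h₂
  simpa using this

end TopologicalGroup

section Graded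

variable {k : Type u} [Field k] {A : Type u} [Ring A] [Algebra k A] {𝒢 : ℤ → Submodule k A}
  [GradedAlgebra 𝒢] [∀ d, TopologicalSpace (𝒢 d)] [∀ d, IsTopologicalAddGroup (𝒢 d)]
  [∀ d, ContinuousConstSMul k (𝒢 d)] [IsCompatible 𝒢]

lemma IsQuasiFinite.exists_limit (hA : IsQuasiFinite 𝒢) {d : ℤ} {a : ℕ → A}
    (ha : ∀ m, a m ∈ 𝒢 d) (hc : ∀ m : ℕ, a (m + 1) - a m ∈ clI 𝒢 m d) :
    ∃ x ∈ 𝒢 d, ∀ m : ℕ, x - a m ∈ clI 𝒢 m d := by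
  have hc' : ∀ m : ℕ, ∀ j ≥ m, a j - a m ∈ clI 𝒢 m d := by
    intro m j hj
    induction j, hj using Nat.le_induction with
    | base => simp
    | succ j hj ih =>
      have := add_mem (clI_anti 𝒢 (by exact_mod_cast hj) d (hc j)) ih
      rwa [sub_add_sub_cancel] at this
  obtain ⟨x, hx⟩ := exists_limit_of_complete (V := 𝒢 d)
    (W := fun m => (leftI 𝒢 m d).toAddSubgroup)
    (IsCompatible.hasBasis (𝒢 := 𝒢) d) (hA.complete d).2 (u := fun m => ⟨a m, ha m⟩)
    fun m j hj => ((mem_clI_iff 𝒢).1 (hc' m j hj)).2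
  exact ⟨x, x.2, fun m => ⟨_, hx m, rfl⟩⟩

open Polynomial

lemma aeval_mem_zero (h : 𝒢 0) (p : k[X]) : aeval (h : A) p ∈ 𝒢 0 := by
  have : aeval (h : A) p = ((aeval h p : 𝒢 0) : A) := by
    have := aeval_algHom_apply (SetLike.GradeZero.subalgebra 𝒢).val h p
    exact this
  rw [this]
  exact (aeval h p).2

variable (𝒢) in
/-- The minimal polynomial of `h` in `A(0) / I_0(A(0))`. -/
noncomputable def minpolyZero (h : 𝒢 0) : k[X] :=
  minpoly k (Ideal.Quotient.mk (zeroIdeal 𝒢 0) h)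

lemma IsQuasiFinite.isIntegral (hA : IsQuasiFinite 𝒢) (h : 𝒢 0) :
    IsIntegral k (Ideal.Quotient.mk (zeroIdeal 𝒢 0) h) := by
  have : Module.Finite k (𝒢 0 ⧸ zeroIdeal 𝒢 0) := hA.finite 0 0
  exact Algebra.IsIntegral.isIntegral _

lemma IsQuasiFinite.minpolyZero_monic (hA : IsQuasiFinite 𝒢) (h : 𝒢 0) :
    (minpolyZero 𝒢 h).Monic := minpoly.monic (hA.isIntegral h)

lemma aeval_minpolyZero_mem (h : 𝒢 0) : aeval (h : A) (minpolyZero 𝒢 h) ∈ clI 𝒢 0 0 := by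
  have h₁ : aeval (Ideal.Quotient.mk (zeroIdeal 𝒢 0) h) (minpolyZero 𝒢 h) = 0 := minpoly.aeval _ _
  have h₂ := aeval_algHom_apply (Ideal.Quotient.mkₐ k (zeroIdeal 𝒢 0)) h (minpolyZero 𝒢 h)
  have h₃ : Ideal.Quotient.mk (zeroIdeal 𝒢 0) (aeval h (minpolyZero 𝒢 h)) = 0 := h₂.symm.trans h₁
  rw [Ideal.Quotient.eq_zero_iff_mem] at h₃
  have h₄ : aeval (h : A) (minpolyZero 𝒢 h) = ((aeval h (minpolyZero 𝒢 h) : 𝒢 0) : A) :=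
    aeval_algHom_apply (SetLike.GradeZero.subalgebra 𝒢).val h (minpolyZero 𝒢 h)
  rw [h₄]
  exact ⟨_, h₃, rfl⟩

/-- The relation [h, a] = d a reads a h = (h - d) a, and this propagates to powers. -/
lemma IsHamiltonian.mul_aeval {h : A} (hh : IsHamiltonian 𝒢 h) {d : ℤ} {a : A} (ha : a ∈ 𝒢 d)
    (p : k[X]) : a * aeval h p = aeval h (p.comp (X - C (d : k))) * a := by
  have h₁ : a * h = (h - algebraMap k A d) * a := by
    have := (hh d a).1 ha
    rw [sub_mul, map_intCast, ← zsmul_eq_mul, ← this]; abel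
  rw [aeval_comp]
  simp only [map_sub, aeval_X, aeval_C]
  induction p using Polynomial.induction_on' with
  | add p q hp hq => simp only [map_add, mul_add, add_mul, hp, hq]
  | monomial n c =>
    simp only [aeval_monomial]
    have : ∀ n : ℕ, a * h ^ n = (h - algebraMap k A d) ^ n * a := by
      intro n
      induction n with
      | zero => simp
      | succ n ih => rw [pow_succ, ← mul_assoc, ih, mul_assoc, h₁, ← mul_assoc, pow_succ]
    rw [← mul_assoc, ← Algebra.commutes, mul_assoc, this, mul_assoc]

lemma IsHamiltonian.aeval_mul {h : A} (hh : IsHamiltonian 𝒢 h) {d : ℤ} {a : A} (ha : a ∈ 𝒢 d)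
    (p : k[X]) : aeval h p * a = a * aeval h (p.comp (X + C (d : k))) := by
  rw [hh.mul_aeval ha, comp_assoc]
  simp

/-- Modulo I_t, an element of I_{t-1} is a sum of products u v with deg v ≤ -t. If deg v < -t, then
u v is already in I_t. If deg v = -t, then v φ(h - t) = φ(h) v, and φ(h) ∈ I_0 gives φ(h) v ∈ I_t.
-/
lemma mul_aeval_comp_mem {h : 𝒢 0} (hh : IsHamiltonian 𝒢 (h : A)) {φ : k[X]}
    (hφ : aeval (h : A) φ ∈ clI 𝒢 0 0) {t d : ℤ} {b : A} (hb : b ∈ clI 𝒢 (t - 1) d) :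
    b * aeval (h : A) (φ.comp (X - C (t : k))) ∈ clI 𝒢 t d := by
  set y := aeval (h : A) (φ.comp (X - C (t : k)))
  have hy : y ∈ 𝒢 0 := aeval_mem_zero h _
  -- The integer `t` may be negative, while approximation is available only at natural indices; any
  -- index that is at least `t` suffices.
  obtain ⟨c, hc, hbc⟩ := exists_sub_mem_clI 𝒢 hb t.toNat
  suffices H : c * y ∈ clI 𝒢 t d by
    have h₁ : (b - c) * y ∈ clI 𝒢 t d :=
      clI_mul_graded_mem 𝒢 (clI_anti 𝒢 (Int.self_le_toNat t) d hbc) hy (add_zero d) (by simp)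
    have := add_mem h₁ H
    rwa [← add_mul, sub_add_cancel] at this
  rw [degProd] at hc
  clear hbc
  induction hc using Submodule.iSup_induction' with
  | zero => rw [zero_mul]; exact zero_mem _
  | add u v _ _ hu hv => rw [add_mul]; exact add_mem hu hv
  | mem j c hc =>
    by_cases hj : j ≤ -(t - 1) - 1
    swap
    · simp only [hj, iSup_false, Submodule.mem_bot] at hc
      rw [hc, zero_mul]; exact zero_mem _
    simp only [hj, iSup_true] at hc
    induction hc using Submodule.mul_induction_on' with
    | add u _ v _ hu hv => rw [add_mul]; exact add_mem hu hv
    | mem_mul_mem u hu v hv =>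
      rcases (show j ≤ -t by omega).lt_or_eq with hlt | rfl
      · exact clI_mul_graded_mem 𝒢 (mul_mem_clI_of_le 𝒢 (t := t) hu hv (by omega)
          (by omega)) hy (add_zero d) (by simp)
      · rw [mul_assoc, hh.mul_aeval hv, comp_assoc]
        simp only [sub_comp, X_comp, C_comp, Int.cast_neg, map_neg, sub_neg_eq_add, 
          add_sub_cancel_right, comp_X]
        exact graded_mul_mem_clI 𝒢 hu (clI_mul_graded_mem 𝒢 hφ hv (zero_add _) (by simp)) (by ring)

/-- The product of the translates of `φ` by the integers `m + 1, …, m + l`. -/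
noncomputable def shiftProd (φ : k[X]) (m : ℤ) (l : ℕ) : k[X] :=
  ∏ i ∈ Finset.range l, φ.comp (X - C ((m + 1 + i : ℤ) : k))

lemma mul_aeval_shiftProd_mem {h : 𝒢 0} (hh : IsHamiltonian 𝒢 (h : A)) {φ : k[X]}
    (hφ : aeval (h : A) φ ∈ clI 𝒢 0 0) {m d : ℤ} {b : A} (hb : b ∈ clI 𝒢 m d) (l : ℕ) :
    b * aeval (h : A) (shiftProd φ m l) ∈ clI 𝒢 (m + l) d := by
  induction l with
  | zero => simpa [shiftProd] using hb
  | succ l ih =>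
    rw [shiftProd, Finset.prod_range_succ, map_mul, ← mul_assoc]
    have := mul_aeval_comp_mem hh hφ (t := m + 1 + l) (b := b * aeval (h : A) (shiftProd φ m l))
      (by convert ih using 2; ring)
    rwa [show m + ((l + 1 : ℕ) : ℤ) = m + 1 + l by push_cast; ring]

lemma shiftProd_add (φ : k[X]) (m : ℤ) (l l' : ℕ) :
    shiftProd φ m (l + l') = shiftProd φ m l * shiftProd φ (m + l) l' := by
  unfold shiftProd
  rw [Finset.prod_range_add]
  congr 1
  refine Finset.prod_congr rfl fun i _ => ?_
  congr 4
  push_cast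
  ring

lemma shiftProd_comp (φ : k[X]) (m d : ℤ) (l : ℕ) :
    (shiftProd φ m l).comp (X - C (d : k)) = shiftProd φ (m + d) l := by
  unfold shiftProd
  rw [Polynomial.prod_comp]
  refine Finset.prod_congr rfl fun i _ => ?_
  rw [comp_assoc]
  simp only [sub_comp, X_comp, C_comp]
  congr 1
  rw [sub_sub, ← C_add]
  congr 2
  push_cast
  ring

lemma shiftProd_monic {φ : k[X]} (hφ : φ.Monic) (m : ℤ) (l : ℕ) : (shiftProd φ m l).Monic :=
  monic_prod_of_monic _ _ fun _ _ => hφ.comp_X_sub_C _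

lemma isRoot_shiftProd {φ : k[X]} {m : ℤ} {l : ℕ} {x : k} :
    (shiftProd φ m l).IsRoot x ↔ ∃ i < l, φ.IsRoot (x - ((m + 1 + i : ℤ) : k)) := by
  unfold shiftProd
  rw [IsRoot, eval_prod, Finset.prod_eq_zero_iff]
  simp [IsRoot]

end Graded

end

/-! ### Roots of polynomials, the sets Γ_n, and idempotents obtained by Chinese remaindering -/

section

open Polynomial

section Roots

variable {k : Type u} [Field k] [IsAlgClosed k]

lemma isCoprime_of_forall_isRoot {p q : k[X]} (h : ∀ x, p.IsRoot x → ¬ q.IsRoot x) :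
    IsCoprime p q := by
  rw [Polynomial.isCoprime_iff_aeval_ne_zero_of_isAlgClosed k k]
  intro x
  by_contra! hx
  exact h x (by simpa using hx.1) (by simpa using hx.2)

open Classical in
/-- The product of the linear factors of `p` that belong to its roots in `T`. -/
noncomputable def rootPart (p : k[X]) (T : Set k) : k[X] :=
  ((p.roots.filter (· ∈ T)).map fun x => X - C x).prod

lemma isRoot_rootPart {p : k[X]} {T : Set k} {x : k} :
    (rootPart p T).IsRoot x ↔ x ∈ p.roots ∧ x ∈ T := by
  classical
  rw [rootPart, IsRoot, eval_multiset_prod, Multiset.prod_eq_zero_iff]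
  simp [sub_eq_zero]

lemma rootPart_mul_rootPart_compl {p : k[X]} (hp : p.Monic) (T : Set k) :
    rootPart p T * rootPart p Tᶜ = p := by
  classical
  conv_rhs => rw [(IsAlgClosed.splits p).eq_prod_roots_of_monic hp]
  rw [rootPart, rootPart, ← Multiset.prod_add, ← Multiset.map_add]
  congr 2
  convert Multiset.filter_add_not (· ∈ T) p.roots

lemma dvd_rootPart {p q : k[X]} (hp : p.Monic) (hq : q.Monic) (h : p ∣ q) {T : Set k}
    (hT : ∀ x, p.IsRoot x → x ∈ T) : p ∣ rootPart q T := by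
  classical
  conv_lhs => rw [(IsAlgClosed.splits p).eq_prod_roots_of_monic hp]
  refine Multiset.prod_dvd_prod_of_le (Multiset.map_le_map ?_)
  rw [Multiset.le_filter]
  exact ⟨roots.le_of_dvd hq.ne_zero h, fun x hx => hT x (isRoot_of_mem_roots hx)⟩

end Roots

variable {k : Type u} [Field k] {A : Type u} [Ring A] [Algebra k A] {𝒢 : ℤ → Submodule k A}
  [GradedAlgebra 𝒢] [∀ d, TopologicalSpace (𝒢 d)] [∀ d, IsTopologicalAddGroup (𝒢 d)]
  [∀ d, ContinuousConstSMul k (𝒢 d)] [IsCompatible 𝒢]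

section SpecRange

variable [CharZero k]

lemma specRange_mono (h : 𝒢 0) {m m' : ℕ} (hm : m ≤ m') : specRange 𝒢 h m ⊆ specRange 𝒢 h m' :=
  fun _ ⟨y, hy, j, hj, hx⟩ => ⟨y, hy, j, hj.trans hm, hx⟩

lemma IsQuasiFinite.spec_finite (hA : IsQuasiFinite 𝒢) (h : 𝒢 0) : (spec 𝒢 h 0).Finite :=
  Polynomial.finite_setOfPred_isRoot (hA.minpolyZero_monic h).ne_zero

/-- Among the points x - j of Ω_0 with j natural, the lowest belongs to Γ_0, and its distance j to x
is one of the differences bounded by g. -/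
lemma IsQuasiFinite.spec_subset (hA : IsQuasiFinite 𝒢) (h : 𝒢 0) :
    spec 𝒢 h 0 ⊆ specRange 𝒢 h (gap 𝒢 h) := by
  intro x hx
  have hfin : {j : ℕ | x - j ∈ spec 𝒢 h 0}.Finite :=
    (hA.spec_finite h).preimage fun a _ b _ hab => by
      simpa using hab
  -- `gap` is a supremum in ℕ, an upper bound only if the set is bounded; here Ω_0 is finite and ℕ
  -- embeds in `k`.
  have hbdd : BddAbove {m : ℕ | ∃ x ∈ spec 𝒢 h 0, ∃ y ∈ spec 𝒢 h 0, x - y = (m : k)} := by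
    refine Set.Finite.bddAbove ?_
    refine (((hA.spec_finite h).image2 (· - ·) (hA.spec_finite h)).preimage
      (f := fun m : ℕ => (m : k)) (Nat.cast_injective.injOn)).subset ?_
    rintro m ⟨x, hx, y, hy, e⟩
    exact ⟨x, hx, y, hy, e⟩
  obtain ⟨j, hj, hmax⟩ := hfin.exists_maximal (s := {j : ℕ | x - j ∈ spec 𝒢 h 0})
    ⟨0, by simpa using hx⟩
  refine ⟨x - j, ⟨hj, ?_⟩, j, ?_, by ring⟩
  · rintro y hy ⟨m, hm⟩
    have e : y = x - ((j + m : ℕ) : k) := by push_cast; rw [← hm]; ring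
    have := hmax (y := j + m) (by rw [e] at hy; exact hy) (by simp)
    have hm0 : m = 0 := by have : j + m ≤ j := this; omega
    rw [e, hm0, add_zero]
  · exact le_csSup hbdd ⟨x, hx, x - j, hj, by ring⟩

lemma IsQuasiFinite.spec_add_mem (hA : IsQuasiFinite 𝒢) (h : 𝒢 0) {x : k} (hx : x ∈ spec 𝒢 h 0)
    {i m : ℕ} (hm : i + gap 𝒢 h ≤ m) : x + i ∈ specRange 𝒢 h m := by
  obtain ⟨y, hy, j, hj, rfl⟩ := hA.spec_subset h hx
  exact ⟨y, hy, j + i, by omega, by push_cast; ring⟩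

/-- If x = y + j with y ∈ Γ_0 and j ≤ m < i, then x - i would be a point of Ω_0 strictly below the
minimal y. -/
lemma notMem_specRange_of_lt {h : 𝒢 0} {m i : ℕ} (hi : m < i) {x : k}
    (hx : x - i ∈ spec 𝒢 h 0) : x ∉ specRange 𝒢 h m := by
  rintro ⟨y, hy, j, hj, rfl⟩
  have := hy.2 _ hx ⟨i - j, by rw [Nat.cast_sub (by omega)]; ring⟩
  have h' : (j : k) = i := by linear_combination this
  have := Nat.cast_injective h'
  omega

/-- Write x = y + j and x - i - l = z + c with y, z ∈ Γ_0. These differ by an integer and are both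
minimal, so y = z and j = i + l + c; then x - i = y + (l + c) with l + c ≤ m. -/
lemma IsQuasiFinite.mem_specRange_of_sub_mem (hA : IsQuasiFinite 𝒢) {h : 𝒢 0} {m i l : ℕ} {x : k}
    (hx : x ∈ specRange 𝒢 h (m + i)) (hl : x - i - l ∈ spec 𝒢 h 0) :
    x - i ∈ specRange 𝒢 h m := by
  obtain ⟨y, hy, j, hj, rfl⟩ := hx
  obtain ⟨z, hz, c, hc, e⟩ := hA.spec_subset h hl
  have hyz : y = z ∧ j = i + l + c := by
    rcases le_total j (i + l + c) with hle | hle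
    · have h₁ := hy.2 z hz.1 ⟨i + l + c - j, by
        rw [Nat.cast_sub hle]; push_cast; linear_combination e⟩
      refine ⟨h₁.symm, Nat.cast_injective (R := k) ?_⟩
      push_cast; linear_combination e + h₁
    · have h₁ := hz.2 y hy.1 ⟨j - (i + l + c), by
        rw [Nat.cast_sub hle]; push_cast; linear_combination -e⟩
      refine ⟨h₁, Nat.cast_injective (R := k) ?_⟩
      push_cast; linear_combination e - h₁
  obtain ⟨rfl, rfl⟩ := hyz
  exact ⟨y, hy, l + c, by omega, by push_cast; ring⟩

end SpecRange

section SpectralIdempotent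

/-- `e` is the idempotent of `A(0)` that projects to the part of the spectrum of `h` given by the
roots of `P`, along the parts given by the roots of the polynomials `Q M`. -/
structure IsSpectralIdempotent (h : 𝒢 0) (P : k[X]) (Q : ℕ → k[X]) (e : A) : Prop where
  mem : e ∈ 𝒢 0
  aeval_mul : aeval (h : A) P * e = 0
  exists_sub_mem : ∀ M : ℕ, ∃ s, 1 - e - aeval (h : A) (s * P) ∈ clI 𝒢 M 0
  tail_mem : ∀ M : ℕ, aeval (h : A) (Q M) * (1 - e) ∈ clI 𝒢 M 0

lemma zero_mul_mem_clI {t d : ℤ} {a b : A} (ha : a ∈ 𝒢 0) (hb : b ∈ clI 𝒢 t d) :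
    a * b ∈ clI 𝒢 t d := graded_mul_mem_clI 𝒢 ha hb (zero_add d)

lemma mul_zero_mem_clI {t d : ℤ} {a b : A} (ha : a ∈ 𝒢 0) (hb : b ∈ clI 𝒢 t d) :
    b * a ∈ clI 𝒢 t d := clI_mul_graded_mem 𝒢 hb ha (add_zero d) (by simp)

lemma IsHamiltonian.commute_aeval {h : A} (hh : IsHamiltonian 𝒢 h) {a : A} (ha : a ∈ 𝒢 0)
    (p : k[X]) : a * aeval h p = aeval h p * a := by
  rw [hh.mul_aeval ha]; simp

/-- Take Bézout relations s_M P + t_M Q_M = 1. The polynomial t_M Q_M is 1 modulo P and 0 modulo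
Q_M, and Q_M divides Q_{M+1}, so consecutive ones differ by a multiple of P Q_M, whose value at h is
in I_M. Hence their values at h converge, and the limit is `e`. -/
lemma IsQuasiFinite.exists_isSpectralIdempotent (hA : IsQuasiFinite 𝒢) {h : 𝒢 0}
    {P : k[X]} {Q : ℕ → k[X]} (hcop : ∀ M, IsCoprime P (Q M))
    (hdvd : ∀ M, Q M ∣ Q (M + 1)) (hI : ∀ M : ℕ, aeval (h : A) (P * Q M) ∈ clI 𝒢 M 0) :
    ∃ e, IsSpectralIdempotent h P Q e := by
  choose s t hst using hcop
  have hstep : ∀ M, P * Q M ∣ t (M + 1) * Q (M + 1) - t M * Q M := fun M => by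
    have h₁ : t (M + 1) * Q (M + 1) - t M * Q M = P * (s M - s (M + 1)) := by
      linear_combination hst (M + 1) - hst M
    exact IsCoprime.mul_dvd ⟨s M, t M, hst M⟩ ⟨_, h₁⟩
      (dvd_sub ((hdvd M).mul_left _) (dvd_mul_left _ _))
  obtain ⟨e, he, hlim⟩ := hA.exists_limit (a := fun M => aeval (h : A) (t M * Q M))
    (fun M => aeval_mem_zero h _) fun M => by
      obtain ⟨c, hc⟩ := hstep M
      rw [← map_sub, hc, map_mul]
      exact mul_zero_mem_clI (aeval_mem_zero h _) (hI M)
  have hcompl : ∀ M : ℕ, 1 - e - aeval (h : A) (s M * P) ∈ clI 𝒢 M 0 := fun M => by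
    have h₁ : 1 - e - aeval (h : A) (s M * P) = -(e - aeval (h : A) (t M * Q M)) := by
      rw [show s M * P = 1 - t M * Q M by linear_combination hst M, map_sub, map_one]
      abel
    rw [h₁]
    exact neg_mem (hlim M)
  refine ⟨e, he, hA.eq_zero (d := 0) fun M => ?_, fun M => ⟨s M, hcompl M⟩, fun M => ?_⟩
  · have h₁ := zero_mul_mem_clI (aeval_mem_zero h P) (hlim M)
    have h₂ := mul_zero_mem_clI (aeval_mem_zero h (t M)) (hI M)
    have := add_mem h₁ h₂
    rwa [mul_sub, ← map_mul, ← map_mul,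
      show P * (t M * Q M) = P * Q M * t M by ring, sub_add_cancel] at this
  · have h₁ := zero_mul_mem_clI (aeval_mem_zero h (Q M)) (hcompl M)
    have h₂ := mul_zero_mem_clI (aeval_mem_zero h (s M)) (hI M)
    have := add_mem h₁ h₂
    rwa [mul_sub, ← map_mul, ← map_mul,
      show Q M * (s M * P) = P * Q M * s M by ring, sub_add_cancel] at this

variable {h : 𝒢 0} {P : k[X]} {Q : ℕ → k[X]} {e : A}

/-- If u R + v Q_M = 1, then (1 - e) a = v(h) Q_M(h) (1 - e) a, and the factor Q_M(h) (1 - e) is in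
I_M for every M. -/
lemma IsSpectralIdempotent.one_sub_mul_eq_zero (he : IsSpectralIdempotent h P Q e)
    (hA : IsQuasiFinite 𝒢) (hh : IsHamiltonian 𝒢 (h : A)) {R : k[X]} (hR : ∀ M, IsCoprime R (Q M))
    {d : ℤ} {a : A} (ha : a ∈ 𝒢 d) (h0 : aeval (h : A) R * a = 0) : (1 - e) * a = 0 := by
  have he1 : 1 - e ∈ 𝒢 0 := sub_mem (SetLike.one_mem_graded 𝒢) he.mem
  refine hA.eq_zero (d := d) fun m => ?_
  -- Right multiplication by `a` costs `d` in the index, so M ≥ m + d is what ends in I_m.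
  set M := (m + d).toNat
  obtain ⟨u, v, huv⟩ := hR M
  have key : (1 - e) * a = aeval (h : A) v * (aeval (h : A) (Q M) * (1 - e)) * a := by
    calc (1 - e) * a = aeval (h : A) (u * R + v * Q M) * (1 - e) * a := by rw [huv]; simp
      _ = aeval (h : A) u * (1 - e) * (aeval (h : A) R * a) +
          aeval (h : A) v * (aeval (h : A) (Q M) * (1 - e)) * a := by
        rw [map_add, map_mul, map_mul, add_mul, add_mul, mul_assoc (aeval (h : A) u) _ (1 - e),
          ← hh.commute_aeval he1]
        noncomm_ring
      _ = _ := by rw [h0]; simp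
  rw [key]
  refine clI_mul_graded_mem 𝒢 (zero_mul_mem_clI (aeval_mem_zero h _) (he.tail_mem M)) ha
    (zero_add d) ?_
  have := Int.self_le_toNat (m + d)
  omega

lemma IsSpectralIdempotent.mul_one_sub_eq_zero (he : IsSpectralIdempotent h P Q e)
    (hA : IsQuasiFinite 𝒢) {R : k[X]} (hR : ∀ M, IsCoprime R (Q M))
    {d : ℤ} {a : A} (ha : a ∈ 𝒢 d) (h0 : a * aeval (h : A) R = 0) : a * (1 - e) = 0 := by
  have he1 : 1 - e ∈ 𝒢 0 := sub_mem (SetLike.one_mem_graded 𝒢) he.mem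
  refine hA.eq_zero (d := d) fun M => ?_
  obtain ⟨u, v, huv⟩ := hR M
  have key : a * (1 - e) = a * (aeval (h : A) v * (aeval (h : A) (Q M) * (1 - e))) := by
    calc a * (1 - e) = a * (aeval (h : A) (R * u + v * Q M) * (1 - e)) := by
          rw [mul_comm R, huv]; simp
      _ = (a * aeval (h : A) R) * (aeval (h : A) u * (1 - e)) +
          a * (aeval (h : A) v * (aeval (h : A) (Q M) * (1 - e))) := by
        rw [map_add, map_mul, map_mul]; noncomm_ring
      _ = _ := by rw [h0]; simp
  rw [key]
  exact graded_mul_mem_clI 𝒢 ha (zero_mul_mem_clI (aeval_mem_zero h _) (he.tail_mem M))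
    (add_zero d)

lemma IsSpectralIdempotent.mul_aeval (he : IsSpectralIdempotent h P Q e)
    (hh : IsHamiltonian 𝒢 (h : A)) : e * aeval (h : A) P = 0 := by
  rw [hh.commute_aeval he.mem, he.aeval_mul]


end SpectralIdempotent

end

/-! ### The spectral projectors e_m and the two-sided ideals they generate -/

section

open Polynomial

/-- The two-sided ideal generated by `x`, as an additive subgroup. -/
def idealGen {R : Type u} [Ring R] (x : R) : AddSubgroup R :=
  AddSubgroup.closure {y | ∃ a b, y = a * x * b}

section IdealGen

variable {R : Type u} [Ring R] {x : R}

lemma mul_mul_mem_idealGen (a b : R) : a * x * b ∈ idealGen x :=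
  AddSubgroup.subset_closure ⟨a, b, rfl⟩

lemma idealGen_mul_mul_mem {y : R} (hy : y ∈ idealGen x) (a b : R) : a * y * b ∈ idealGen x := by
  induction hy using AddSubgroup.closure_induction with
  | mem y hy =>
    obtain ⟨c, d, rfl⟩ := hy
    exact AddSubgroup.subset_closure ⟨a * c, d * b, by noncomm_ring⟩
  | zero => simp
  | add y z _ _ hy hz => rw [mul_add, add_mul]; exact add_mem hy hz
  | neg y _ hy => rw [mul_neg, neg_mul]; exact neg_mem hy

lemma idealGen_le {y : R} (hy : y ∈ idealGen x) : idealGen y ≤ idealGen x :=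
  (AddSubgroup.closure_le _).2 fun _ ⟨a, b, h⟩ => h ▸ idealGen_mul_mul_mem hy a b

end IdealGen

variable {k : Type u} [Field k] [IsAlgClosed k] [CharZero k] {A : Type u} [Ring A] [Algebra k A]
  {𝒢 : ℤ → Submodule k A}
  [GradedAlgebra 𝒢] [∀ d, TopologicalSpace (𝒢 d)] [∀ d, IsTopologicalAddGroup (𝒢 d)]
  [∀ d, ContinuousConstSMul k (𝒢 d)] [IsCompatible 𝒢]

/-- The product of the translates of the minimal polynomial of `h` by `0, …, m`. -/
noncomputable def rangePoly (h : 𝒢 0) (m : ℕ) : k[X] := shiftProd (minpolyZero 𝒢 h) (-1) (m + 1)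

/-- The part of `rangePoly h m` with roots in `Γ_m`. -/
noncomputable def headPoly (h : 𝒢 0) (m : ℕ) : k[X] :=
  rootPart (rangePoly h m) (specRange 𝒢 h m)

/-- The part of `rangePoly h (m + M)` with roots outside of `Γ_m`. -/
noncomputable def tailPoly (h : 𝒢 0) (m M : ℕ) : k[X] :=
  rootPart (rangePoly h m) (specRange 𝒢 h m)ᶜ * shiftProd (minpolyZero 𝒢 h) m M

/-- `e m` is the projector to the part `Γ_m` of the spectrum of `h`, for all `m`. -/
def IsSpectralFamily (h : 𝒢 0) (e : ℕ → A) : Prop :=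
  ∀ m, IsSpectralIdempotent h (headPoly h m) (tailPoly h m) (e m)

variable {h : 𝒢 0}

lemma isRoot_of_isRoot_headPoly {m : ℕ} {x : k} (hx : (headPoly h m).IsRoot x) :
    x ∈ specRange 𝒢 h m := (isRoot_rootPart.1 hx).2

lemma isRoot_tailPoly {m M : ℕ} {x : k} (hx : (tailPoly h m M).IsRoot x) :
    x ∉ specRange 𝒢 h m ∧ ∃ i : ℕ, x - i ∈ spec 𝒢 h 0 := by
  rcases root_mul.1 hx with hx | hx
  · obtain ⟨h₁, h₂⟩ := isRoot_rootPart.1 hx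
    obtain ⟨i, -, hi⟩ := isRoot_shiftProd.1 (isRoot_of_mem_roots h₁)
    have hi' : (minpolyZero 𝒢 h).IsRoot (x - i) := by simpa using hi
    exact ⟨h₂, i, hi'⟩
  · obtain ⟨i, -, hi⟩ := isRoot_shiftProd.1 hx
    have hi' : x - ((m + 1 + i : ℕ) : k) ∈ spec 𝒢 h 0 := by push_cast at hi ⊢; exact hi
    exact ⟨notMem_specRange_of_lt (by omega) hi', _, hi'⟩

/-- The roots of a tail polynomial lie in Ω_0 + ℕ and outside Γ_m, so `R` has to be controlled only
on Ω_0 + ℕ. -/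
lemma isCoprime_tailPoly {m : ℕ} {R : k[X]}
    (hR : ∀ x, R.IsRoot x → ∀ i : ℕ, x - i ∈ spec 𝒢 h 0 → x ∈ specRange 𝒢 h m) (M : ℕ) :
    IsCoprime R (tailPoly h m M) :=
  isCoprime_of_forall_isRoot fun x hx hx' => by
    obtain ⟨h₁, i, hi⟩ := isRoot_tailPoly hx'
    exact h₁ (hR x hx i hi)

lemma isCoprime_headPoly_tailPoly {m j : ℕ} (hmj : m ≤ j) (M : ℕ) :
    IsCoprime (headPoly h m) (tailPoly h j M) :=
  isCoprime_tailPoly (fun _ hx _ _ => specRange_mono h hmj (isRoot_of_isRoot_headPoly hx)) M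

lemma IsQuasiFinite.rangePoly_monic (hA : IsQuasiFinite 𝒢) (h : 𝒢 0) (m : ℕ) :
    (rangePoly h m).Monic := shiftProd_monic (hA.minpolyZero_monic h) _ _

lemma IsQuasiFinite.headPoly_mul_tailPoly (hA : IsQuasiFinite 𝒢) (h : 𝒢 0) (m M : ℕ) :
    headPoly h m * tailPoly h m M = shiftProd (minpolyZero 𝒢 h) (-1) (m + 1 + M) := by
  rw [headPoly, tailPoly, ← mul_assoc,
    rootPart_mul_rootPart_compl (hA.rangePoly_monic h m), shiftProd_add,
    rangePoly]
  simp

/-- The induction starts at index -1, where the ideal is all of A(0) and contains 1; the translates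
by 0, …, l - 1 then gain one step each. -/
lemma IsHamiltonian.aeval_shiftProd_mem (hh : IsHamiltonian 𝒢 (h : A)) (l : ℕ) :
    aeval (h : A) (shiftProd (minpolyZero 𝒢 h) (-1) l) ∈ clI 𝒢 (-1 + l) 0 := by
  have := mul_aeval_shiftProd_mem hh (aeval_minpolyZero_mem h) (m := -1) (b := 1)
    (graded_le_clI_of_neg 𝒢 le_rfl (SetLike.one_mem_graded 𝒢)) l
  rwa [one_mul] at this

lemma exists_isSpectralFamily (hA : IsQuasiFinite 𝒢) (hh : IsHamiltonian 𝒢 (h : A)) :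
    ∃ e, IsSpectralFamily h e := by
  suffices H : ∀ m, ∃ e, IsSpectralIdempotent h (headPoly h m) (tailPoly h m) e by
    choose e he using H
    exact ⟨e, he⟩
  intro m
  refine hA.exists_isSpectralIdempotent (isCoprime_headPoly_tailPoly le_rfl) (fun M => ?_)
    fun M => ?_
  · rw [tailPoly, tailPoly, shiftProd_add]
    exact mul_dvd_mul_left _ (dvd_mul_right _ _)
  -- Head times tail is the product of the translates of φ by 0, …, m + M, whose value is in I_{m+M}
  -- and a fortiori in I_M.
  · rw [hA.headPoly_mul_tailPoly]
    refine clI_anti 𝒢 ?_ 0 (hh.aeval_shiftProd_mem _)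
    push_cast; omega

namespace IsSpectralFamily

variable {e : ℕ → A}

/-- The head polynomial of `m` annihilates `e m` and is coprime to all tails of `j`. The case `m =
j` is the idempotency of `e m`. -/
lemma mul_of_le (he : IsSpectralFamily h e) (hA : IsQuasiFinite 𝒢)
    (hh : IsHamiltonian 𝒢 (h : A)) {m j : ℕ} (hmj : m ≤ j) : e j * e m = e m := by
  have := (he j).one_sub_mul_eq_zero hA hh (isCoprime_headPoly_tailPoly hmj) (he m).mem
    (he m).aeval_mul
  rw [sub_mul, one_mul, sub_eq_zero] at this
  exact this.symm

lemma mul_of_ge (he : IsSpectralFamily h e) (hA : IsQuasiFinite 𝒢)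
    (hh : IsHamiltonian 𝒢 (h : A)) {m j : ℕ} (hmj : m ≤ j) : e m * e j = e m := by
  have := (he j).mul_one_sub_eq_zero hA (isCoprime_headPoly_tailPoly hmj) (he m).mem
    ((he m).mul_aeval hh)
  rw [mul_sub, mul_one, sub_eq_zero] at this
  exact this.symm

lemma isCoprime_shiftProd_headPoly (m M : ℕ) :
    IsCoprime (shiftProd (minpolyZero 𝒢 h) m M) (headPoly h m) :=
  (isCoprime_headPoly_tailPoly le_rfl M).of_mul_right_right.symm

/-- The translates of φ by m + 1, …, m + M push `b` into I_{m+M}, while on `e m` their product is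
invertible, having no root in common with its head polynomial. So `b * e m` lies in every I_M. -/
lemma clI_mul_eq_zero (he : IsSpectralFamily h e) (hA : IsQuasiFinite 𝒢)
    (hh : IsHamiltonian 𝒢 (h : A)) {m : ℕ} {d : ℤ} {b : A} (hb : b ∈ clI 𝒢 m d) :
    b * e m = 0 := by
  refine hA.eq_zero (d := d) fun M => ?_
  obtain ⟨u, v, huv⟩ := isCoprime_shiftProd_headPoly (h := h) m M
  have key : b * e m = b * aeval (h : A) (shiftProd (minpolyZero 𝒢 h) m M) *
      (aeval (h : A) u * e m) := by
    calc b * e m = b * (aeval (h : A) (shiftProd (minpolyZero 𝒢 h) m M * u +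
          v * headPoly h m) * e m) := by rw [mul_comm _ u, huv]; simp
      _ = b * aeval (h : A) (shiftProd (minpolyZero 𝒢 h) m M) * (aeval (h : A) u * e m) +
          b * (aeval (h : A) v * (aeval (h : A) (headPoly h m) * e m)) := by
        rw [map_add, map_mul, map_mul]; noncomm_ring
      _ = _ := by rw [(he m).aeval_mul]; simp
  rw [key]
  exact mul_zero_mem_clI (SetLike.mul_mem_graded (aeval_mem_zero h u) (he m).mem)
    (clI_anti 𝒢 (by omega) d (mul_aeval_shiftProd_mem hh (aeval_minpolyZero_mem h) hb M))

/-- The same argument on the other side: moving the translates of φ by m + 1, … past `b` shifts them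
by -d, which is precisely where an element of I_{m-d}(A(d)) = I^∨_m(A(d)) starts to gain. -/
lemma mul_clI_eq_zero (he : IsSpectralFamily h e) (hA : IsQuasiFinite 𝒢)
    (hh : IsHamiltonian 𝒢 (h : A)) {m : ℕ} {d : ℤ} {b : A} (hb : b ∈ clI 𝒢 (m - d) d) :
    e m * b = 0 := by
  refine hA.eq_zero (d := d) fun N => ?_
  set M := (N + d).toNat
  obtain ⟨u, v, huv⟩ := isCoprime_shiftProd_headPoly (h := h) m M
  have key : e m * b = e m * aeval (h : A) u * 
      (aeval (h : A) (shiftProd (minpolyZero 𝒢 h) m M) * b) := by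
    calc e m * b = e m * aeval (h : A) (u * shiftProd (minpolyZero 𝒢 h) m M +
          headPoly h m * v) * b := by rw [mul_comm _ v, huv]; simp
      _ = e m * aeval (h : A) u * (aeval (h : A) (shiftProd (minpolyZero 𝒢 h) m M) * b) +
          (e m * aeval (h : A) (headPoly h m)) * aeval (h : A) v * b := by
        rw [map_add, map_mul, map_mul]; noncomm_ring
      _ = _ := by rw [(he m).mul_aeval hh]; simp
  rw [key]
  refine zero_mul_mem_clI (by simpa using SetLike.mul_mem_graded (he m).mem (aeval_mem_zero h u)) ?_
  rw [hh.aeval_mul (clI_le 𝒢 _ _ hb)]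
  have e₁ := shiftProd_comp (minpolyZero 𝒢 h) m (-d) M
  rw [Int.cast_neg, map_neg, sub_neg_eq_add] at e₁
  rw [e₁, ← sub_eq_add_neg]
  have := Int.self_le_toNat (N + d)
  exact clI_anti 𝒢 (by omega) d (mul_aeval_shiftProd_mem hh (aeval_minpolyZero_mem h) hb M)

/-- All roots of the translates of φ by 0, …, m lie in Γ_{m+g}, so their product divides the head
polynomial of `j`. Modulo I_m, the element 1 - e_j is a multiple of the value of the latter, and
that value is itself in I_m. -/
lemma one_sub_mem (he : IsSpectralFamily h e) (hA : IsQuasiFinite 𝒢)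
    (hh : IsHamiltonian 𝒢 (h : A)) {m j : ℕ} (hmj : m + gap 𝒢 h ≤ j) : 1 - e j ∈ clI 𝒢 m 0 := by
  have hdvd : rangePoly h m ∣ headPoly h j := by
    refine dvd_rootPart (hA.rangePoly_monic h m) (hA.rangePoly_monic h j) ?_ fun x hx => ?_
    · rw [rangePoly, rangePoly, show j + 1 = (m + 1) + (j - m) by omega,
        shiftProd_add _ _ (m + 1)]
      exact dvd_mul_right _ _
    · obtain ⟨i, hi, hx⟩ := isRoot_shiftProd.1 hx
      have hx' : (minpolyZero 𝒢 h).IsRoot (x - i) := by simpa using hx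
      have := hA.spec_add_mem h (x := x - i) (i := i) (m := j) hx' (by omega)
      simpa using this
  obtain ⟨s, hs⟩ := (he j).exists_sub_mem m
  obtain ⟨c, hc⟩ := hdvd
  have h₁ : aeval (h : A) (s * headPoly h j) ∈ clI 𝒢 m 0 := by
    rw [hc, mul_left_comm, map_mul]
    refine mul_zero_mem_clI (aeval_mem_zero h _) (clI_anti 𝒢 ?_ 0 (hh.aeval_shiftProd_mem _))
    push_cast; omega
  have := add_mem hs h₁
  rwa [sub_add_cancel] at this

/-- For homogeneous `a` of degree d, (1 - e_j) a is in I_m as soon as j ≥ (m + d)⁺ + g, and I_m e_m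
= 0. -/
lemma exists_forall_mul_eq_left (he : IsSpectralFamily h e) (hA : IsQuasiFinite 𝒢)
    (hh : IsHamiltonian 𝒢 (h : A)) (a : A) (m : ℕ) :
    ∃ j, ∀ j' ≥ j, e j' * (a * e m) = a * e m := by
  induction a using DirectSum.Decomposition.inductionOn 𝒢 with
  | zero => exact ⟨0, by simp⟩
  | @homogeneous d a =>
    refine ⟨(m + d).toNat + gap 𝒢 h, fun j hj => ?_⟩
    have h₁ := clI_mul_graded_mem 𝒢 (s := m) (he.one_sub_mem hA hh hj) a.2 (zero_add d)
      (by have := Int.self_le_toNat (m + d); omega)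
    have := he.clI_mul_eq_zero hA hh h₁
    rw [sub_mul, sub_mul, one_mul, sub_eq_zero, mul_assoc] at this
    exact this.symm
  | add a b ha hb =>
    obtain ⟨i, hi⟩ := ha
    obtain ⟨j, hj⟩ := hb
    refine ⟨max i j, fun l hl => ?_⟩
    rw [add_mul, mul_add, hi l (le_of_max_le_left hl), hj l (le_of_max_le_right hl)]

lemma exists_forall_mul_eq_right (he : IsSpectralFamily h e) (hA : IsQuasiFinite 𝒢)
    (hh : IsHamiltonian 𝒢 (h : A)) (a : A) (m : ℕ) :
    ∃ j, ∀ j' ≥ j, (e m * a) * e j' = e m * a := by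
  induction a using DirectSum.Decomposition.inductionOn 𝒢 with
  | zero => exact ⟨0, by simp⟩
  | @homogeneous d a =>
    refine ⟨(m - d).toNat + gap 𝒢 h, fun j hj => ?_⟩
    have h₁ := graded_mul_mem_clI 𝒢 a.2 (he.one_sub_mem hA hh hj) (add_zero d)
    have := he.mul_clI_eq_zero hA hh (m := m)
      (clI_anti 𝒢 (by have := Int.self_le_toNat (m - d); omega) d h₁)
    rw [← mul_assoc, mul_sub, mul_one, sub_eq_zero] at this
    exact this.symm
  | add a b ha hb =>
    obtain ⟨i, hi⟩ := ha
    obtain ⟨j, hj⟩ := hb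
    refine ⟨max i j, fun l hl => ?_⟩
    rw [mul_add, add_mul, hi l (le_of_max_le_left hl), hj l (le_of_max_le_right hl)]

/-- The difference ε of consecutive projectors is annihilated by a polynomial without roots in Γ_m.
As m ≥ g, this set contains Ω_0, so φ(h) is invertible on ε and ε ∈ I_0. Hence ε = c e_{m+1} with c
a sum of products u v, deg v < 0. Since v lowers the spectrum by at least one, v e_{m+1} = e_m v
e_{m+1}, and u v e_{m+1} is in the ideal generated by e_m. -/
lemma succ_mem_idealGen (he : IsSpectralFamily h e) (hA : IsQuasiFinite 𝒢)
    (hh : IsHamiltonian 𝒢 (h : A)) {m : ℕ} (hm : gap 𝒢 h ≤ m) : e (m + 1) ∈ idealGen (e m) := by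
  set ε := e (m + 1) - e m with hε
  have hεe : ε * e (m + 1) = ε := by
    rw [hε, sub_mul, he.mul_of_le hA hh le_rfl, he.mul_of_ge hA hh (Nat.le_succ m)]
  have hε0 : ε ∈ 𝒢 0 := sub_mem (he _).mem (he _).mem
  -- The tail estimate at index m + 1 holds modulo I_{m+1}; multiplying by e_{m+1} on the right
  -- makes it exact.
  have h₁ : aeval (h : A) (tailPoly h m (m + 1)) * ε = 0 := by
    have := he.clI_mul_eq_zero hA hh ((he m).tail_mem (m + 1))
    rwa [mul_assoc, sub_mul, one_mul, he.mul_of_ge hA hh (Nat.le_succ m)] at this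
  have h₂ : ε ∈ clI 𝒢 0 0 := by
    obtain ⟨u, v, huv⟩ : IsCoprime (minpolyZero 𝒢 h) (tailPoly h m (m + 1)) :=
      isCoprime_tailPoly (fun x hx _ _ =>
        specRange_mono h hm (hA.spec_subset h hx)) _
    have : ε = aeval (h : A) u * aeval (h : A) (minpolyZero 𝒢 h) * ε := by
      calc ε = aeval (h : A) (u * minpolyZero 𝒢 h + v * tailPoly h m (m + 1)) * ε := by
            rw [huv]; simp
        _ = _ := by
          rw [map_add, map_mul, map_mul, add_mul, mul_assoc (aeval (h : A) v), h₁, mul_zero,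
            add_zero]
    rw [this]
    exact mul_zero_mem_clI hε0 (zero_mul_mem_clI (aeval_mem_zero h u) (aeval_minpolyZero_mem h))
  -- Precision m + 1 is enough, since e_{m+1} kills the error and ε = ε e_{m+1}.
  obtain ⟨c, hc, hεc⟩ := exists_sub_mem_clI 𝒢 h₂ (m + 1)
  have h₃ := he.clI_mul_eq_zero hA hh hεc
  rw [sub_mul, sub_eq_zero, hεe] at h₃
  suffices H : c * e (m + 1) ∈ idealGen (e m) by
    have h₄ : e m ∈ idealGen (e m) := by simpa using mul_mul_mem_idealGen (x := e m) 1 1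
    have := add_mem (h₃ ▸ H) h₄
    rwa [hε, sub_add_cancel] at this
  clear hεc h₃
  rw [degProd] at hc
  induction hc using Submodule.iSup_induction' with
  | zero => rw [zero_mul]; exact zero_mem _
  | add u v _ _ hu hv => rw [add_mul]; exact add_mem hu hv
  | mem j c hc =>
    by_cases hj : j ≤ -0 - 1
    swap
    · simp only [hj, iSup_false, Submodule.mem_bot] at hc
      rw [hc, zero_mul]; exact zero_mem _
    simp only [hj, iSup_true] at hc
    induction hc using Submodule.mul_induction_on' with
    | add u _ v _ hu hv => rw [add_mul]; exact add_mem hu hv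
    | mem_mul_mem u hu v hv =>
      obtain ⟨i, rfl⟩ : ∃ i : ℕ, j = -(i + 1 : ℕ) := ⟨(-j - 1).toNat, by omega⟩
      have hve : v * e (m + 1) ∈ 𝒢 (-(i + 1 : ℕ)) := by
        simpa using SetLike.mul_mem_graded hv (he (m + 1)).mem
      -- The eigenvalues of h on the left of v e_{m+1} are in Γ_{m+1} - (i + 1), and those of them
      -- that belong to Ω_0 + ℕ are in Γ_m.
      have key : (1 - e m) * (v * e (m + 1)) = 0 := by
        refine (he m).one_sub_mul_eq_zero hA hh
          (R := (headPoly h (m + 1)).comp (X - C ((-(i + 1 : ℕ) : ℤ) : k)))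
          (isCoprime_tailPoly fun x hx l hl => ?_) hve ?_
        · rw [IsRoot, eval_comp] at hx
          have hx' : (headPoly h (m + 1)).IsRoot (x + (i + 1 : ℕ)) := by
            rw [IsRoot, ← hx]
            congr 1
            simp
            ring
          have := hA.mem_specRange_of_sub_mem (m := m) (i := i + 1) (l := l)
            (specRange_mono h (by omega) (isRoot_of_isRoot_headPoly hx')) (by simpa using hl)
          simpa using this
        · rw [← mul_assoc, ← hh.mul_aeval hv, mul_assoc, (he _).aeval_mul, mul_zero]
      rw [sub_mul, one_mul, sub_eq_zero] at key
      rw [mul_assoc, key, ← mul_assoc]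
      exact mul_mul_mem_idealGen _ _

lemma mem_idealGen (he : IsSpectralFamily h e) (hA : IsQuasiFinite 𝒢)
    (hh : IsHamiltonian 𝒢 (h : A)) {n : ℕ} (hn : gap 𝒢 h ≤ n) (m : ℕ) : e m ∈ idealGen (e n) := by
  rcases le_total m n with hmn | hmn
  · have := mul_mul_mem_idealGen (x := e n) (e m) 1
    rwa [mul_one, he.mul_of_ge hA hh hmn] at this
  · induction m, hmn using Nat.le_induction with
    | base => simpa using mul_mul_mem_idealGen (x := e n) 1 1
    | succ m hm ih => exact idealGen_le ih (he.succ_mem_idealGen hA hh (hn.trans hm))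

/-- Right multiplication by e_{m'} factors through the finite-dimensional A(d)/I_{m'}(A(d)). Only
-m' ≤ d ≤ m contribute: below this range A(d) is inside I_{m'}, above it A(d) is inside I^∨_m. -/
lemma exists_fg (he : IsSpectralFamily h e) (hA : IsQuasiFinite 𝒢)
    (hh : IsHamiltonian 𝒢 (h : A)) (m m' : ℕ) :
    ∃ W : Submodule k A, W.FG ∧ ∀ x, e m * x * e m' ∈ W := by
  have hfg : ∀ d, ((𝒢 d).map (LinearMap.mulRight k (e m'))).FG := by
    intro d
    have := hA.finite m' d
    let f : 𝒢 d →ₗ[k] A := (LinearMap.mulRight k (e m')).comp (𝒢 d).subtype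
    have hf : leftI 𝒢 m' d ≤ LinearMap.ker f := fun b hb => by
      have : (b : A) * e m' = 0 := he.clI_mul_eq_zero hA hh (d := d) ⟨b, hb, rfl⟩
      simpa [f] using this
    have hr : (𝒢 d).map (LinearMap.mulRight k (e m')) =
        LinearMap.range ((leftI 𝒢 m' d).liftQ f hf) := by
      rw [Submodule.range_liftQ, LinearMap.range_comp, Submodule.range_subtype]
    rw [hr]
    exact (Module.Finite.iff_fg).1 inferInstance
  refine ⟨⨆ d ∈ Finset.Icc (-(m' : ℤ)) m, (𝒢 d).map (LinearMap.mulRight k (e m')),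
    Submodule.fg_biSup _ _ fun d _ => hfg d, fun x => ?_⟩
  induction x using DirectSum.Decomposition.inductionOn 𝒢 with
  | zero => simp
  | add x y hx hy => rw [mul_add, add_mul]; exact add_mem hx hy
  | @homogeneous d x =>
    by_cases h₁ : d ≤ -m' - 1
    · have := he.clI_mul_eq_zero hA hh (graded_le_clI 𝒢 h₁ x.2)
      rw [mul_assoc, this, mul_zero]; exact zero_mem _
    by_cases h₂ : (m : ℤ) - d ≤ -1
    · have := he.mul_clI_eq_zero hA hh (graded_le_clI_of_neg 𝒢 h₂ x.2)
      rw [this, zero_mul]; exact zero_mem _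
    refine Submodule.mem_iSup_of_mem d (Submodule.mem_iSup_of_mem
      (Finset.mem_Icc.2 ⟨by omega, by omega⟩) ⟨e m * x, ?_, rfl⟩)
    simpa using SetLike.mul_mem_graded (he m).mem x.2

end IsSpectralFamily

end

/-! ### The algebra A_n as the corner e_n A e_n -/

section

open Polynomial

section PartialFractions

variable {k : Type u} [Field k] {A : Type u} [Ring A] [Algebra k A]

lemma mem_cornerAlgebra_iff {h : A} {Γ : Set k} {a : A} :
    a ∈ cornerAlgebra h Γ ↔ a ∈ (⨆ x ∈ Γ, ⨆ y ∈ Γ, genEig h x y : Submodule k A) := Iff.rfl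

lemma genEig_le_cornerAlgebra {h : A} {Γ : Set k} {x y : k} (hx : x ∈ Γ) (hy : y ∈ Γ) {a : A}
    (ha : a ∈ genEig h x y) : a ∈ cornerAlgebra h Γ :=
  mem_cornerAlgebra_iff.2 (Submodule.mem_iSup_of_mem x (Submodule.mem_iSup_of_mem hx
    (Submodule.mem_iSup_of_mem y (Submodule.mem_iSup_of_mem hy ha))))

/-- Bézout for the pairwise coprime powers (X - x)^{mult}: `q x` is a multiple of all of them but
the one at `x`. The degree of `P` bounds all multiplicities and serves as common exponent. -/
lemma exists_partialFractions [IsAlgClosed k] {P : k[X]} (hP : P.Monic) :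
    ∃ (T : Finset k) (q : k → k[X]) (r : ℕ), (∀ x ∈ T, P.IsRoot x) ∧
      P ∣ ∑ x ∈ T, q x - 1 ∧ ∀ x ∈ T, P ∣ (X - C x) ^ r * q x := by
  classical
  have hPeq : P = ∏ x ∈ P.roots.toFinset, (X - C x) ^ rootMultiplicity x P := by
    rw [← prod_multiset_root_eq_finset_root]
    exact (IsAlgClosed.splits P).eq_prod_roots_of_monic hP
  -- The Bézout statement needs a nonempty index set; without roots P = 1, and the empty sum will
  -- do.
  rcases P.roots.toFinset.eq_empty_or_nonempty with h0 | hne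
  · refine ⟨∅, 0, 0, by simp, ?_, by simp⟩
    rw [h0, Finset.prod_empty] at hPeq
    rw [hPeq]
    exact one_dvd _
  obtain ⟨μ, hμ⟩ := (exists_sum_eq_one_iff_pairwise_coprime hne
    (s := fun x => (X - C x) ^ rootMultiplicity x P)).2 fun x y hxy =>
      (Polynomial.isCoprime_X_sub_C_of_isUnit_sub
        (sub_ne_zero.2 fun e => hxy (Subtype.ext e)).isUnit).pow
  refine ⟨P.roots.toFinset, _, P.natDegree, fun x hx =>
    isRoot_of_mem_roots (Multiset.mem_toFinset.1 hx), by rw [hμ, sub_self]; exact dvd_zero _,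
    fun x hx => ?_⟩
  have h₁ : P ∣ (X - C x) ^ rootMultiplicity x P *
      (μ x * ∏ j ∈ P.roots.toFinset \ {x}, (X - C j) ^ rootMultiplicity j P) := by
    refine ⟨μ x, ?_⟩
    conv_rhs => rw [hPeq, ← Finset.prod_sdiff (Finset.singleton_subset_iff.2 hx)]
    rw [Finset.prod_singleton]
    ring
  refine h₁.trans (mul_dvd_mul_right (pow_dvd_pow _ ?_) _)
  rw [← count_roots]
  exact (Multiset.count_le_card _ _).trans (card_roots' P)

/-- Inserting the partition of unity on both sides, a is the sum of the q_x(h) a q_y(h), and each of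
these is in A[x, y]. -/
lemma mem_cornerAlgebra_of_aeval_eq_zero [IsAlgClosed k] {h : A} {Γ : Set k} {P : k[X]}
    (hP : P.Monic) (hΓ : ∀ x, P.IsRoot x → x ∈ Γ) {a : A} (h₁ : aeval h P * a = 0)
    (h₂ : a * aeval h P = 0) : a ∈ cornerAlgebra h Γ := by
  obtain ⟨T, q, r, hT, ⟨c, hsum⟩, hdvd⟩ := exists_partialFractions hP
  have e₁ : aeval h (∑ x ∈ T, q x) * a = a := by
    rw [sub_eq_iff_eq_add.1 hsum, mul_comm, map_add, map_mul, add_mul, mul_assoc, h₁]; simp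
  have e₂ : a * aeval h (∑ x ∈ T, q x) = a := by
    rw [sub_eq_iff_eq_add.1 hsum, map_add, map_mul, mul_add, ← mul_assoc, h₂]; simp
  rw [← e₁, ← e₂, map_sum, Finset.mul_sum, Finset.mul_sum]
  refine sum_mem fun y hy => ?_
  rw [Finset.sum_mul]
  refine sum_mem fun x hx => genEig_le_cornerAlgebra (hΓ x (hT x hx)) (hΓ y (hT y hy)) ⟨r, ?_, ?_⟩
  · obtain ⟨c, hc⟩ := hdvd x hx
    have := congrArg (aeval h) hc
    rw [map_mul, map_pow, map_sub, aeval_X, aeval_C, mul_comm P, map_mul] at this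
    rw [← mul_assoc, this, mul_assoc, ← mul_assoc _ a, h₁]
    simp
  · obtain ⟨c, hc⟩ := hdvd y hy
    rw [mul_comm] at hc
    have := congrArg (aeval h) hc
    rw [map_mul, map_pow, map_sub, aeval_X, aeval_C, map_mul] at this
    rw [mul_assoc, mul_assoc, this, ← mul_assoc a, h₂]
    simp

end PartialFractions

variable {k : Type u} [Field k] {A : Type u} [Ring A] [Algebra k A]
  {𝒢 : ℤ → Submodule k A} [GradedAlgebra 𝒢]

lemma forall_decompose_of_mem_zero {b a : A} (hb : b ∈ 𝒢 0) :
    (b * a = 0 → ∀ d, b * (DirectSum.decompose 𝒢 a d : A) = 0) ∧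
      (a * b = 0 → ∀ d, (DirectSum.decompose 𝒢 a d : A) * b = 0) := by
  refine ⟨fun h d => ?_, fun h d => ?_⟩
  · rw [← DirectSum.coe_decompose_mul_of_left_mem_zero 𝒢 hb, h]; simp
  · rw [← DirectSum.coe_decompose_mul_of_right_mem_zero 𝒢 hb, h]; simp

lemma mul_eq_zero_of_decompose {b a : A} :
    ((∀ d, b * (DirectSum.decompose 𝒢 a d : A) = 0) → b * a = 0) ∧
      ((∀ d, (DirectSum.decompose 𝒢 a d : A) * b = 0) → a * b = 0) := by
  classical
  refine ⟨fun h => ?_, fun h => ?_⟩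
  · rw [← DirectSum.sum_support_decompose 𝒢 a, Finset.mul_sum, Finset.sum_eq_zero fun d _ => h d]
  · rw [← DirectSum.sum_support_decompose 𝒢 a, Finset.sum_mul, Finset.sum_eq_zero fun d _ => h d]

variable [IsAlgClosed k] [CharZero k] [∀ d, TopologicalSpace (𝒢 d)]
  [∀ d, IsTopologicalAddGroup (𝒢 d)] [∀ d, ContinuousConstSMul k (𝒢 d)] [IsCompatible 𝒢]
  {h : 𝒢 0} {e : ℕ → A}

/-- For x ∈ Γ_n the powers of X - x are coprime to all tails, so e_n fixes A[x, y] from both sides.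
Conversely, the head polynomial, with all its roots in Γ_n, annihilates e_n a e_n from both sides.
-/
lemma IsSpectralFamily.mem_finAlgebra_iff (he : IsSpectralFamily h e) (hA : IsQuasiFinite 𝒢)
    (hh : IsHamiltonian 𝒢 (h : A)) {n : ℕ} {a : A} :
    a ∈ finAlgebra 𝒢 h n ↔ e n * a * e n = a := by
  constructor
  · suffices H : (⨆ x ∈ specRange 𝒢 h n, ⨆ y ∈ specRange 𝒢 h n, genEig (h : A) x y :
        Submodule k A) ≤ LinearMap.eqLocus
          ((LinearMap.mulRight k (e n)).comp (LinearMap.mulLeft k (e n))) LinearMap.id by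
      intro ha
      exact H ha
    refine iSup₂_le fun x hx => iSup₂_le fun y hy => ?_
    rintro a ⟨r, h₁, h₂⟩
    have hcop : ∀ x ∈ specRange 𝒢 h n, ∀ M, IsCoprime ((X - C x) ^ r) (tailPoly h n M) :=
      fun x hx => isCoprime_tailPoly fun y hy _ _ => by
        have hyx : y = x := by
          rw [IsRoot, eval_pow, eval_sub, eval_X, eval_C] at hy
          exact sub_eq_zero.1 (eq_zero_of_pow_eq_zero hy)
        rwa [hyx]
    have e₁ : ∀ x, (h - algebraMap k A x : A) ^ r = aeval (h : A) ((X - C x) ^ r) := by simp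
    rw [e₁] at h₁ h₂
    -- The annihilation criterion concerns homogeneous elements; as h has degree zero, the relation
    -- for `a` passes to its components.
    have k₁ : (1 - e n) * a = 0 := mul_eq_zero_of_decompose.1 fun d =>
      (he n).one_sub_mul_eq_zero hA hh (hcop x hx) (SetLike.coe_mem _)
        ((forall_decompose_of_mem_zero (aeval_mem_zero h _)).1 h₁ d)
    have k₂ : a * (1 - e n) = 0 := mul_eq_zero_of_decompose.2 fun d =>
      (he n).mul_one_sub_eq_zero hA (hcop y hy) (SetLike.coe_mem _)
        ((forall_decompose_of_mem_zero (aeval_mem_zero h _)).2 h₂ d)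
    rw [sub_mul, one_mul, sub_eq_zero] at k₁
    rw [mul_sub, mul_one, sub_eq_zero] at k₂
    change e n * a * e n = a
    rw [← k₁, ← k₂]
  · intro ha
    have hmon : (headPoly h n).Monic := monic_multiset_prod_of_monic _ _ fun x _ => monic_X_sub_C x
    refine mem_cornerAlgebra_of_aeval_eq_zero hmon (fun x => isRoot_of_isRoot_headPoly) ?_ ?_
    · rw [← ha, ← mul_assoc, ← mul_assoc, (he n).aeval_mul]; simp
    · rw [← ha, mul_assoc, (he n).mul_aeval hh]; simp

end

/-! ### Corners of rings, corners of modules, and coinduction -/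

section

section Corner

variable {R S : Type u} [Ring R] [Ring S]

/-- The embedding `φ` identifies `S` with the corner `φ 1 * R * φ 1` of `R`. -/
structure IsCorner (φ : S →ₙ+* R) : Prop where
  injective : Function.Injective φ
  exists_eq : ∀ x, ∃ s, φ s = φ 1 * x * φ 1

lemma map_one_mul (φ : S →ₙ+* R) (s : S) : φ 1 * φ s = φ s := by rw [← map_mul, one_mul]

lemma mul_map_one (φ : S →ₙ+* R) (s : S) : φ s * φ 1 = φ s := by rw [← map_mul, mul_one]

/-- The part of an `R`-module on which `φ 1` acts as the identity. -/
def corner (φ : S →ₙ+* R) (M : Type u) [AddCommGroup M] [Module R M] : AddSubgroup M where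
  carrier := {v | φ 1 • v = v}
  zero_mem' := smul_zero _
  add_mem' := fun {v w} hv hw => by
    change φ 1 • (v + w) = v + w
    rw [smul_add, hv, hw]
  neg_mem' := fun {v} hv => by
    change φ 1 • -v = -v
    rw [smul_neg, hv]

variable (φ : S →ₙ+* R) {M M' : Type u} [AddCommGroup M] [Module R M] [AddCommGroup M']
  [Module R M']

lemma mem_corner {v : M} : v ∈ corner φ M ↔ φ 1 • v = v := Iff.rfl

lemma smul_mem_corner (s : S) (v : M) : φ s • v ∈ corner φ M := by
  rw [mem_corner, ← mul_smul, map_one_mul]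

instance : Module S (corner φ M) where
  smul s v := ⟨φ s • (v : M), smul_mem_corner φ s (v : M)⟩
  one_smul v := Subtype.ext v.2
  mul_smul s t v := Subtype.ext (by
    change φ (s * t) • (v : M) = φ s • φ t • (v : M)
    rw [map_mul, mul_smul])
  smul_zero s := Subtype.ext (smul_zero _)
  smul_add s v w := Subtype.ext (smul_add _ _ _)
  add_smul s t v := Subtype.ext (by
    change φ (s + t) • (v : M) = φ s • (v : M) + φ t • (v : M)
    rw [map_add, add_smul])
  zero_smul v := Subtype.ext (by
    change φ 0 • (v : M) = 0
    rw [map_zero, zero_smul])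

lemma coe_corner_smul (s : S) (v : corner φ M) : ((s • v : corner φ M) : M) = φ s • (v : M) := rfl

/-- The map of corners induced by a map of `R`-modules. -/
def cornerMap (f : M →ₗ[R] M') : corner φ M →ₗ[S] corner φ M' where
  toFun v := ⟨f v, by rw [mem_corner, ← map_smul, v.2]⟩
  map_add' v w := Subtype.ext (map_add f _ _)
  map_smul' s v := Subtype.ext (map_smul f _ _)

lemma coe_cornerMap (f : M →ₗ[R] M') (v : corner φ M) : (cornerMap φ f v : M') = f v := rfl

/-- The action of `φ 1`, as a map to the corner. -/
def cornerProj : M →+ corner φ M where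
  toFun v := ⟨φ 1 • v, smul_mem_corner φ 1 v⟩
  map_zero' := Subtype.ext (smul_zero _)
  map_add' _ _ := Subtype.ext (smul_add _ _ _)

lemma coe_cornerProj (v : M) : (cornerProj φ v : M) = φ 1 • v := rfl

variable {φ}

lemma IsCorner.cornerProj_smul (hφ : IsCorner φ) (g : corner φ M →ₗ[S] corner φ M') (b : R)
    (v : corner φ M) : cornerProj φ (b • (g v : M')) = g (cornerProj φ (b • (v : M))) := by
  obtain ⟨s, hs⟩ := hφ.exists_eq b
  have h₁ : ∀ {M : Type u} [AddCommGroup M] [Module R M] (v : corner φ M),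
      cornerProj φ (b • (v : M)) = s • v := fun v => Subtype.ext (by
    rw [coe_cornerProj, coe_corner_smul, hs, mul_smul, mul_smul, v.2])
  rw [h₁, h₁, map_smul]

/-- A map of corners extends to the submodule generated by the corner. -/
lemma IsCorner.exists_of_mem_span (hφ : IsCorner φ) (g : corner φ M →ₗ[S] corner φ M') {v : M}
    (hv : v ∈ Submodule.span R (corner φ M : Set M)) :
    ∃ w : M', ∀ b : R, cornerProj φ (b • w) = g (cornerProj φ (b • v)) := by
  induction hv using Submodule.span_induction with
  | mem v hv => exact ⟨g ⟨v, hv⟩, fun b => hφ.cornerProj_smul g b ⟨v, hv⟩⟩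
  | zero => exact ⟨0, fun b => by simp⟩
  | add v v' _ _ h h' =>
    obtain ⟨w, hw⟩ := h
    obtain ⟨w', hw'⟩ := h'
    exact ⟨w + w', fun b => by simp only [smul_add, map_add, hw, hw']⟩
  | smul a v _ h =>
    obtain ⟨w, hw⟩ := h
    exact ⟨a • w, fun b => by rw [← mul_smul, hw, mul_smul]⟩

/-- By `hM'` an element of `M'` is determined by the corner projections of its multiples, so values
chosen pointwise automatically form a linear map. -/
lemma IsCorner.exists_extend (hφ : IsCorner φ)
    (hM' : ∀ w : M', (∀ b : R, cornerProj φ (b • w) = 0) → w = 0)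
    (g : corner φ M →ₗ[S] corner φ M')
    (hg : ∀ v : M, ∃ w : M', ∀ b : R, cornerProj φ (b • w) = g (cornerProj φ (b • v))) :
    ∃ f : M →ₗ[R] M', cornerMap φ f = g := by
  have huniq : ∀ w w' : M', (∀ b : R, cornerProj φ (b • w) = cornerProj φ (b • w')) → w = w' :=
    fun w w' h => sub_eq_zero.1 (hM' _ fun b => by rw [smul_sub, map_sub, h, sub_self])
  choose f hf using hg
  refine ⟨⟨⟨f, fun v w => huniq _ _ fun b => ?_⟩, fun a v => huniq _ _ fun b => ?_⟩,
    LinearMap.ext fun v => Subtype.ext (huniq _ _ fun b => ?_)⟩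
  · simp only [smul_add, map_add, hf]
  · simp only [RingHom.id_apply]
    rw [hf, ← mul_smul, ← mul_smul, hf]
  · change cornerProj φ (b • f v) = _
    rw [hf, hφ.cornerProj_smul]

lemma eq_of_cornerMap_eq (hM' : ∀ w : M', (∀ b : R, cornerProj φ (b • w) = 0) → w = 0)
    {f f' : M →ₗ[R] M'} (h : cornerMap φ f = cornerMap φ f') : f = f' := by
  refine LinearMap.ext fun v => sub_eq_zero.1 (hM' _ fun b => ?_)
  have := congrArg (Subtype.val ∘ fun g => g (cornerProj φ (b • v))) h
  refine Subtype.ext ?_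
  simp only [Function.comp, coe_cornerMap, coe_cornerProj, map_smul] at this
  rw [coe_cornerProj, smul_sub, smul_sub, this, sub_self]
  rfl

/-- With e = φ 1, the vector a e b v is the multiple by `a` of the corner element e b v. -/
lemma smul_mem_span_corner {y : R} (hy : y ∈ idealGen (φ 1)) (v : M) :
    y • v ∈ Submodule.span R (corner φ M : Set M) := by
  induction hy using AddSubgroup.closure_induction with
  | mem y hy =>
    obtain ⟨a, b, rfl⟩ := hy
    rw [mul_assoc, mul_smul, mul_smul]
    exact Submodule.smul_mem _ _ (Submodule.subset_span (smul_mem_corner φ 1 _))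
  | zero => simp
  | add y z _ _ hy hz => rw [add_smul]; exact add_mem hy hz
  | neg y _ hy => rw [neg_smul]; exact neg_mem hy

lemma smul_eq_zero_of_mem_idealGen {w : M} (hw : ∀ b : R, cornerProj φ (b • w) = 0) {y : R}
    (hy : y ∈ idealGen (φ 1)) : y • w = 0 := by
  induction hy using AddSubgroup.closure_induction with
  | mem y hy =>
    obtain ⟨a, b, rfl⟩ := hy
    have := congrArg Subtype.val (hw b)
    rw [coe_cornerProj] at this
    rw [mul_assoc, mul_smul, mul_smul, this]
    exact smul_zero _
  | zero => simp
  | add y z _ _ hy hz => rw [add_smul, hy, hz, add_zero]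
  | neg y _ hy => rw [neg_smul, hy, neg_zero]

/-- The functor from `R`-modules to `S`-modules that takes a module to its corner. -/
def cornerFunctor (φ : S →ₙ+* R) : ModuleCat.{u} R ⥤ ModuleCat.{u} S where
  obj M := ModuleCat.of S (corner φ M)
  map f := ModuleCat.ofHom (cornerMap φ f.hom)

end Corner

section Coinduced

variable {R S : Type u} [Ring R] [Ring S] (φ : S →ₙ+* R) (N : Type u) [AddCommGroup N] [Module S N]

/-- The additive maps `f : R → N` such that `f (φ s * x) = s • f x`. -/
def coinduced : AddSubgroup (R →+ N) where
  carrier := {f | ∀ s x, f (φ s * x) = s • f x}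
  zero_mem' := fun s x => by simp
  add_mem' := fun {f g} hf hg s x => by
    rw [AddMonoidHom.add_apply, hf, hg, AddMonoidHom.add_apply, smul_add]
  neg_mem' := fun {f} hf s x => by
    rw [AddMonoidHom.neg_apply, hf, AddMonoidHom.neg_apply, smul_neg]

variable {φ N}

instance : CoeFun (coinduced φ N) fun _ => R → N := ⟨fun f => f.1⟩

lemma coinduced_ext {f g : coinduced φ N} (h : ∀ x, f x = g x) : f = g :=
  Subtype.ext (AddMonoidHom.ext h)

instance : Module R (coinduced φ N) where
  smul a f := ⟨(f : R →+ N).comp (AddMonoidHom.mulRight a), fun s x => by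
    change f (φ s * x * a) = s • f (x * a)
    rw [mul_assoc]; exact f.2 s _⟩
  one_smul f := coinduced_ext fun x => congrArg f (mul_one x)
  mul_smul a b f := coinduced_ext fun x => congrArg f (mul_assoc x a b).symm
  smul_zero a := rfl
  smul_add a f g := rfl
  add_smul a b f := coinduced_ext fun x => by
    change f (x * (a + b)) = f (x * a) + f (x * b)
    rw [mul_add, map_add]
  zero_smul f := coinduced_ext fun x => by
    change f (x * 0) = 0
    rw [mul_zero, map_zero]

lemma coinduced_smul_apply (a : R) (f : coinduced φ N) (x : R) : (a • f) x = f (x * a) := rfl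

lemma coinduced_apply_map_mul (f : coinduced φ N) (s : S) (x : R) : f (φ s * x) = s • f x := f.2 s x

lemma coinduced_apply_map_one_mul (f : coinduced φ N) (x : R) : f (φ 1 * x) = f x := by
  rw [coinduced_apply_map_mul, one_smul]

/-- Evaluation at `1`. -/
def coinducedEval {D : Submodule R (coinduced φ N)} : corner φ D →ₗ[S] N where
  toFun f := (f : D).1 1
  map_add' _ _ := rfl
  map_smul' s f := by
    change (f : D).1 (1 * φ s) = s • (f : D).1 1
    rw [one_mul, ← mul_one (φ s), coinduced_apply_map_mul]

/-- Put e = φ 1. If e f = f, then f(x) = f(e x e), and e x e comes from `S`, so f(1) determines f.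
Conversely, y is the value at 1 of the function x ↦ σ(x) y, where σ(x) ∈ S corresponds to e x e. -/
lemma IsCorner.coinducedEval_bijective (hφ : IsCorner φ) {D : Submodule R (coinduced φ N)}
    (hD : ∀ f ∈ corner φ (coinduced φ N), f ∈ D) :
    Function.Bijective (coinducedEval : corner φ D →ₗ[S] N) := by
  constructor
  · rw [injective_iff_map_eq_zero]
    intro f hf
    have hf' : (f : D).1 1 = 0 := hf
    have hφ1 : φ 1 • (f : D).1 = (f : D).1 := congrArg Subtype.val f.2
    refine Subtype.ext (Subtype.ext (coinduced_ext fun x => ?_))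
    obtain ⟨s, hs⟩ := hφ.exists_eq x
    change (f : D).1 x = 0
    rw [← hφ1, coinduced_smul_apply, ← coinduced_apply_map_one_mul, ← mul_assoc, ← hs,
      ← mul_one (φ s), coinduced_apply_map_mul, hf', smul_zero]
  · intro y
    choose σ hσ using hφ.exists_eq
    let f : coinduced φ N := ⟨⟨⟨fun x => σ x • y, by
        have : σ 0 = 0 := hφ.injective (by simp [hσ])
        rw [this, zero_smul]⟩, fun x x' => by
        have : σ (x + x') = σ x + σ x' := hφ.injective (by simp [hσ, mul_add, add_mul])
        change σ (x + x') • y = σ x • y + σ x' • y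
        rw [this, add_smul]⟩, fun s x => by
        have : σ (φ s * x) = s * σ x := hφ.injective (by
          rw [hσ, map_mul, hσ, ← mul_assoc, ← mul_assoc, ← mul_assoc, map_one_mul, mul_map_one])
        change σ (φ s * x) • y = s • σ x • y
        rw [this, mul_smul]⟩
    have hf : φ 1 • f = f := coinduced_ext fun x => by
      have : σ (x * φ 1) = σ x := hφ.injective (by
        rw [hσ, hσ, ← mul_assoc, mul_assoc _ (φ 1), map_one_mul])
      change σ (x * φ 1) • y = σ x • y
      rw [this]
    refine ⟨⟨⟨f, hD f hf⟩, Subtype.ext hf⟩, ?_⟩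
    have : σ 1 = 1 := hφ.injective (by rw [hσ, mul_one, map_one_mul])
    change σ 1 • y = y
    rw [this, one_smul]

end Coinduced

section Finiteness

variable {k : Type u} [Field k] {R S : Type u} [Ring R] [Algebra k R] [Ring S]

/-- A sequence `E` of idempotents of `R` such that `φ` identifies `S` with the corner of `R` defined
by `E n`, this corner determining the others up to Morita equivalence. -/
structure IsCornerSystem (k : Type u) [Field k] [Algebra k R] (φ : S →ₙ+* R) (E : ℕ → R) (n : ℕ) :
    Prop extends IsCorner φ where
  map_one : φ 1 = E n
  mul_of_le : ∀ {m j}, m ≤ j → E j * E m = E m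
  mul_of_ge : ∀ {m j}, m ≤ j → E m * E j = E m
  exists_fg : ∀ m m', ∃ W : Submodule k R, W.FG ∧ ∀ x, E m * x * E m' ∈ W
  mem_idealGen : ∀ m, E m ∈ idealGen (E n)

variable {φ : S →ₙ+* R} {E : ℕ → R} {n : ℕ} {M : Type u} [AddCommGroup M] [Module k M] [Module R M]
  [IsScalarTower k R M]

lemma smul_algebra_comm (c : k) (a : R) (v : M) : a • c • v = c • a • v := by
  rw [← algebraMap_smul R c v, ← algebraMap_smul R c (a • v), ← mul_smul, ← mul_smul,
    Algebra.commutes]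

variable (k) in
/-- The corner of an `R`-module, as a subspace. -/
def cornerSubspace (φ : S →ₙ+* R) (M : Type u) [AddCommGroup M] [Module k M] [Module R M]
    [IsScalarTower k R M] : Submodule k M where
  __ := corner φ M
  smul_mem' c v hv := by
    change φ 1 • c • v = c • v
    rw [smul_algebra_comm, hv]

lemma IsCorner.finite_corner (hφ : IsCorner φ) (hfin : Module.Finite k (cornerSubspace k φ M)) :
    Module.Finite S (corner φ M) := by
  obtain ⟨t, ht, hspan⟩ := Submodule.fg_def.1 (Module.Finite.iff_fg.1 hfin)
  have hinj : Set.InjOn (Subtype.val : corner φ M → M) (Subtype.val ⁻¹' t) :=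
    Subtype.val_injective.injOn
  refine ⟨Submodule.fg_def.2 ⟨Subtype.val ⁻¹' t, ht.preimage hinj, ?_⟩⟩
  rw [eq_top_iff]
  rintro ⟨v, hv⟩ -
  have hv' : v ∈ Submodule.span k t := hspan ▸ hv
  have hle : ∀ w ∈ Submodule.span k t, w ∈ corner φ M := fun w hw => by
    rw [hspan] at hw; exact hw
  suffices H : ∀ w (hw : w ∈ Submodule.span k t), (⟨w, hle w hw⟩ : corner φ M) ∈
      Submodule.span S (Subtype.val ⁻¹' t : Set (corner φ M)) from H v hv'
  intro w hw
  induction hw using Submodule.span_induction with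
  | mem w hw => exact Submodule.subset_span hw
  | zero => exact zero_mem _
  | add v w hv hw hv' hw' => exact add_mem hv' hw'
  | smul c w hw hw' =>
    -- `S` has no `k`-structure here; the scalar c acts on the corner through the element of `S`
    -- that corresponds to e c e.
    obtain ⟨s, hs⟩ := hφ.exists_eq (algebraMap k R c)
    have h₁ : (⟨c • w, hle _ (Submodule.smul_mem _ c hw)⟩ : corner φ M) =
        s • (⟨w, hle w hw⟩ : corner φ M) := Subtype.ext (by
      have hw1 : φ 1 • w = w := hle w hw
      rw [coe_corner_smul, hs, mul_smul, mul_smul, hw1, algebraMap_smul, smul_algebra_comm, hw1])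
    rw [h₁]
    exact Submodule.smul_mem _ _ hw'

/-- Since E_m ∈ R E_n R, the space E_m M is contained in the span of E_m R · E_n M. If the finite
set t generates the corner over `S`, this is in the sum of the E_m R E_n c with c ∈ t, all
finite-dimensional. -/
lemma IsCornerSystem.exists_fg_smul_mem (hE : IsCornerSystem k φ E n)
    (hfin : Module.Finite S (corner φ M)) (m : ℕ) :
    ∃ W : Submodule k M, W.FG ∧ ∀ v, E m • v ∈ W := by
  obtain ⟨W₀, hW₀, hmem⟩ := hE.exists_fg m n
  obtain ⟨t, ht, hspan⟩ := Submodule.fg_def.1 hfin.1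
  refine ⟨⨆ c ∈ ht.toFinset, W₀.map ((LinearMap.toSpanSingleton R M (c : M)).restrictScalars k),
    Submodule.fg_biSup _ _ fun c _ => hW₀.map _, ?_⟩
  set W := ⨆ c ∈ ht.toFinset, W₀.map ((LinearMap.toSpanSingleton R M (c : M)).restrictScalars k)
    with hW
  have h₁ : ∀ u : corner φ M, ∀ x : R, (E m * x) • (u : M) ∈ W := by
    intro u
    have hu : u ∈ Submodule.span S t := hspan ▸ trivial
    induction hu using Submodule.span_induction with
    | mem c hc =>
      intro x
      refine Submodule.mem_iSup_of_mem c (Submodule.mem_iSup_of_mem (ht.mem_toFinset.2 hc)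
        ⟨_, hmem x, ?_⟩)
      have hc1 : E n • (c : M) = c := hE.map_one ▸ c.2
      change (E m * x * E n) • (c : M) = _
      rw [mul_smul _ (E n), hc1]
    | zero => intro x; simp
    | add u v _ _ hu hv =>
      intro x
      rw [AddSubgroup.coe_add, smul_add]
      exact add_mem (hu x) (hv x)
    | smul s u _ hu =>
      intro x
      rw [coe_corner_smul, ← mul_smul, mul_assoc]
      exact hu _
  intro v
  rw [← hE.mul_of_le (le_refl m)]
  suffices H : ∀ y ∈ idealGen (E n), (E m * y) • v ∈ W from H _ (hE.mem_idealGen m)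
  intro y hy
  induction hy using AddSubgroup.closure_induction with
  | mem y hy =>
    obtain ⟨a, b, rfl⟩ := hy
    rw [← hE.map_one, ← mul_assoc, mul_smul _ b, ← mul_assoc, mul_smul _ (φ 1)]
    exact h₁ ⟨_, smul_mem_corner φ 1 _⟩ a
  | zero => simp
  | add y z _ _ hy hz => rw [mul_add, add_smul]; exact add_mem hy hz
  | neg y _ hy => rw [mul_neg, neg_smul]; exact neg_mem hy

end Finiteness

end

/-! ### The Morita equivalences for exhaustive and for coexhaustive modules -/

section

variable {k : Type u} [Field k] {R S : Type u} [Ring R] [Algebra k R] [Ring S]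
  {φ : S →ₙ+* R} {E : ℕ → R} {n : ℕ}

section Exhaustive

/-- The idempotents `E m` approximate `1` from the left, with respect to the subspaces `I m`. -/
structure IsExhaustiveSystem (I : ℕ → Submodule k R) (E : ℕ → R) : Prop where
  exists_mul_eq : ∀ a m, ∃ j, E j * (a * E m) = a * E m
  exists_one_sub_mem : ∀ m, ∃ j, 1 - E j ∈ I m
  mul_eq_zero : ∀ {m a}, a ∈ I m → a * E m = 0

variable {I : ℕ → Submodule k R}

section

variable {M : Type u} [AddCommGroup M] [Module k M] [Module R M] [IsScalarTower k R M]

lemma IsExhaustiveSystem.exists_smul_eq (hI : IsExhaustiveSystem I E) {v : M} {m : ℕ}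
    (hv : v ∈ annihilated (I m) M) : ∃ j, E j • v = v := by
  obtain ⟨j, hj⟩ := hI.exists_one_sub_mem m
  have := hv _ hj
  rw [sub_smul, one_smul, sub_eq_zero] at this
  exact ⟨j, this.symm⟩

lemma IsExhaustiveSystem.mem_annihilated (hI : IsExhaustiveSystem I E) {v : M} {m : ℕ}
    (hv : E m • v = v) : v ∈ annihilated (I m) M := fun a ha => by
  rw [← hv, ← mul_smul, hI.mul_eq_zero ha, zero_smul]

end

/-- Being fixed by some E_j is stable under sums, the E_j being increasing, and under `R`, because a
E_i = E_j a E_i for some j. -/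
lemma IsCornerSystem.exists_smul_eq_of_mem_span (hE : IsCornerSystem k φ E n)
    (hI : IsExhaustiveSystem I E) {M : Type u} [AddCommGroup M] [Module R M] {v : M}
    (hv : v ∈ Submodule.span R (corner φ M : Set M)) : ∃ j, E j • v = v := by
  induction hv using Submodule.span_induction with
  | mem v hv => exact ⟨n, hE.map_one ▸ hv⟩
  | zero => exact ⟨0, smul_zero _⟩
  | add v w _ _ hv hw =>
    obtain ⟨i, hi⟩ := hv
    obtain ⟨j, hj⟩ := hw
    refine ⟨max i j, ?_⟩
    rw [← hi, ← hj, smul_add, ← mul_smul, ← mul_smul, hE.mul_of_le (le_max_left i j),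
      hE.mul_of_le (le_max_right i j)]
  | smul a v _ hv =>
    obtain ⟨i, hi⟩ := hv
    obtain ⟨j, hj⟩ := hI.exists_mul_eq a i
    refine ⟨j, ?_⟩
    rw [← hi, ← mul_smul a, ← mul_smul, hj]

lemma IsCornerSystem.eq_zero_of_exhaustive (hE : IsCornerSystem k φ E n)
    {M : Type u} [AddCommGroup M] [Module R M] {w : M} (hw : ∃ j, E j • w = w)
    (h : ∀ b : R, cornerProj φ (b • w) = 0) : w = 0 := by
  obtain ⟨j, hj⟩ := hw
  rw [← hj]
  exact smul_eq_zero_of_mem_idealGen h (hE.map_one ▸ hE.mem_idealGen j)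

lemma quasiFiniteExhaustive.exists_smul_eq {M : ModuleCat.{u} R} (hM : quasiFiniteExhaustive I M)
    (hI : IsExhaustiveSystem I E) (v : M) : ∃ j, E j • v = v := by
  let _ := scalarModule k R M
  have := scalarModule_isScalarTower k R M
  obtain ⟨m, hm⟩ := hM.1 v
  exact hI.exists_smul_eq hm

lemma quasiFiniteExhaustive.finite_corner {M : ModuleCat.{u} R} (hM : quasiFiniteExhaustive I M)
    (hE : IsCornerSystem k φ E n) (hI : IsExhaustiveSystem I E) : 
    Module.Finite S (corner φ M) := by
  let _ := scalarModule k R M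
  have := scalarModule_isScalarTower k R M
  have := hM.2 n
  have hle : cornerSubspace k φ M ≤ annihilated (I n) M := fun v hv =>
    hI.mem_annihilated (hE.map_one ▸ hv)
  exact hE.finite_corner (Module.Finite.of_injective (Submodule.inclusion hle)
    (Submodule.inclusion_injective hle))

/-- Each vector of an exhaustive module is fixed by some E_j, and E_j ∈ R E_n R. Hence the corner
generates the module, which gives fullness, and no nonzero vector is killed by E_n R, which gives
faithfulness. -/
theorem IsCornerSystem.exhaustive_equivalence (hE : IsCornerSystem k φ E n)
    (hI : IsExhaustiveSystem I E) :
    Nonempty ((quasiFiniteExhaustive I).FullSubcategory ≌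
      (finitelyGenerated S).FullSubcategory) := by
  let Φ : (quasiFiniteExhaustive I).FullSubcategory ⥤ (finitelyGenerated S).FullSubcategory :=
    (finitelyGenerated S).lift ((quasiFiniteExhaustive I).ι ⋙ cornerFunctor φ)
      fun M => M.property.finite_corner hE hI
  have hz : ∀ (M : (quasiFiniteExhaustive I).FullSubcategory) (w : M.obj),
      (∀ b : R, cornerProj φ (b • w) = 0) → w = 0 := fun M w =>
    hE.eq_zero_of_exhaustive (M.property.exists_smul_eq hI w)
  have : Φ.Faithful := ⟨fun {M M'} f f' h => by
    have h' : cornerMap φ f.hom.hom = cornerMap φ f'.hom.hom :=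
      congrArg (fun g => g.hom.hom) h
    exact ObjectProperty.hom_ext _ (ModuleCat.hom_ext (eq_of_cornerMap_eq (hz M') h'))⟩
  have : Φ.Full := ⟨fun {M M'} g => by
    obtain ⟨f, hf⟩ := hE.exists_extend (hz M') g.hom.hom fun v => by
      refine hE.exists_of_mem_span g.hom.hom ?_
      obtain ⟨j, hj⟩ := M.property.exists_smul_eq hI v
      rw [← hj]
      exact smul_mem_span_corner (hE.map_one ▸ hE.mem_idealGen j) v
    exact ⟨ObjectProperty.homMk (ModuleCat.ofHom f),
      ObjectProperty.hom_ext _ (ModuleCat.hom_ext hf)⟩⟩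
  have : Φ.EssSurj := ⟨fun N => by
    -- Passing to the submodule generated by the corner ensures exhaustiveness and leaves the corner
    -- unchanged.
    let D : Submodule R (coinduced φ N.obj) := Submodule.span R (corner φ (coinduced φ N.obj))
    let ev : corner φ D ≃ₗ[S] N.obj := LinearEquiv.ofBijective coinducedEval
      (hE.coinducedEval_bijective fun f hf => Submodule.subset_span hf)
    have hD : ∀ v : D, ∃ j, E j • v = v := fun v => by
      obtain ⟨j, hj⟩ := hE.exists_smul_eq_of_mem_span hI v.2
      exact ⟨j, Subtype.ext hj⟩
    have hfin : Module.Finite S (corner φ D) := by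
      have : Module.Finite S N.obj := N.property
      exact Module.Finite.equiv ev.symm
    have hM : quasiFiniteExhaustive I (ModuleCat.of R D) := by
      let _ := scalarModule k R (ModuleCat.of R D)
      have := scalarModule_isScalarTower k R (ModuleCat.of R D)
      refine ⟨fun v => ?_, fun m => ?_⟩
      · obtain ⟨j, hj⟩ := hD v
        exact ⟨j, hI.mem_annihilated hj⟩
      · obtain ⟨j, hj⟩ := hI.exists_one_sub_mem m
        obtain ⟨W, hW, hmem⟩ := hE.exists_fg_smul_mem (k := k) (M := ModuleCat.of R D) hfin j
        have : Module.Finite k W := Module.Finite.iff_fg.2 hW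
        -- Vectors annihilated by I_m are fixed by E_j, so they lie in the finite-dimensional span
        -- of E_j D.
        have hle : annihilated (I m) (ModuleCat.of R D) ≤ W := fun v hv => by
          have := hv _ hj
          rw [sub_smul, one_smul, sub_eq_zero] at this
          rw [this]
          exact hmem v
        exact Module.Finite.of_injective (Submodule.inclusion hle)
          (Submodule.inclusion_injective hle)
    exact ⟨⟨ModuleCat.of R D, hM⟩, ⟨ObjectProperty.isoMk _ ev.toModuleIso⟩⟩⟩
  have : Φ.IsEquivalence := {}
  exact ⟨Φ.asEquivalence⟩

end Exhaustive

section Coexhaustive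

variable [TopologicalSpace R]

/-- The idempotents `E m` approximate `1` from the right, with respect to the topology and the
filtration `F` of `R`. -/
structure IsCoexhaustiveSystem (F : ℤ → Submodule k R) (E : ℕ → R) : Prop where
  exists_mul_eq : ∀ a m, ∃ j, E m * a * E j = E m * a
  exists_one_sub_mem : ∀ m : ℕ, ∃ j, 1 - E j ∈
    closure (Submodule.span k {y | ∃ a ∈ F (-(m : ℤ) - 1), ∃ x : R, y = a * x} : Set R)
  mul_eq_zero : ∀ {m : ℕ} {a}, a ∈ F (-(m : ℤ) - 1) → E m * a = 0
  eventually_mul_eq_zero : ∀ m x, ∀ᶠ y in 𝓝 x, E m * (y - x) = 0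

variable {F : ℤ → Submodule k R}

/-- The elements of `M` annihilated by `a`. -/
def smulKer (a : R) (M : Type u) [AddCommGroup M] [Module R M] : AddSubgroup M where
  carrier := {v | a • v = 0}
  zero_mem' := smul_zero a
  add_mem' := fun {v w} hv hw => by
    change a • (v + w) = 0
    rw [smul_add, hv, hw, add_zero]
  neg_mem' := fun {v} hv => by
    change a • -v = 0
    rw [smul_neg, hv, neg_zero]

lemma mem_smulKer {a : R} {M : Type u} [AddCommGroup M] [Module R M] {v : M} :
    v ∈ smulKer a M ↔ a • v = 0 := Iff.rfl

lemma IsCornerSystem.smulKer_anti (hE : IsCornerSystem k φ E n) (M : Type u) [AddCommGroup M]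
    [Module R M] : Antitone fun m => smulKer (E m) M := fun i j hij v hv => by
  rw [mem_smulKer] at hv ⊢
  rw [← hE.mul_of_ge hij, mul_smul, hv, smul_zero]

section

variable {M : Type u} [AddCommGroup M] [Module k M] [Module R M] [IsScalarTower k R M]
  [TopologicalSpace M] [IsTopologicalAddGroup M] [ContinuousSMul R M] [ContinuousConstSMul k M]

lemma IsCoexhaustiveSystem.stepClosure_le (hF : IsCoexhaustiveSystem F E) {m : ℕ}
    (hcl : IsClosed (smulKer (E m) M : Set M)) {v : M} (hv : v ∈ stepClosure F m M) :
    E m • v = 0 := by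
  refine closure_minimal (t := (smulKer (E m) M : Set M)) (fun v hv => ?_) hcl hv
  change E m • v = 0
  induction hv using Submodule.span_induction with
  | mem v hv =>
    obtain ⟨a, ha, w, rfl⟩ := hv
    rw [← mul_smul, hF.mul_eq_zero ha, zero_smul]
  | zero => exact smul_zero _
  | add v w _ _ hv hw => rw [smul_add, hv, hw, add_zero]
  | smul c v _ hv => rw [smul_algebra_comm, hv, smul_zero]

/-- The orbit map a ↦ a v is continuous, so it carries the closure containing 1 - E_j into the
closure of F_{-m-1} R · M. -/
lemma IsCoexhaustiveSystem.exists_sub_mem (hF : IsCoexhaustiveSystem F E) (m : ℕ) :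
    ∃ j, ∀ v : M, v - E j • v ∈ stepClosure F m M := by
  obtain ⟨j, hj⟩ := hF.exists_one_sub_mem m
  refine ⟨j, fun v => ?_⟩
  have hc : Continuous fun a : R => a • v := continuous_id.smul continuous_const
  have := map_mem_closure hc hj (t := (Submodule.span k
    {x | ∃ a ∈ F (-(m : ℤ) - 1), ∃ v : M, x = a • v} : Set M)) fun y hy => by
      induction hy using Submodule.span_induction with
      | mem y hy =>
        obtain ⟨a, ha, x, rfl⟩ := hy
        exact Submodule.subset_span ⟨a, ha, x • v, mul_smul a x v⟩
      | zero => rw [zero_smul]; exact zero_mem _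
      | add y z _ _ hy hz => rw [add_smul]; exact add_mem hy hz
      | smul c y _ hy => rw [smul_assoc]; exact Submodule.smul_mem _ c hy
  rw [sub_smul, one_smul] at this
  exact this

lemma IsCoexhaustiveSystem.hasBasis_smulKer [T2Space M] (hF : IsCoexhaustiveSystem F E)
    (hM : (𝓝 (0 : M)).HasBasis (fun _ : ℕ => True) fun m => (stepClosure F m M : Set M)) :
    (𝓝 (0 : M)).HasBasis (fun _ : ℕ => True) fun m => (smulKer (E m) M : Set M) := by
  refine hM.to_hasBasis (fun m _ => ?_) fun m _ => ⟨m, trivial, fun v hv => ?_⟩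
  · obtain ⟨j, hj⟩ := hF.exists_sub_mem (M := M) m
    refine ⟨j, trivial, fun v hv => ?_⟩
    have := hj v
    rwa [show E j • v = 0 from hv, sub_zero] at this
  · exact hF.stepClosure_le (isClosed_singleton.preimage (continuous_const_smul (E m))) hv

end

lemma quasiFiniteCoexhaustive.hasBasis_smulKer {M : TopModuleCat.{u} R}
    (hM : quasiFiniteCoexhaustive F M) (hF : IsCoexhaustiveSystem F E) :
    (𝓝 (0 : M)).HasBasis (fun _ : ℕ => True) fun m => (smulKer (E m) M : Set M) := by
  let _ := scalarModule k R M
  have := scalarModule_isScalarTower k R M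
  have := scalarModule_continuousConstSMul k R M
  have := hM.2.1.1
  exact hF.hasBasis_smulKer hM.1

lemma quasiFiniteCoexhaustive.eq_zero {M : TopModuleCat.{u} R}
    (hM : quasiFiniteCoexhaustive F M) (hF : IsCoexhaustiveSystem F E) {w : M}
    (hw : ∀ m, E m • w = 0) : w = 0 := by
  have := hM.2.1.1
  by_contra hne
  obtain ⟨m, -, hm⟩ := (hM.hasBasis_smulKer hF).mem_iff.1
    (isOpen_compl_singleton.mem_nhds (show (0 : M) ∈ ({w}ᶜ : Set M) from Ne.symm hne))
  exact hm (hw m) rfl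

lemma quasiFiniteCoexhaustive.eq_zero_of_cornerProj {M : TopModuleCat.{u} R}
    (hM : quasiFiniteCoexhaustive F M) (hE : IsCornerSystem k φ E n)
    (hF : IsCoexhaustiveSystem F E) {w : M} (h : ∀ b : R, cornerProj φ (b • w) = 0) : w = 0 :=
  hM.eq_zero hF fun m => smul_eq_zero_of_mem_idealGen h (hE.map_one ▸ hE.mem_idealGen m)

lemma quasiFiniteCoexhaustive.finite_corner {M : TopModuleCat.{u} R}
    (hM : quasiFiniteCoexhaustive F M) (hE : IsCornerSystem k φ E n)
    (hF : IsCoexhaustiveSystem F E) : Module.Finite S (corner φ M) := by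
  let _ := scalarModule k R M
  have := scalarModule_isScalarTower k R M
  have := scalarModule_continuousConstSMul k R M
  have := hM.2.1.1
  have := hM.2.2 n
  refine hE.finite_corner (k := k) (Module.Finite.of_injective
    ((stepClosure F n M).mkQ.comp (cornerSubspace k φ M).subtype) ?_)
  rw [injective_iff_map_eq_zero]
  intro v hv
  have h₁ : (v : M) ∈ stepClosure F n M := (Submodule.Quotient.mk_eq_zero _).1 hv
  have h₂ := hF.stepClosure_le (isClosed_singleton.preimage (continuous_const_smul (E n))) h₁
  rw [← hE.map_one] at h₂
  exact Subtype.ext ((show φ 1 • (v : M) = v from v.2).symm.trans h₂)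

/-- Each E_m v is in the submodule generated by the corner, so it has an image u_m. Since E_i u_j =
u_i for i ≤ j, the sequence is Cauchy; its limit has the required property because E_n b = E_n b E_j
for some j. -/
lemma quasiFiniteCoexhaustive.exists_extend {M M' : TopModuleCat.{u} R}
    (hM' : quasiFiniteCoexhaustive F M') (hE : IsCornerSystem k φ E n)
    (hF : IsCoexhaustiveSystem F E) (g : corner φ M →ₗ[S] corner φ M') (v : M) :
    ∃ w : M', ∀ b : R, cornerProj φ (b • w) = g (cornerProj φ (b • v)) := by
  have hu := fun m => hE.exists_of_mem_span g
    (smul_mem_span_corner (hE.map_one ▸ hE.mem_idealGen m) v)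
  choose u hu using hu
  have huj : ∀ i j, i ≤ j → E i • u j = u i := fun i j hij => by
    refine sub_eq_zero.1 (hM'.eq_zero_of_cornerProj hE hF fun b => ?_)
    rw [smul_sub, map_sub, ← mul_smul, hu, hu, mul_smul, ← mul_smul (E i), hE.mul_of_ge hij,
      sub_self]
  obtain ⟨w, hw⟩ := exists_limit_of_complete (hM'.hasBasis_smulKer hF) hM'.2.1.2 (u := u)
    fun m j hj => by
      rw [mem_smulKer, smul_sub, huj _ _ hj, huj _ _ le_rfl, sub_self]
  refine ⟨w, fun b => ?_⟩
  obtain ⟨j, hj⟩ := hF.exists_mul_eq b n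
  rw [← hE.map_one] at hj
  have hb : ∀ {M : TopModuleCat.{u} R} (v : M), cornerProj φ (b • v) =
      cornerProj φ (b • E j • v) := fun v => Subtype.ext (by
    rw [coe_cornerProj, coe_cornerProj, ← mul_smul, ← mul_smul, ← mul_smul, hj])
  have hwj : E j • w = u j := by
    have := hw j
    rwa [mem_smulKer, smul_sub, huj _ _ le_rfl, sub_eq_zero] at this
  rw [hb w, hb v, hwj, hu]

/-- The filter basis of a decreasing sequence of subgroups. -/
abbrev antitoneFilterBasis {V : Type u} [AddCommGroup V] (W : ℕ → AddSubgroup V) (hW : Antitone W) :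
    AddGroupFilterBasis V :=
  addGroupFilterBasisOfComm (Set.range fun m => (W m : Set V)) ⟨_, 0, rfl⟩
    (by
      rintro _ _ ⟨i, rfl⟩ ⟨j, rfl⟩
      exact ⟨_, ⟨max i j, rfl⟩, fun v hv =>
        ⟨hW (le_max_left i j) hv, hW (le_max_right i j) hv⟩⟩)
    (by rintro _ ⟨i, rfl⟩; exact zero_mem (W i))
    (by
      rintro _ ⟨i, rfl⟩
      exact ⟨_, ⟨i, rfl⟩, Set.add_subset_iff.2 fun v hv w hw => add_mem hv hw⟩)
    (by rintro _ ⟨i, rfl⟩; exact ⟨_, ⟨i, rfl⟩, fun v hv => neg_mem (show v ∈ W i from hv)⟩)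

lemma hasBasis_antitoneFilterBasis {V : Type u} [AddCommGroup V] (W : ℕ → AddSubgroup V)
    (hW : Antitone W) : (@nhds V (antitoneFilterBasis W hW).topology 0).HasBasis
      (fun _ : ℕ => True) fun m => (W m : Set V) := by
  refine (antitoneFilterBasis W hW).nhds_zero_hasBasis.to_hasBasis ?_ ?_
  · rintro _ ⟨i, rfl⟩
    exact ⟨i, trivial, le_rfl⟩
  · exact fun i _ => ⟨_, ⟨i, rfl⟩, le_rfl⟩

/-- Choosing j with E_m a = E_m a E_j, one has E_m (b w - a v) = E_m (b - a) w + E_m a E_j (w - v),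
and both terms vanish near (a, v). -/
lemma IsCoexhaustiveSystem.continuousSMul (hF : IsCoexhaustiveSystem F E) {M : Type u}
    [AddCommGroup M] [Module R M] [TopologicalSpace M] [IsTopologicalAddGroup M]
    (hM : (𝓝 (0 : M)).HasBasis (fun _ : ℕ => True) fun m => (smulKer (E m) M : Set M)) :
    ContinuousSMul R M := by
  refine ⟨continuous_iff_continuousAt.2 fun ⟨a, v⟩ => ?_⟩
  rw [ContinuousAt, ← tendsto_sub_nhds_zero_iff, hM.tendsto_right_iff]
  intro m _
  obtain ⟨j, hj⟩ := hF.exists_mul_eq a m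
  have h₁ : ∀ᶠ w in 𝓝 v, E j • (w - v) = 0 := by
    have : Filter.Tendsto (fun w => w - v) (𝓝 v) (𝓝 0) := tendsto_sub_nhds_zero_iff.2 Filter.tendsto_id
    exact this.eventually (hM.mem_of_mem (i := j) trivial)
  rw [nhds_prod_eq]
  filter_upwards [(hF.eventually_mul_eq_zero m a).prod_mk h₁] with ⟨b, w⟩ ⟨hb, hw⟩
  change E m • (b • w - a • v) = 0
  have e : b • w - a • v = (b - a) • w + a • (w - v) := by rw [sub_smul, smul_sub]; abel
  rw [e, smul_add, ← mul_smul, hb, zero_smul, ← mul_smul, ← hj, mul_smul, hw, smul_zero, add_zero]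

/-- The value f(x) depends only on E_l f when E_n x = E_n x E_l. So the given sequence is eventually
constant at each x, and its pointwise limit is the limit. -/
lemma IsCoexhaustiveSystem.coinduced_exists_limit (hE : IsCornerSystem k φ E n)
    (hF : IsCoexhaustiveSystem F E) {N : Type u} [AddCommGroup N] [Module S N]
    (u : ℕ → coinduced φ N) (hu : ∀ m, ∀ j ≥ m, u j - u m ∈ smulKer (E m) (coinduced φ N)) :
    ∃ f, ∀ m, f - u m ∈ smulKer (E m) (coinduced φ N) := by
  choose l hl using fun x => hF.exists_mul_eq x n
  have key : ∀ (f : coinduced φ N) (x : R), f x = (E (l x) • f) (φ 1 * x) := fun f x => by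
    rw [coinduced_smul_apply, hE.map_one, hl, ← hE.map_one, coinduced_apply_map_one_mul]
  have hul : ∀ m, ∀ j ≥ m, E m • u j = E m • u m := fun m j hj => by
    have := hu m j hj
    rwa [mem_smulKer, smul_sub, sub_eq_zero] at this
  have hstab : ∀ x, ∀ j ≥ l x, u j x = u (l x) x := fun x j hj => by
    rw [key (u j), key (u (l x)), hul _ _ hj]
  let f : coinduced φ N := ⟨AddMonoidHom.mk' (fun x => u (l x) x) fun x y => by
      set j := max (l (x + y)) (max (l x) (l y))
      rw [← hstab x j (by omega), ← hstab y j (by omega), ← hstab (x + y) j (by omega), map_add],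
    fun s x => by
      change u (l (φ s * x)) (φ s * x) = s • u (l x) x
      set j := max (l (φ s * x)) (l x)
      rw [← hstab x j (by omega), ← hstab (φ s * x) j (by omega), coinduced_apply_map_mul]⟩
  refine ⟨f, fun m => coinduced_ext fun x => ?_⟩
  change u (l (x * E m)) (x * E m) - u m (x * E m) = 0
  set j := max (l (x * E m)) m
  rw [← hstab _ j (by omega), sub_eq_zero, ← coinduced_smul_apply, hul _ _ (by omega)]
  rfl

/-- The inverse uses the whole coinduced module, completeness replacing generation by the corner.
The topology of any such module is given by the kernels of the E_m, which every `R`-linear map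
respects, so extensions are automatically continuous. -/
theorem IsCornerSystem.coexhaustive_equivalence (hE : IsCornerSystem k φ E n)
    (hF : IsCoexhaustiveSystem F E) :
    Nonempty ((quasiFiniteCoexhaustive F).FullSubcategory ≌
      (finitelyGenerated S).FullSubcategory) := by
  let Φ : (quasiFiniteCoexhaustive F).FullSubcategory ⥤ (finitelyGenerated S).FullSubcategory :=
    (finitelyGenerated S).lift ((quasiFiniteCoexhaustive F).ι ⋙
      forget₂ (TopModuleCat R) (ModuleCat R) ⋙ cornerFunctor φ)
      fun M => M.property.finite_corner hE hF
  have hz : ∀ (M : (quasiFiniteCoexhaustive F).FullSubcategory) (w : M.obj),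
      (∀ b : R, cornerProj φ (b • w) = 0) → w = 0 := fun M w =>
    M.property.eq_zero_of_cornerProj hE hF
  have : Φ.Faithful := ⟨fun {M M'} f f' h => by
    have h' : cornerMap φ f.hom.hom.toLinearMap = cornerMap φ f'.hom.hom.toLinearMap :=
      congrArg (fun g => g.hom.hom) h
    have := eq_of_cornerMap_eq (hz M') h'
    exact ObjectProperty.hom_ext _ (ConcreteCategory.hom_ext _ _ fun v => LinearMap.congr_fun this v)⟩
  have : Φ.Full := ⟨fun {M M'} g => by
    let g' : corner φ M.obj →ₗ[S] corner φ M'.obj := g.hom.hom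
    obtain ⟨f, hf⟩ := hE.exists_extend (hz M') g' (M'.property.exists_extend hE hF g')
    have hcont : Continuous f := by
      refine continuous_of_continuousAt_zero f ?_
      rw [ContinuousAt, map_zero, (M.property.hasBasis_smulKer hF).tendsto_iff
        (M'.property.hasBasis_smulKer hF)]
      refine fun m _ => ⟨m, trivial, fun v hv => ?_⟩
      change E m • f v = 0
      rw [← map_smul, show E m • v = 0 from hv, map_zero]
    exact ⟨ObjectProperty.homMk (TopModuleCat.ofHom ⟨f, hcont⟩),
      ObjectProperty.hom_ext _ (ModuleCat.hom_ext hf)⟩⟩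
  have : Φ.EssSurj := ⟨fun N => by
    let C := coinduced φ N.obj
    let ev : corner φ C ≃ₗ[S] N.obj :=
      (LinearEquiv.ofBijective (cornerMap φ (⊤ : Submodule R C).subtype) (by
        refine ⟨fun f g h => ?_, fun f => ⟨⟨⟨f, trivial⟩, Subtype.ext f.2⟩, rfl⟩⟩
        have h' := congrArg Subtype.val h
        exact Subtype.ext (Subtype.ext h'))).symm.trans
      (LinearEquiv.ofBijective (coinducedEval (D := (⊤ : Submodule R C)))
        (hE.coinducedEval_bijective fun f _ => trivial))
    have hfin : Module.Finite S (corner φ C) := by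
      have : Module.Finite S N.obj := N.property
      exact Module.Finite.equiv ev.symm
    let B := antitoneFilterBasis _ (hE.smulKer_anti C)
    let _ : TopologicalSpace C := B.topology
    have : IsTopologicalAddGroup C := B.isTopologicalAddGroup
    have hbasis : (𝓝 (0 : C)).HasBasis (fun _ : ℕ => True) fun m => (smulKer (E m) C : Set C) :=
      hasBasis_antitoneFilterBasis _ (hE.smulKer_anti C)
    have : ContinuousSMul R C := hF.continuousSMul hbasis
    let M : TopModuleCat R := TopModuleCat.of R C
    have hM : quasiFiniteCoexhaustive F M := by
      let _ := scalarModule k R M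
      have := scalarModule_isScalarTower k R M
      have := scalarModule_continuousConstSMul k R M
      refine ⟨hbasis.to_hasBasis (fun m _ => ⟨m, trivial, fun v hv => ?_⟩) fun m _ => ?_,
        ⟨?_, ?_⟩, fun m => ?_⟩
      · exact hF.stepClosure_le (isClosed_of_hasBasis hbasis m) hv
      · obtain ⟨j, hj⟩ := hF.exists_sub_mem (M := M) m
        refine ⟨j, trivial, fun v hv => ?_⟩
        have := hj v
        rwa [show E j • v = 0 from hv, sub_zero] at this
      · refine IsTopologicalAddGroup.t2Space_of_zero_sep fun f hf => ?_
        by_contra! hcon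
        refine hf (coinduced_ext fun x => ?_)
        obtain ⟨l, hl⟩ := hF.exists_mul_eq x n
        have h₁ : E l • f = 0 := hcon _ (hbasis.mem_of_mem (i := l) trivial)
        rw [← coinduced_apply_map_one_mul, hE.map_one, ← hl, ← coinduced_smul_apply, h₁]
        rfl
      · exact complete_of_exists_limit hbasis (hF.coinduced_exists_limit hE)
      · obtain ⟨j, hj⟩ := hF.exists_sub_mem (M := M) m
        obtain ⟨W, hW, hmem⟩ := hE.exists_fg_smul_mem (k := k) (M := M) hfin j
        have : Module.Finite k W := Module.Finite.iff_fg.2 hW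
        -- Modulo I_m(M) every v equals E_j v, so the finite-dimensional W containing E_j M fills
        -- the quotient.
        refine Module.Finite.of_surjective ((stepClosure F m M).mkQ.comp W.subtype) fun x => ?_
        obtain ⟨v, rfl⟩ := Submodule.Quotient.mk_surjective _ x
        refine ⟨⟨E j • v, hmem v⟩, ?_⟩
        refine ((Submodule.Quotient.eq _).2 ?_).symm
        exact hj v
    exact ⟨⟨M, hM⟩, ⟨ObjectProperty.isoMk _ ev.toModuleIso⟩⟩⟩
  have : Φ.IsEquivalence := {}
  exact ⟨Φ.asEquivalence⟩

end Coexhaustive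

end

/-! ### The projectors in the filterwise completions and in their opposites -/

section

section Completion

variable {k : Type u} [Field k] {A : Type u} [Ring A] [Algebra k A]
  {F : ℤ → Submodule k A} {I : ℕ → Submodule k A} [IsFilteredLinear F I]

variable (I) in
/-- The canonical map to the filterwise completion, for an exhaustive filtration. -/
def completionMap (hF : ∀ a, ∃ p, a ∈ F p) : A →ₐ[k] FilterwiseCompletion F I :=
  (FilterwiseCompletion.mk F I).comp
    ((Pi.constAlgHom k ℕ A).codRestrict (boundedCauchy F I) fun a =>
      ⟨(hF a).imp fun _ hp _ => hp, fun _ => ⟨0, fun _ _ _ _ => by simp⟩⟩)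

lemma FilterwiseCompletion.mk_surjective (x : FilterwiseCompletion F I) :
    ∃ s, FilterwiseCompletion.mk F I s = x := Ideal.Quotient.mk_surjective x

lemma FilterwiseCompletion.mk_eq_zero_iff {s : boundedCauchy F I} :
    FilterwiseCompletion.mk F I s = 0 ↔ ∀ n, ∃ N, ∀ i ≥ N, (s : ℕ → A) i ∈ I n :=
  Ideal.Quotient.eq_zero_iff_mem

lemma FilterwiseCompletion.mk_eq_of_eventually_eq {s t : boundedCauchy F I}
    (h : ∃ N, ∀ i ≥ N, (s : ℕ → A) i = (t : ℕ → A) i) :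
    FilterwiseCompletion.mk F I s = FilterwiseCompletion.mk F I t := by
  rw [← sub_eq_zero, ← map_sub, FilterwiseCompletion.mk_eq_zero_iff]
  obtain ⟨N, hN⟩ := h
  refine fun n => ⟨N, fun i hi => ?_⟩
  change (s : ℕ → A) i - (t : ℕ → A) i ∈ I n
  rw [hN i hi, sub_self]
  exact zero_mem _

variable (hF : ∀ a, ∃ p, a ∈ F p)

lemma mem_of_completionMap_eq_zero {a : A} (h : completionMap I hF a = 0) (n : ℕ) : a ∈ I n := by
  obtain ⟨N, hN⟩ := FilterwiseCompletion.mk_eq_zero_iff.1 h n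
  exact hN N le_rfl

lemma completionMap_mem_kerSubspace {a : A} {n : ℕ} (h : a ∈ I n) :
    completionMap I hF a ∈ FilterwiseCompletion.kerSubspace F I n :=
  ⟨_, ⟨0, fun _ _ => h⟩, rfl⟩

lemma completionMap_mem_filtration {a : A} {p : ℤ} (h : a ∈ F p) :
    completionMap I hF a ∈ FilterwiseCompletion.filtration F I p :=
  ⟨_, fun _ => h, rfl⟩

/-- A representing sequence is eventually constant modulo I_m, which `e` kills; so completing adds
nothing to the left multiples of `e`. -/
lemma exists_mul_completionMap {e : A} {m : ℕ} (he : ∀ a ∈ I m, a * e = 0)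
    (x : FilterwiseCompletion F I) :
    ∃ a, x * completionMap I hF e = completionMap I hF (a * e) := by
  obtain ⟨s, rfl⟩ := FilterwiseCompletion.mk_surjective x
  obtain ⟨N, hN⟩ := s.2.2 m
  refine ⟨(s : ℕ → A) N, ?_⟩
  rw [completionMap, AlgHom.comp_apply, AlgHom.comp_apply, ← map_mul]
  refine FilterwiseCompletion.mk_eq_of_eventually_eq ⟨N, fun i hi => ?_⟩
  have := he _ (hN i hi N le_rfl)
  rwa [sub_mul, sub_eq_zero] at this

lemma exists_completionMap_mul {e : A} {m : ℕ} (he : ∀ a ∈ I m, e * a = 0)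
    (x : FilterwiseCompletion F I) :
    ∃ a, completionMap I hF e * x = completionMap I hF (e * a) := by
  obtain ⟨s, rfl⟩ := FilterwiseCompletion.mk_surjective x
  obtain ⟨N, hN⟩ := s.2.2 m
  refine ⟨(s : ℕ → A) N, ?_⟩
  rw [completionMap, AlgHom.comp_apply, AlgHom.comp_apply, ← map_mul]
  refine FilterwiseCompletion.mk_eq_of_eventually_eq ⟨N, fun i hi => ?_⟩
  have := he _ (hN i hi N le_rfl)
  rwa [mul_sub, sub_eq_zero] at this

lemma kerSubspace_mul_completionMap {e : A} {m : ℕ} (he : ∀ a ∈ I m, a * e = 0)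
    {x : FilterwiseCompletion F I} (hx : x ∈ FilterwiseCompletion.kerSubspace F I m) :
    x * completionMap I hF e = 0 := by
  obtain ⟨s, ⟨N, hN⟩, rfl⟩ := hx
  rw [completionMap, AlgHom.comp_apply, ← map_mul, ← map_zero (FilterwiseCompletion.mk F I)]
  exact FilterwiseCompletion.mk_eq_of_eventually_eq ⟨N, fun i hi => he _ (hN i hi)⟩

lemma completionMap_mul_kerSubspace {e : A} {m : ℕ} (he : ∀ a ∈ I m, e * a = 0)
    {x : FilterwiseCompletion F I} (hx : x ∈ FilterwiseCompletion.kerSubspace F I m) :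
    completionMap I hF e * x = 0 := by
  obtain ⟨s, ⟨N, hN⟩, rfl⟩ := hx
  rw [completionMap, AlgHom.comp_apply, ← map_mul, ← map_zero (FilterwiseCompletion.mk F I)]
  exact FilterwiseCompletion.mk_eq_of_eventually_eq ⟨N, fun i hi => he _ (hN i hi)⟩

lemma filtration_le_kerSubspace {p : ℤ} {m : ℕ} (h : F p ≤ I m) :
    FilterwiseCompletion.filtration F I p ≤ FilterwiseCompletion.kerSubspace F I m := by
  rintro _ ⟨s, hs, rfl⟩
  exact ⟨s, ⟨0, fun i _ => h (hs i)⟩, rfl⟩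

lemma eventually_sub_mem_kerSubspace (m : ℕ) (x : FilterwiseCompletion F I) :
    ∀ᶠ y in 𝓝 x, y - x ∈ FilterwiseCompletion.kerSubspace F I m := by
  have hopen : IsOpen {y | y - x ∈ FilterwiseCompletion.kerSubspace F I m} := fun z hz =>
    ⟨m, fun y hy => by
      have := add_mem hy hz
      rwa [sub_add_sub_cancel] at this⟩
  exact hopen.mem_nhds (by simp)

lemma mem_closure_of_forall_kerSubspace {x : FilterwiseCompletion F I}
    {T : Set (FilterwiseCompletion F I)}
    (h : ∀ l, ∃ c ∈ T, x - c ∈ FilterwiseCompletion.kerSubspace F I l) : x ∈ closure T := by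
  refine mem_closure_iff.2 fun U hU hx => ?_
  obtain ⟨l, hl⟩ := hU x hx
  obtain ⟨c, hc, hxc⟩ := h l
  exact ⟨c, hl c (by simpa using neg_mem hxc), hc⟩

end Completion

section Opposite

variable {k : Type u} [Field k] {R S : Type u} [Ring R] [Algebra k R] [Ring S]
  {φ : S →ₙ+* R} {E : ℕ → R} {n : ℕ}

lemma op_mem_idealGen {x y : R} (hy : y ∈ idealGen x) :
    MulOpposite.op y ∈ idealGen (MulOpposite.op x) := by
  induction hy using AddSubgroup.closure_induction with
  | mem y hy =>
    obtain ⟨a, b, rfl⟩ := hy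
    rw [MulOpposite.op_mul, MulOpposite.op_mul, ← mul_assoc]
    exact mul_mul_mem_idealGen _ _
  | zero => exact zero_mem _
  | add y z _ _ hy hz => exact add_mem hy hz
  | neg y _ hy => exact neg_mem hy

lemma map_mem_idealGen {R' : Type u} [Ring R'] (f : R →+* R') {x y : R} (hy : y ∈ idealGen x) :
    f y ∈ idealGen (f x) := by
  induction hy using AddSubgroup.closure_induction with
  | mem y hy =>
    obtain ⟨a, b, rfl⟩ := hy
    rw [map_mul, map_mul]
    exact mul_mul_mem_idealGen _ _
  | zero => rw [map_zero]; exact zero_mem _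
  | add y z _ _ hy hz => rw [map_add]; exact add_mem hy hz
  | neg y _ hy => rw [map_neg]; exact neg_mem hy

lemma IsCornerSystem.op (hE : IsCornerSystem k φ E n) :
    IsCornerSystem k (NonUnitalRingHom.op φ) (fun m => MulOpposite.op (E m)) n where
  injective _ _ h := MulOpposite.unop_injective (hE.injective (MulOpposite.op_injective h))
  exists_eq x := by
    obtain ⟨s, hs⟩ := hE.exists_eq x.unop
    exact ⟨MulOpposite.op s, MulOpposite.unop_injective (hs.trans (mul_assoc _ _ _))⟩
  map_one := congrArg MulOpposite.op hE.map_one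
  mul_of_le h := congrArg MulOpposite.op (hE.mul_of_ge h)
  mul_of_ge h := congrArg MulOpposite.op (hE.mul_of_le h)
  exists_fg m m' := by
    obtain ⟨W, hW, hmem⟩ := hE.exists_fg m' m
    exact ⟨opSubspace W, hW.map _, fun x => ⟨_, hmem x.unop,
      MulOpposite.unop_injective (mul_assoc _ _ _)⟩⟩
  mem_idealGen m := op_mem_idealGen (hE.mem_idealGen m)

end Opposite

section Graded

variable {k : Type u} [Field k] [IsAlgClosed k] [CharZero k] {A : Type u} [Ring A] [Algebra k A]
  {𝒢 : ℤ → Submodule k A} [GradedAlgebra 𝒢] [∀ d, TopologicalSpace (𝒢 d)]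
  [∀ d, IsTopologicalAddGroup (𝒢 d)] [∀ d, ContinuousConstSMul k (𝒢 d)] [IsCompatible 𝒢]
  {h : 𝒢 0} {e : ℕ → A} {n : ℕ}

lemma IsSpectralFamily.hasUnity (he : IsSpectralFamily h e) (hA : IsQuasiFinite 𝒢)
    (hh : IsHamiltonian 𝒢 (h : A)) : HasUnity (finAlgebra 𝒢 h n) := by
  have hee := he.mul_of_le hA hh (le_refl n)
  refine ⟨⟨e n, (he.mem_finAlgebra_iff hA hh).2 (by rw [hee, hee])⟩, fun a => ?_⟩
  have ha := (he.mem_finAlgebra_iff hA hh).1 a.2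
  constructor <;> refine Subtype.ext ?_
  · change e n * (a : A) = a
    rw [← ha, ← mul_assoc, ← mul_assoc, hee]
  · change (a : A) * e n = a
    rw [← ha, mul_assoc, hee]

lemma IsSpectralFamily.coe_one (he : IsSpectralFamily h e) (hA : IsQuasiFinite 𝒢)
    (hh : IsHamiltonian 𝒢 (h : A)) (hU : HasUnity (finAlgebra 𝒢 h n)) :
    ((hU.choose : finAlgebra 𝒢 h n) : A) = e n := by
  have hee := he.mul_of_le hA hh (le_refl n)
  set u := hU.choose
  have h₁ := congrArg Subtype.val
    (hU.choose_spec ⟨e n, (he.mem_finAlgebra_iff hA hh).2 (by rw [hee, hee])⟩).2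
  have h₂ : e n * (u : A) = e n := h₁
  have ha := (he.mem_finAlgebra_iff hA hh).1 u.2
  rw [h₂, hee] at ha
  exact ha.symm

lemma IsSpectralFamily.leftIdeal_mul (he : IsSpectralFamily h e) (hA : IsQuasiFinite 𝒢)
    (hh : IsHamiltonian 𝒢 (h : A)) (m : ℕ) : ∀ a ∈ leftIdeal 𝒢 m, a * e m = 0 := by
  suffices H : leftIdeal 𝒢 m ≤ LinearMap.ker (LinearMap.mulRight k (e m)) from fun a ha => H ha
  exact iSup_le fun d b hb => he.clI_mul_eq_zero hA hh (d := d) hb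

lemma IsSpectralFamily.mul_rightIdeal (he : IsSpectralFamily h e) (hA : IsQuasiFinite 𝒢)
    (hh : IsHamiltonian 𝒢 (h : A)) (m : ℕ) : ∀ a ∈ rightIdeal 𝒢 m, e m * a = 0 := by
  suffices H : rightIdeal 𝒢 m ≤ LinearMap.ker (LinearMap.mulLeft k (e m)) from fun a ha => H ha
  rw [rightIdeal_eq]
  exact iSup_le fun d b hb => he.mul_clI_eq_zero hA hh (d := d) hb

variable (𝒢 h n) in
/-- The map from `A_n` to an algebra over `A`. -/
def finAlgebraMap (hU : HasUnity (finAlgebra 𝒢 h n)) {B : Type u} [Ring B] [Algebra k B]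
    (f : A →ₐ[k] B) : UnitalRing (finAlgebra 𝒢 h n) hU →ₙ+* B where
  toFun a := f (a : finAlgebra 𝒢 h n).1
  map_mul' _ _ := map_mul f _ _
  map_zero' := map_zero f
  map_add' _ _ := map_add f _ _

/-- By `hf` nothing new appears in `B` between two of the idempotents, and by `hinj` nothing is lost
in the corner, so the properties established in `A` carry over. This is applied to both completions.
-/
lemma IsSpectralFamily.isCornerSystem (he : IsSpectralFamily h e) (hA : IsQuasiFinite 𝒢)
    (hh : IsHamiltonian 𝒢 (h : A)) (hn : gap 𝒢 h ≤ n) (hU : HasUnity (finAlgebra 𝒢 h n))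
    {B : Type u} [Ring B] [Algebra k B] (f : A →ₐ[k] B)
    (hf : ∀ m m' x, ∃ a, f (e m) * x * f (e m') = f (e m * a * e m'))
    (hinj : ∀ a, f a = 0 → e n * a * e n = 0) :
    IsCornerSystem k (finAlgebraMap 𝒢 h n hU f) (fun m => f (e m)) n := by
  have hee := he.mul_of_le hA hh (le_refl n)
  have hone : finAlgebraMap 𝒢 h n hU f 1 = f (e n) := congrArg f (he.coe_one hA hh hU)
  refine { injective := ?_, exists_eq := fun x => ?_, map_one := hone, mul_of_le := fun hmj => ?_,
           mul_of_ge := fun hmj => ?_, exists_fg := fun m m' => ?_, mem_idealGen := fun m => ?_ }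
  · rw [injective_iff_map_eq_zero]
    intro a ha
    have := hinj _ ha
    rw [(he.mem_finAlgebra_iff hA hh).1 (a : finAlgebra 𝒢 h n).2] at this
    exact Subtype.ext this
  · obtain ⟨a, ha⟩ := hf n n x
    refine ⟨(⟨e n * a * e n, (he.mem_finAlgebra_iff hA hh).2 ?_⟩ : finAlgebra 𝒢 h n), ?_⟩
    · rw [← mul_assoc, ← mul_assoc, hee, mul_assoc, hee]
    · rw [hone, ha]; rfl
  · rw [← map_mul, he.mul_of_le hA hh hmj]
  · rw [← map_mul, he.mul_of_ge hA hh hmj]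
  · obtain ⟨W, hW, hmem⟩ := he.exists_fg hA hh m m'
    refine ⟨W.map f.toLinearMap, hW.map _, fun x => ?_⟩
    obtain ⟨a, ha⟩ := hf m m' x
    exact ⟨_, hmem a, ha.symm⟩
  · exact map_mem_idealGen (f : A →+* B) (he.mem_idealGen hA hh hn m)

variable (𝒢) in
/-- The canonical map from `A` to its left completion. -/
def toLeftCompletion : A →ₐ[k] LeftCompletion 𝒢 := completionMap (leftIdeal 𝒢) (exists_mem_filt 𝒢)

variable (𝒢) in
/-- The canonical map from `A` to its right completion. -/
def toRightCompletion : A →ₐ[k] RightCompletion 𝒢 :=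
  completionMap (rightIdeal 𝒢) (exists_mem_filtOpp 𝒢)

lemma IsSpectralFamily.isCornerSystem_left (he : IsSpectralFamily h e) (hA : IsQuasiFinite 𝒢)
    (hh : IsHamiltonian 𝒢 (h : A)) (hn : gap 𝒢 h ≤ n) (hU : HasUnity (finAlgebra 𝒢 h n)) :
    IsCornerSystem k (finAlgebraMap 𝒢 h n hU (toLeftCompletion 𝒢))
      (fun m => toLeftCompletion 𝒢 (e m)) n := by
  refine he.isCornerSystem hA hh hn hU _ (fun m m' x => ?_) fun a ha => ?_
  · obtain ⟨a, ha⟩ := exists_mul_completionMap (exists_mem_filt 𝒢) (he.leftIdeal_mul hA hh m') x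
    refine ⟨a, ?_⟩
    rw [mul_assoc, toLeftCompletion, ha, ← map_mul, mul_assoc]
  · rw [mul_assoc, he.leftIdeal_mul hA hh n a (mem_of_completionMap_eq_zero _ ha n), mul_zero]

lemma IsSpectralFamily.isCornerSystem_right (he : IsSpectralFamily h e) (hA : IsQuasiFinite 𝒢)
    (hh : IsHamiltonian 𝒢 (h : A)) (hn : gap 𝒢 h ≤ n) (hU : HasUnity (finAlgebra 𝒢 h n)) :
    IsCornerSystem k (finAlgebraMap 𝒢 h n hU (toRightCompletion 𝒢))
      (fun m => toRightCompletion 𝒢 (e m)) n := by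
  refine he.isCornerSystem hA hh hn hU _ (fun m m' x => ?_) fun a ha => ?_
  · obtain ⟨a, ha⟩ := exists_completionMap_mul (exists_mem_filtOpp 𝒢) (he.mul_rightIdeal hA hh m) x
    refine ⟨a, ?_⟩
    rw [toRightCompletion, ha, ← map_mul]
  · rw [he.mul_rightIdeal hA hh n a (mem_of_completionMap_eq_zero _ ha n), zero_mul]

lemma IsSpectralFamily.exists_one_sub_mem_leftIdeal (he : IsSpectralFamily h e)
    (hA : IsQuasiFinite 𝒢) (hh : IsHamiltonian 𝒢 (h : A)) (m : ℕ) :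
    ∃ j, 1 - e j ∈ leftIdeal 𝒢 m :=
  ⟨_, Submodule.mem_iSup_of_mem 0 (he.one_sub_mem hA hh le_rfl)⟩

lemma IsSpectralFamily.exists_one_sub_mem_rightIdeal (he : IsSpectralFamily h e)
    (hA : IsQuasiFinite 𝒢) (hh : IsHamiltonian 𝒢 (h : A)) (m : ℕ) :
    ∃ j, 1 - e j ∈ rightIdeal 𝒢 m := by
  refine ⟨m + gap 𝒢 h, ?_⟩
  rw [rightIdeal_eq]
  exact Submodule.mem_iSup_of_mem 0 (by simpa using he.one_sub_mem hA hh le_rfl)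

lemma IsSpectralFamily.exists_left_mul_eq (he : IsSpectralFamily h e) (hA : IsQuasiFinite 𝒢)
    (hh : IsHamiltonian 𝒢 (h : A)) (x : LeftCompletion 𝒢) (m : ℕ) :
    ∃ j, toLeftCompletion 𝒢 (e j) * (x * toLeftCompletion 𝒢 (e m)) =
      x * toLeftCompletion 𝒢 (e m) := by
  obtain ⟨a, ha⟩ := exists_mul_completionMap (exists_mem_filt 𝒢) (he.leftIdeal_mul hA hh m) x
  obtain ⟨j, hj⟩ := he.exists_forall_mul_eq_left hA hh a m
  refine ⟨j, ?_⟩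
  rw [toLeftCompletion, ha, ← map_mul, hj j le_rfl]

lemma IsSpectralFamily.exists_right_mul_eq (he : IsSpectralFamily h e) (hA : IsQuasiFinite 𝒢)
    (hh : IsHamiltonian 𝒢 (h : A)) (x : RightCompletion 𝒢) (m : ℕ) :
    ∃ j, toRightCompletion 𝒢 (e m) * x * toRightCompletion 𝒢 (e j) =
      toRightCompletion 𝒢 (e m) * x := by
  obtain ⟨a, ha⟩ := exists_completionMap_mul (exists_mem_filtOpp 𝒢) (he.mul_rightIdeal hA hh m) x
  obtain ⟨j, hj⟩ := he.exists_forall_mul_eq_right hA hh a m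
  refine ⟨j, ?_⟩
  rw [toRightCompletion, ha, ← map_mul, hj j le_rfl]

lemma IsSpectralFamily.isExhaustiveSystem_left (he : IsSpectralFamily h e) (hA : IsQuasiFinite 𝒢)
    (hh : IsHamiltonian 𝒢 (h : A)) :
    IsExhaustiveSystem (FilterwiseCompletion.kerSubspace (filt 𝒢) (leftIdeal 𝒢))
      fun m => toLeftCompletion 𝒢 (e m) where
  exists_mul_eq := he.exists_left_mul_eq hA hh
  exists_one_sub_mem m := by
    obtain ⟨j, hj⟩ := he.exists_one_sub_mem_leftIdeal hA hh m
    refine ⟨j, ?_⟩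
    rw [← map_one (toLeftCompletion 𝒢), ← map_sub]
    exact completionMap_mem_kerSubspace _ hj
  mul_eq_zero ha := kerSubspace_mul_completionMap _ (he.leftIdeal_mul hA hh _) ha

lemma IsSpectralFamily.isExhaustiveSystem_right (he : IsSpectralFamily h e)
    (hA : IsQuasiFinite 𝒢) (hh : IsHamiltonian 𝒢 (h : A)) :
    IsExhaustiveSystem (R := (RightCompletion 𝒢)ᵐᵒᵖ)
      (fun m => opSubspace (FilterwiseCompletion.kerSubspace (filtOpp 𝒢) (rightIdeal 𝒢) m))
      fun m => MulOpposite.op (toRightCompletion 𝒢 (e m)) where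
  exists_mul_eq a m := by
    obtain ⟨j, hj⟩ := he.exists_right_mul_eq hA hh a.unop m
    exact ⟨j, MulOpposite.unop_injective hj⟩
  exists_one_sub_mem m := by
    obtain ⟨j, hj⟩ := he.exists_one_sub_mem_rightIdeal hA hh m
    refine ⟨j, 1 - toRightCompletion 𝒢 (e j), ?_, rfl⟩
    rw [← map_one (toRightCompletion 𝒢), ← map_sub]
    exact completionMap_mem_kerSubspace _ hj
  mul_eq_zero := by
    rintro m _ ⟨a, ha, rfl⟩
    exact MulOpposite.unop_injective
      (completionMap_mul_kerSubspace _ (he.mul_rightIdeal hA hh _) ha)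

lemma filt_le_leftIdeal (m : ℕ) : filt 𝒢 (-(m : ℤ) - 1) ≤ leftIdeal 𝒢 m :=
  iSup₂_le fun d hd => le_iSup_of_le (f := fun d => clI 𝒢 m d) d (graded_le_clI 𝒢 hd)

lemma filtOpp_le_rightIdeal (m : ℕ) : filtOpp 𝒢 (-(m : ℤ) - 1) ≤ rightIdeal 𝒢 m := by
  rw [rightIdeal_eq]
  exact iSup₂_le fun d hd => le_iSup_of_le d (graded_le_clI_of_neg 𝒢 (by omega))

/-- Closeness in A(0) becomes closeness in the completion: 1 - e_j ∈ I_m(A(0)) is approximated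
modulo every I_l by elements of A · F_{-m-1} A. -/
lemma IsSpectralFamily.exists_one_sub_mem_closure_left (he : IsSpectralFamily h e)
    (hA : IsQuasiFinite 𝒢) (hh : IsHamiltonian 𝒢 (h : A)) (m : ℕ) :
    ∃ j, 1 - toLeftCompletion 𝒢 (e j) ∈ closure (Submodule.span k {y |
      ∃ a ∈ FilterwiseCompletion.filtration (filt 𝒢) (leftIdeal 𝒢) (-(m : ℤ) - 1),
        ∃ x, y = x * a} : Set (LeftCompletion 𝒢)) := by
  refine ⟨m + gap 𝒢 h, mem_closure_of_forall_kerSubspace fun l => ?_⟩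
  obtain ⟨c, hc, hl⟩ := exists_sub_mem_clI 𝒢 (he.one_sub_mem hA hh (m := m) le_rfl) l
  refine ⟨toLeftCompletion 𝒢 c, ?_, ?_⟩
  · have hc' := (mem_top_mul_filt_iff 𝒢 (degProd_le 𝒢 _ _ hc)).2 hc
    clear hc hl
    induction hc' using Submodule.mul_induction_on' with
    | mem_mul_mem x _ a ha =>
      rw [map_mul]
      exact Submodule.subset_span ⟨_, completionMap_mem_filtration _ ha, _, rfl⟩
    | add x _ y _ hx hy => rw [map_add]; exact add_mem hx hy
  · rw [← map_one (toLeftCompletion 𝒢), ← map_sub, ← map_sub]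
    exact completionMap_mem_kerSubspace _ (Submodule.mem_iSup_of_mem 0 hl)

lemma IsSpectralFamily.exists_one_sub_mem_closure_right (he : IsSpectralFamily h e)
    (hA : IsQuasiFinite 𝒢) (hh : IsHamiltonian 𝒢 (h : A)) (m : ℕ) :
    ∃ j, 1 - toRightCompletion 𝒢 (e j) ∈ closure (Submodule.span k {y |
      ∃ a ∈ FilterwiseCompletion.filtration (filtOpp 𝒢) (rightIdeal 𝒢) (-(m : ℤ) - 1),
        ∃ x, y = a * x} : Set (RightCompletion 𝒢)) := by
  refine ⟨m + gap 𝒢 h, mem_closure_of_forall_kerSubspace fun l => ?_⟩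
  obtain ⟨c, hc, hl⟩ := exists_sub_mem_clI 𝒢 (he.one_sub_mem hA hh (m := m) le_rfl) l
  refine ⟨toRightCompletion 𝒢 c, ?_, ?_⟩
  -- In degree 0 the two descriptions of the products agree without any shift of the index.
  · have hc' := (mem_filtOpp_mul_top_iff 𝒢 (p := -(m : ℤ) - 1) (degProd_le 𝒢 _ _ hc)).2
      (by rwa [zero_add])
    clear hc hl
    induction hc' using Submodule.mul_induction_on' with
    | mem_mul_mem a ha x _ =>
      rw [map_mul]
      exact Submodule.subset_span ⟨_, completionMap_mem_filtration _ ha, _, rfl⟩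
    | add x _ y _ hx hy => rw [map_add]; exact add_mem hx hy
  · rw [← map_one (toRightCompletion 𝒢), ← map_sub, ← map_sub]
    refine completionMap_mem_kerSubspace _ ?_
    rw [rightIdeal_eq]
    exact Submodule.mem_iSup_of_mem 0 (by simpa using hl)

/-- "Left" refers to the side of the modules: the left modules of coexhaustive type live over the
right completion. -/
lemma IsSpectralFamily.isCoexhaustiveSystem_left (he : IsSpectralFamily h e)
    (hA : IsQuasiFinite 𝒢) (hh : IsHamiltonian 𝒢 (h : A)) :
    IsCoexhaustiveSystem (FilterwiseCompletion.filtration (filtOpp 𝒢) (rightIdeal 𝒢))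
      fun m => toRightCompletion 𝒢 (e m) where
  exists_mul_eq := he.exists_right_mul_eq hA hh
  exists_one_sub_mem := he.exists_one_sub_mem_closure_right hA hh
  mul_eq_zero ha := completionMap_mul_kerSubspace _ (he.mul_rightIdeal hA hh _)
    (filtration_le_kerSubspace (filtOpp_le_rightIdeal _) ha)
  eventually_mul_eq_zero m x := (eventually_sub_mem_kerSubspace m x).mono fun _ hy =>
    completionMap_mul_kerSubspace _ (he.mul_rightIdeal hA hh _) hy

lemma IsSpectralFamily.isCoexhaustiveSystem_right (he : IsSpectralFamily h e)
    (hA : IsQuasiFinite 𝒢) (hh : IsHamiltonian 𝒢 (h : A)) :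
    IsCoexhaustiveSystem (R := (LeftCompletion 𝒢)ᵐᵒᵖ)
      (fun p => opSubspace (FilterwiseCompletion.filtration (filt 𝒢) (leftIdeal 𝒢) p))
      fun m => MulOpposite.op (toLeftCompletion 𝒢 (e m)) where
  exists_mul_eq a m := by
    obtain ⟨j, hj⟩ := he.exists_left_mul_eq hA hh a.unop m
    exact ⟨j, MulOpposite.unop_injective hj⟩
  exists_one_sub_mem m := by
    obtain ⟨j, hj⟩ := he.exists_one_sub_mem_closure_left hA hh m
    refine ⟨j, map_mem_closure (f := MulOpposite.op) (x := 1 - toLeftCompletion 𝒢 (e j))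
      MulOpposite.continuous_op hj fun y hy => ?_⟩
    induction hy using Submodule.span_induction with
    | mem y hy =>
      obtain ⟨a, ha, x, rfl⟩ := hy
      exact Submodule.subset_span ⟨MulOpposite.op a, ⟨a, ha, rfl⟩, MulOpposite.op x, rfl⟩
    | zero => exact zero_mem _
    | add y z _ _ hy hz => exact add_mem hy hz
    | smul c y _ hy => exact Submodule.smul_mem _ c hy
  mul_eq_zero := by
    rintro m _ ⟨a, ha, rfl⟩
    exact MulOpposite.unop_injective (kerSubspace_mul_completionMap _ (he.leftIdeal_mul hA hh _)
      (filtration_le_kerSubspace (filt_le_leftIdeal _) ha))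
  eventually_mul_eq_zero m x := by
    filter_upwards [MulOpposite.continuous_unop.continuousAt.eventually
      (eventually_sub_mem_kerSubspace m x.unop)] with y hy
    exact MulOpposite.unop_injective
      (kerSubspace_mul_completionMap _ (he.leftIdeal_mul hA hh _) hy)

end Graded

end

/-! ### Linear duality, transport along ring isomorphisms, and anti-involutions -/

section

section Duality

variable {k : Type u} [Field k] {S : Type u} [Ring S] [Algebra k S]

/-- The right action of `S` on the dual of a left `S`-module. -/
abbrev dualModule (k S N : Type u) [Field k] [Ring S] [Algebra k S] [AddCommGroup N] [Module k N]
    [Module S N] [IsScalarTower k S N] : Module Sᵐᵒᵖ (Module.Dual k N) where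
  smul s f := f.comp (Algebra.lsmul k k N s.unop)
  one_smul f := LinearMap.ext fun v => congrArg f (one_smul S v)
  mul_smul s t f := LinearMap.ext fun v => congrArg f (mul_smul t.unop s.unop v)
  smul_zero s := rfl
  smul_add s f g := rfl
  add_smul s t f := LinearMap.ext fun v => by
    change f ((s.unop + t.unop) • v) = f (s.unop • v) + f (t.unop • v)
    rw [add_smul, map_add]
  zero_smul f := LinearMap.ext fun v => by
    change f ((0 : S) • v) = 0
    rw [zero_smul, map_zero]

attribute [local instance] dualModule

section

variable {N N' : Type u} [AddCommGroup N] [Module k N] [Module S N] [IsScalarTower k S N]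
  [AddCommGroup N'] [Module k N'] [Module S N'] [IsScalarTower k S N']

lemma dual_op_smul_apply (s : Sᵐᵒᵖ) (f : Module.Dual k N) (v : N) :
    (s • f : Module.Dual k N) v = f (s.unop • v) := rfl

instance : IsScalarTower k Sᵐᵒᵖ (Module.Dual k N) :=
  ⟨fun c s f => LinearMap.ext fun v => by
    rw [dual_op_smul_apply, LinearMap.smul_apply, dual_op_smul_apply, MulOpposite.unop_smul,
      smul_assoc, map_smul]⟩

variable (k) in
/-- The transpose of an `S`-linear map. -/
def dualOpMap (f : N →ₗ[S] N') : Module.Dual k N' →ₗ[Sᵐᵒᵖ] Module.Dual k N where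
  toFun g := g.comp (f.restrictScalars k)
  map_add' _ _ := rfl
  map_smul' s g := LinearMap.ext fun v => congrArg g (map_smul f s.unop v).symm

lemma dualOpMap_apply (f : N →ₗ[S] N') (g : Module.Dual k N') (v : N) :
    dualOpMap k f g v = g (f v) := rfl

lemma dualOpMap_injective {f f' : N →ₗ[S] N'} (h : dualOpMap k f = dualOpMap k f') : f = f' := by
  refine LinearMap.ext fun v => sub_eq_zero.1 ((Module.forall_dual_apply_eq_zero_iff k _).1
    fun g => ?_)
  rw [map_sub, ← dualOpMap_apply, h, dualOpMap_apply, sub_self]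

/-- The preimage is the transpose of `G`, read through the identification of the finite-dimensional
N' with its bidual. -/
lemma dualOpMap_surjective [Module.Finite k N'] (G : Module.Dual k N' →ₗ[Sᵐᵒᵖ] Module.Dual k N) :
    ∃ f : N →ₗ[S] N', dualOpMap k f = G := by
  let G' : Module.Dual k N' →ₗ[k] Module.Dual k N := G.restrictScalars k
  let ev := Module.evalEquiv k N'
  let f : N → N' := fun v => ev.symm ((Module.Dual.eval k N v).comp G')
  have hf : ∀ (g : Module.Dual k N') v, g (f v) = G g v := fun g v => by
    have := LinearMap.congr_fun (ev.apply_symm_apply ((Module.Dual.eval k N v).comp G')) g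
    exact this
  have huniq : ∀ w w' : N', (∀ g : Module.Dual k N', g w = g w') → w = w' := fun w w' h =>
    sub_eq_zero.1 ((Module.forall_dual_apply_eq_zero_iff k _).1 fun g => by
      rw [map_sub, h, sub_self])
  refine ⟨⟨⟨f, fun v w => huniq _ _ fun g => ?_⟩, fun s v => huniq _ _ fun g => ?_⟩,
    LinearMap.ext fun g => LinearMap.ext fun v => hf g v⟩
  · rw [map_add, hf, hf, hf, map_add]
  · have h₁ := hf (MulOpposite.op s • g) v
    rw [map_smul] at h₁
    change g (s • f v) = G g (s • v) at h₁
    rw [RingHom.id_apply, h₁, ← hf]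

end

lemma finite_of_finite_scalars [Module.Finite k S] {N : Type u} [AddCommGroup N] [Module k N]
    [Module S N] [IsScalarTower k S N] [Module.Finite S N] : Module.Finite k N :=
  Module.Finite.trans S N

/-- The underlying vector space of an object of `ModuleCat S`. -/
abbrev moduleCatScalar (N : ModuleCat.{u} S) : Module k N := scalarModule k S N

attribute [local instance] moduleCatScalar

instance (N : ModuleCat.{u} S) : IsScalarTower k S N := scalarModule_isScalarTower k S N

lemma finite_dual [Module.Finite k S] {N : Type u} [AddCommGroup N] [Module k N]
    [Module S N] [IsScalarTower k S N] [Module.Finite S N] :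
    Module.Finite Sᵐᵒᵖ (Module.Dual k N) := by
  have : Module.Finite k N := finite_of_finite_scalars (S := S)
  exact Module.Finite.of_restrictScalars_finite k Sᵐᵒᵖ _

/-- The action of `S` on the dual of a right `S`-module. -/
abbrev dualModuleOfOp (k S N : Type u) [Field k] [Ring S] [Algebra k S] [AddCommGroup N]
    [Module k N] [Module Sᵐᵒᵖ N] [IsScalarTower k Sᵐᵒᵖ N] : Module S (Module.Dual k N) :=
  Module.compHom _ (RingEquiv.opOp S).toRingHom

theorem exists_duality [Module.Finite k S] :
    Nonempty ((finitelyGenerated S).FullSubcategoryᵒᵖ ≌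
      (finitelyGenerated Sᵐᵒᵖ).FullSubcategory) := by
  let Φ : (finitelyGenerated S).FullSubcategoryᵒᵖ ⥤ (finitelyGenerated Sᵐᵒᵖ).FullSubcategory :=
    { obj N := ⟨ModuleCat.of Sᵐᵒᵖ (Module.Dual k N.unop.obj), by
        have : Module.Finite S N.unop.obj := N.unop.property
        exact finite_dual⟩
      map f := ObjectProperty.homMk (ModuleCat.ofHom (dualOpMap k f.unop.hom.hom)) }
  have : Φ.Faithful := ⟨fun {N N'} f f' h => by
    have h' : dualOpMap k f.unop.hom.hom = dualOpMap k f'.unop.hom.hom :=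
      congrArg (fun g => g.hom.hom) h
    exact Quiver.Hom.unop_inj (ObjectProperty.hom_ext _ (ModuleCat.hom_ext
      (dualOpMap_injective h')))⟩
  have : Φ.Full := ⟨fun {N N'} G => by
    have : Module.Finite S N.unop.obj := N.unop.property
    have : Module.Finite k N.unop.obj := finite_of_finite_scalars (S := S)
    obtain ⟨f, hf⟩ := dualOpMap_surjective (k := k) (N := N'.unop.obj) (N' := N.unop.obj) G.hom.hom
    exact ⟨(ObjectProperty.homMk (ModuleCat.ofHom f)).op,
      ObjectProperty.hom_ext _ (ModuleCat.hom_ext hf)⟩⟩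
  have : Φ.EssSurj := ⟨fun N' => by
    have : Module.Finite Sᵐᵒᵖ N'.obj := N'.property
    have : Module.Finite k N'.obj := finite_of_finite_scalars (S := Sᵐᵒᵖ)
    let X := Module.Dual k N'.obj
    -- The dual has a `k`-action as a space of functionals and another through `S`; a separate
    -- module M with an additive identification keeps them apart until `j'` shows that they agree.
    obtain ⟨M, j, hj⟩ : ∃ (M : ModuleCat.{u} S) (j : M ≃+ X), ∀ (s : S) (f : M) (v : N'.obj),
        j (s • f) v = j f (MulOpposite.op s • v) := by
      let _ : Module S X := dualModuleOfOp k S N'.obj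
      exact ⟨ModuleCat.of S X, AddEquiv.refl X, fun _ _ _ => rfl⟩
    let j' : M ≃ₗ[k] X :=
      { j with
        map_smul' := fun c f => LinearMap.ext fun v => by
          change j (algebraMap k S c • f) v = c * j f v
          rw [hj, ← MulOpposite.algebraMap_apply, algebraMap_smul, map_smul]
          rfl }
    have hfink : Module.Finite k M := Module.Finite.equiv j'.symm
    have hfin : Module.Finite S M := Module.Finite.of_restrictScalars_finite k S M
    let ev : N'.obj ≃ₗ[k] Module.Dual k M := (Module.evalEquiv k N'.obj).trans j'.dualMap
    let ev' : N'.obj ≃ₗ[Sᵐᵒᵖ] Module.Dual k M :=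
      { ev with map_smul' := fun s v => LinearMap.ext fun f => (hj s.unop f v).symm }
    exact ⟨Opposite.op ⟨M, hfin⟩, ⟨ObjectProperty.isoMk _ ev'.symm.toModuleIso⟩⟩⟩
  have : Φ.IsEquivalence := {}
  exact ⟨Φ.asEquivalence⟩

end Duality

section RingEquiv

variable {S T : Type u} [Ring S] [Ring T]

theorem nonempty_equivalence_of_ringEquiv (f : S ≃+* T) :
    Nonempty ((finitelyGenerated S).FullSubcategory ≌ (finitelyGenerated T).FullSubcategory) := by
  let Ψ := ModuleCat.restrictScalarsEquivalenceOfRingEquiv.{u} f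
  have hiso : (finitelyGenerated S).IsClosedUnderIsomorphisms := ⟨fun {X Y} e hX => by
    have : Module.Finite S X := hX
    exact Module.Finite.equiv e.toLinearEquiv⟩
  have hP : (finitelyGenerated S).inverseImage Ψ.functor = finitelyGenerated T := by
    ext M
    let _ : Module S M := Module.compHom M (f : S →+* T)
    constructor
    · intro hM
      have : Module.Finite S M := hM
      obtain ⟨t, ht⟩ := this
      refine ⟨t, eq_top_iff.2 fun v _ => ?_⟩
      have hv : v ∈ Submodule.span S (t : Set M) := ht ▸ trivial
      induction hv using Submodule.span_induction with
      | mem v hv => exact Submodule.subset_span hv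
      | zero => exact zero_mem _
      | add v w _ _ hv hw => exact add_mem (hv trivial) (hw trivial)
      | smul s v _ hv => exact Submodule.smul_mem _ (f s) (hv trivial)
    · intro hM
      have : Module.Finite T M := hM
      obtain ⟨t, ht⟩ := this
      change Module.Finite S M
      refine ⟨t, eq_top_iff.2 fun v _ => ?_⟩
      have hv : v ∈ Submodule.span T (t : Set M) := ht ▸ trivial
      induction hv using Submodule.span_induction with
      | mem v hv => exact Submodule.subset_span hv
      | zero => exact zero_mem _
      | add v w _ _ hv hw => exact add_mem (hv trivial) (hw trivial)
      | smul s v _ hv =>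
        have e : s • v = f.symm s • v := by
          change s • v = f (f.symm s) • v
          rw [f.apply_symm_apply]
        rw [e]
        exact Submodule.smul_mem _ _ (hv trivial)
  exact ⟨(Ψ.congrFullSubcategory hP).symm⟩

end RingEquiv

section AntiInvolution

variable {k : Type u} [Field k] {A : Type u} [Ring A] [Algebra k A]

/-- As θ reverses products and fixes the powers of h - x, it exchanges the left and the right
eigenvalue conditions. -/
lemma map_genEig_mem {θ : A →ₗ[k] A} (hmul : ∀ a b, θ (a * b) = θ b * θ a)
    (hone : θ 1 = 1) {h : A} (hh : θ h = h) {x y : k} {a : A} (ha : a ∈ genEig h x y) :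
    θ a ∈ genEig h y x := by
  have hpow : ∀ (x : k) (r : ℕ), θ ((h - algebraMap k A x) ^ r) = (h - algebraMap k A x) ^ r := by
    intro x r
    induction r with
    | zero => simpa using hone
    | succ r ih =>
      rw [pow_succ, hmul, ih, map_sub, hh, Algebra.algebraMap_eq_smul_one, map_smul, hone,
        ← pow_succ']
      exact pow_succ _ _
  obtain ⟨r, h₁, h₂⟩ := ha
  refine ⟨r, ?_, ?_⟩
  · rw [← hpow y r, ← hmul, h₂, map_zero]
  · rw [← hpow x r, ← hmul, h₁, map_zero]

lemma map_cornerAlgebra_mem {θ : A →ₗ[k] A} (hmul : ∀ a b, θ (a * b) = θ b * θ a)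
    (hone : θ 1 = 1) {h : A} (hh : θ h = h) {Γ : Set k} {a : A} (ha : a ∈ cornerAlgebra h Γ) :
    θ a ∈ cornerAlgebra h Γ := by
  suffices H : (⨆ x ∈ Γ, ⨆ y ∈ Γ, genEig h x y : Submodule k A) ≤
      (⨆ x ∈ Γ, ⨆ y ∈ Γ, genEig h x y : Submodule k A).comap θ from H ha
  exact iSup₂_le fun x hx => iSup₂_le fun y hy => fun a ha =>
    genEig_le_cornerAlgebra hy hx (map_genEig_mem hmul hone hh ha)

lemma nonempty_ringEquiv_op {θ : A →ₗ[k] A} (hinv : ∀ a, θ (θ a) = a)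
    (hmul : ∀ a b, θ (a * b) = θ b * θ a) {h : A} (hh : θ h = h) {Γ : Set k}
    (hU : HasUnity (cornerAlgebra h Γ)) :
    Nonempty (UnitalRing (cornerAlgebra h Γ) hU ≃+* (UnitalRing (cornerAlgebra h Γ) hU)ᵐᵒᵖ) := by
  -- Unitality follows from the other properties: 1 = θ(θ(1) · 1) = θ(1) θ(θ(1)) = θ(1).
  have hone : θ 1 = 1 := by
    have := hmul (θ 1) 1
    rw [mul_one, hinv, mul_one] at this
    exact this.symm
  let f : cornerAlgebra h Γ → cornerAlgebra h Γ :=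
    fun a => ⟨θ a, map_cornerAlgebra_mem hmul hone hh a.2⟩
  have hf : ∀ a, f (f a) = a := fun a => Subtype.ext (hinv a)
  exact ⟨{
    toFun := fun a => MulOpposite.op (f a)
    invFun := fun a => f a.unop
    left_inv := hf
    right_inv := fun a => MulOpposite.unop_injective (hf a.unop)
    map_mul' := fun a b => MulOpposite.unop_injective
      (Subtype.ext (hmul (a : cornerAlgebra h Γ).1 (b : cornerAlgebra h Γ).1))
    map_add' := fun a b => MulOpposite.unop_injective
      (Subtype.ext (map_add θ (a : cornerAlgebra h Γ).1 (b : cornerAlgebra h Γ).1)) }⟩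

noncomputable instance (B : NonUnitalSubalgebra k A) (hB : HasUnity B) :
    Algebra k (UnitalRing B hB) :=
  let _ : Module k (UnitalRing B hB) := inferInstanceAs (Module k B)
  Algebra.ofModule (fun c a b => smul_mul_assoc (α := k) (β := B) c a b)
    (fun c a b => mul_smul_comm (β := B) c a b)

end AntiInvolution

end

section

lemma IsSpectralFamily.finite_unitalRing {k : Type u} [Field k] [IsAlgClosed k] [CharZero k]
    {A : Type u} [Ring A] [Algebra k A] {𝒢 : ℤ → Submodule k A} [GradedAlgebra 𝒢]
    [∀ d, TopologicalSpace (𝒢 d)] [∀ d, IsTopologicalAddGroup (𝒢 d)]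
    [∀ d, ContinuousConstSMul k (𝒢 d)] [IsCompatible 𝒢] {h : 𝒢 0} {e : ℕ → A} {n : ℕ}
    (he : IsSpectralFamily h e) (hA : IsQuasiFinite 𝒢) (hh : IsHamiltonian 𝒢 (h : A))
    (hU : HasUnity (finAlgebra 𝒢 h n)) : Module.Finite k (UnitalRing (finAlgebra 𝒢 h n) hU) := by
  obtain ⟨W, hW, hmem⟩ := he.exists_fg hA hh n n
  have : Module.Finite k W := Module.Finite.iff_fg.2 hW
  let f : UnitalRing (finAlgebra 𝒢 h n) hU →ₗ[k] W :=
    { toFun := fun a => ⟨(a : finAlgebra 𝒢 h n).1, by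
        rw [← (he.mem_finAlgebra_iff hA hh).1 (a : finAlgebra 𝒢 h n).2]
        exact hmem _⟩
      map_add' := fun _ _ => rfl
      map_smul' := fun _ _ => rfl }
  exact Module.Finite.of_injective f fun a b hab => by
    have hab' := congrArg Subtype.val hab
    exact Subtype.ext hab'

end

end QuasiFinite

/-! ### Assembly of the theorem -/

open QuasiFinite in
theorem mainTheorem8 {k A : Type u} [Field k] [IsAlgClosed k] [CharZero k] [Ring A] [Algebra k A]
    (𝒢 : ℤ → Submodule k A) [GradedAlgebra 𝒢] [∀ d, TopologicalSpace (𝒢 d)]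
    [∀ d, IsTopologicalAddGroup (𝒢 d)] [∀ d, ContinuousConstSMul k (𝒢 d)]
    [QuasiFinite.IsCompatible 𝒢] (hA : QuasiFinite.IsQuasiFinite 𝒢)
    (h : 𝒢 0) (hh : QuasiFinite.IsHamiltonian 𝒢 (h : A))
    (n : ℕ) (hn : QuasiFinite.gap 𝒢 h ≤ n) :
    ∃ hU : QuasiFinite.HasUnity (QuasiFinite.finAlgebra 𝒢 h n),
      (∀ i j, Nonempty (QuasiFinite.catL 𝒢 h n hU i ≌ QuasiFinite.catL 𝒢 h n hU j)) ∧
      (∀ i j, Nonempty (QuasiFinite.catR 𝒢 h n hU i ≌ QuasiFinite.catR 𝒢 h n hU j)) ∧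
      (∀ i j, Nonempty ((QuasiFinite.catL 𝒢 h n hU i)ᵒᵖ ≌ QuasiFinite.catR 𝒢 h n hU j)) ∧
      ((∃ θ : A →ₗ[k] A, QuasiFinite.IsAntiInvolution 𝒢 (h : A) θ) →
        ∀ i j, Nonempty (QuasiFinite.catL 𝒢 h n hU i ≌ QuasiFinite.catR 𝒢 h n hU j)) := by
  obtain ⟨e, he⟩ := exists_isSpectralFamily hA hh
  have hU : HasUnity (finAlgebra 𝒢 h n) := he.hasUnity hA hh
  -- All categories are compared with the modules over A_n, so duality and anti-involution are
  -- needed only there.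
  have hL : ∀ i, Nonempty (catL 𝒢 h n hU i ≌ catL3 𝒢 h n hU) := by
    intro i
    fin_cases i
    · exact (he.isCornerSystem_left hA hh hn hU).exhaustive_equivalence
        (he.isExhaustiveSystem_left hA hh)
    · exact (he.isCornerSystem_right hA hh hn hU).coexhaustive_equivalence
        (he.isCoexhaustiveSystem_left hA hh)
    · exact ⟨CategoryTheory.Equivalence.refl⟩
  have hR : ∀ i, Nonempty (catR 𝒢 h n hU i ≌ catR3 𝒢 h n hU) := by
    intro i
    fin_cases i
    · exact (he.isCornerSystem_right hA hh hn hU).op.exhaustive_equivalence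
        (he.isExhaustiveSystem_right hA hh)
    · exact (he.isCornerSystem_left hA hh hn hU).op.coexhaustive_equivalence
        (he.isCoexhaustiveSystem_right hA hh)
    · exact ⟨CategoryTheory.Equivalence.refl⟩
  refine ⟨hU, fun i j => ⟨(hL i).some.trans (hL j).some.symm⟩,
    fun i j => ⟨(hR i).some.trans (hR j).some.symm⟩, fun i j => ?_, ?_⟩
  · have := he.finite_unitalRing hA hh hU
    obtain ⟨D⟩ : Nonempty ((catL3 𝒢 h n hU)ᵒᵖ ≌ catR3 𝒢 h n hU) := exists_duality (k := k)
    exact ⟨((hL i).some.op.trans D).trans (hR j).some.symm⟩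
  · rintro ⟨θ, hθ⟩ i j
    obtain ⟨f⟩ := nonempty_ringEquiv_op hθ.involutive hθ.map_mul hθ.map_ham hU
    obtain ⟨D⟩ : Nonempty (catL3 𝒢 h n hU ≌ catR3 𝒢 h n hU) :=
      nonempty_equivalence_of_ringEquiv f
    exact ⟨((hL i).some.trans D).trans (hR j).some.symm⟩
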